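/- Let $A$ be a finitely generated commutative $\mathbb{C}$-algebra and let $P\to A$ be a finite polynomial dg resolution: $P=\mathbb{C}[x_1,\dots,x_r]$ is the free supercommutative algebra on finitely many generators of integer degrees $\deg x_i\le 0$ (parity = degree mod 2), with a differential $\partial=\sum_i f_i\partial_{x_i}$ (a superderivation of degree $1$ with $\partial^2=0$), and $P\to A$ is a quasi-isomorphism of dg algebras, $A$ being placed in degree $0$ with zero differential. Let $\mathcal{D}_P$ be the dg algebra of differential operators on $P$, i.e. the algebra of operators on $P$ generated by multiplications and superderivations, with $\deg\partial_{x_i}=-\deg x_i$ and differential $[\partial,\cdot]$ (supercommutator). Let $\mathcal{D}^{ch}_P$ be the dg vertex (super)algebra of chiral differential operators: its underlying space is the polynomial superalgebra in the jets $x_i^{(n)},\partial_{x_i}^{(n)}$, $n\ge 0$, with vacuum $1$. For $n\ge0$, $x_{i(-n-1)}$ and $\partial_{x_i(-n-1)}$ are multiplication by $x_i^{(n)}$ and $\partial_{x_i}^{(n)}$, and the generators have the only nontrivial supercommutators $[\partial_{x_i(m)},x_{j(n-1)}]=\delta_{ij}\delta_{m,-n}$ (so $x_{i(n)}1=\partial_{x_i(n)}1=0$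 for $n\ge 0$). The field of a monomial $g_1^{(n_1)}\cdots g_s^{(n_s)}$ is the normally ordered product of the fields $\frac1{n_k!}\partial_z^{n_k}g_k(z)$. Its differential is $\partial^{ch}=\big(\sum_i f_{i(-1)}\partial_{x_i}\big)_{(0)}$. A dg module over either algebra is a $\mathbb{Z}$-graded module with a square-zero differential of degree $1$ that satisfies the graded Leibniz rule; morphisms are the module maps of degree $0$ that commute with the differentials. A dg $\mathcal{D}^{ch}_P$-module $\mathcal{M}$ is *bounded* if for each $m\in\mathcal{M}$ there is $N>0$ such that $x_{i(n-1)}^N m=\partial_{x_i(n)}^N m=0$ for all $i$ and all $n>0$. Its space of singular vectors is $$\mathrm{Sing}\,\mathcal{M}=\{m\in\mathcal{M}\;:\;x_{i(n-1)}m=\partial_{x_i(n)}m=0\text{ for all } i\text{ and all }n>0\}.$$ Lemma. The subspace $\mathrm{Sing}\,\mathcal{M}$, with the restricted grading and differential and with $x_i$, $\partial_{x_i}$ acting by $x_{i(-1)}$, $\partial_{x_i(0)}$, is a dg $\mathcal{D}_P$-module, and the assignment $\mathcal{M}\mapsto\mathrm{Sing}\,\mathcal{M}$ (morphisms being restricted)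 defines an equivalence of the category of bounded dg $\mathcal{D}^{ch}_P$-modules and the category of dg $\mathcal{D}_P$-modules. The inverse is induction. Let $\hat{\mathfrak a}$ be the Lie superalgebra with basis $a^i_n,b^i_n,C$ ($n\in\mathbb{Z}$, $1\le i\le r$; $a^i_n$ and $b^i_n$ have the parity of $x_i$ and $C$ is even), and with brackets $[a^i_n,b^j_m]=\delta_{ij}\delta_{n,-m}C$, all other brackets of $a$'s, $b$'s and $C$ being zero. It acts on any $\mathcal{D}^{ch}_P$-module by $a^i_n\mapsto\partial_{x_i(n)}$, $b^i_n\mapsto x_{i(n-1)}$, $C\mapsto\mathrm{Id}$. Let $\hat{\mathfrak a}_{\ge}$ be the subalgebra spanned by $C$ and the $a^i_n,b^i_n$ with $n\ge0$; it acts on a $\mathcal{D}_P$-module $N$ by $a^i_0\mapsto\partial_{x_i}$, $b^i_0\mapsto x_i$, $C\mapsto \mathrm{Id}$, and by $0$ for $a^i_n,b^i_n$ with $n>0$. Then, as an $\hat{\mathfrak a}$-module, the value of the inverse equivalence at $N$ is $\mathrm{Ind}_{\hat{\mathfrak a}_\ge}^{\hat{\mathfrak a}}N=U(\hat{\mathfrak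 a})\otimes_{U(\hat{\mathfrak a}_\ge)}N$, by an isomorphism under which $1\otimes n$ corresponds to the image of $n$ in the space of singular vectors under the natural isomorphism (the unit/counit of the equivalence). -/

import Mathlib

open CategoryTheory
open scoped TensorProduct VertexOperator

universe u

noncomputable section

/-! ### Polynomial superalgebras

All signs are governed by a `ℤ`-grading, the parity being the degree modulo 2. -/

/-- The Koszul sign `(-1)^k`. -/
def sgn (k : ℤ) : ℂ := (-1) ^ k

lemma sgn_mul_self (k : ℤ) : sgn k * sgn k = 1 := by
  simp [sgn, ← mul_zpow]

lemma sgn_add (k l : ℤ) : sgn (k + l) = sgn k * sgn l := by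
  simp [sgn, zpow_add₀]

lemma sgn_neg (k : ℤ) : sgn (-k) = sgn k := by
  simp only [sgn, zpow_neg]
  rcases Int.even_or_odd k with h | h <;> simp [h.neg_one_zpow]

/-- Supercommutativity of the generators: `x y = (-1)^{|x||y|} y x`. -/
inductive SuperRel {X : Type} (deg : X → ℤ) : FreeAlgebra ℂ X → FreeAlgebra ℂ X → Prop
  | comm (x y : X) : SuperRel deg (FreeAlgebra.ι ℂ x * FreeAlgebra.ι ℂ y)
      (sgn (deg x * deg y) • (FreeAlgebra.ι ℂ y * FreeAlgebra.ι ℂ x))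

/-- The polynomial superalgebra `ℂ[X]` on graded generators: ordinary polynomials in the generators
of even degree tensored with the Grassmann algebra on the generators of odd degree. -/
def SuperPoly {X : Type} (deg : X → ℤ) : Type := RingQuot (SuperRel deg)

instance {X : Type} (deg : X → ℤ) : Ring (SuperPoly deg) :=
  inferInstanceAs (Ring (RingQuot (SuperRel deg)))

instance {X : Type} (deg : X → ℤ) : Algebra ℂ (SuperPoly deg) :=
  inferInstanceAs (Algebra ℂ (RingQuot (SuperRel deg)))

namespace SuperPoly

variable {X : Type} (deg : X → ℤ)

/-- The quotient map from the free algebra. -/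
def mk : FreeAlgebra ℂ X →ₐ[ℂ] SuperPoly deg := RingQuot.mkAlgHom ℂ (SuperRel deg)

/-- The generator `x` of `ℂ[X]`. -/
def gen (x : X) : SuperPoly deg := mk deg (FreeAlgebra.ι ℂ x)

lemma gen_mul_gen (x y : X) :
    gen deg x * gen deg y = sgn (deg x * deg y) • (gen deg y * gen deg x) := by
  have h : mk deg _ = mk deg _ := RingQuot.mkAlgHom_rel ℂ (SuperRel.comm (deg := deg) x y)
  simpa [gen] using h

variable {deg} in
/-- The universal property of `ℂ[X]`. -/
def lift {B : Type*} [Ring B] [Algebra ℂ B] (f : X → B)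
    (hf : ∀ x y, f x * f y = sgn (deg x * deg y) • (f y * f x)) : SuperPoly deg →ₐ[ℂ] B :=
  RingQuot.liftAlgHom ℂ ⟨FreeAlgebra.lift ℂ f, by
    rintro _ _ ⟨x, y⟩
    simpa using hf x y⟩

variable {deg} in
@[simp] lemma lift_gen {B : Type*} [Ring B] [Algebra ℂ B] (f : X → B)
    (hf : ∀ x y, f x * f y = sgn (deg x * deg y) • (f y * f x)) (x : X) :
    lift f hf (gen deg x) = f x := by
  have h := RingQuot.liftAlgHom_mkAlgHom_apply ℂ (s := SuperRel deg) (FreeAlgebra.lift ℂ f) (by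
    rintro _ _ ⟨x, y⟩
    simpa using hf x y) (FreeAlgebra.ι ℂ x)
  rw [FreeAlgebra.lift_ι_apply] at h
  exact h

variable {deg} in
lemma gen_induction {C : SuperPoly deg → Prop} (one : C 1)
    (add : ∀ p q, C p → C q → C (p + q)) (smul : ∀ (c : ℂ) p, C p → C (c • p))
    (gen_mul : ∀ x p, C p → C (gen deg x * p)) (p : SuperPoly deg) : C p := by
  obtain ⟨a, rfl⟩ : ∃ a, mk deg a = p := RingQuot.mkAlgHom_surjective ℂ (SuperRel deg) p
  have key : ∀ a : FreeAlgebra ℂ X, ∀ q, C q → C (mk deg a * q) := by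
    intro a
    induction a using FreeAlgebra.induction with
    | grade0 r =>
      intro q hq
      rw [AlgHom.commutes, ← Algebra.smul_def]
      exact smul r q hq
    | grade1 x => exact fun q hq => gen_mul x q hq
    | mul a b ha hb =>
      intro q hq
      rw [map_mul, mul_assoc]
      exact ha _ (hb _ hq)
    | add a b ha hb =>
      intro q hq
      rw [map_add, add_mul]
      exact add _ _ (ha _ hq) (hb _ hq)
  simpa using key a 1 one

/-- The homogeneous component of degree `k`: the span of the monomials of degree `k`. -/
def homog (k : ℤ) : Submodule ℂ (SuperPoly deg) :=
  Submodule.span ℂ {p | ∃ l : List X, (l.map deg).sum = k ∧ p = (l.map (gen deg)).prod}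

/-- `D` is a superderivation of degree `δ`:
`D(ab) = D(a) b + (-1)^{δ|a|} a D(b)` and `|D a| = |a| + δ`. -/
structure IsSuperDerivation (δ : ℤ) (D : Module.End ℂ (SuperPoly deg)) : Prop where
  map_homog : ∀ k, ∀ a ∈ homog deg k, D a ∈ homog deg (k + δ)
  leibniz : ∀ k, ∀ a ∈ homog deg k, ∀ b, D (a * b) = D a * b + sgn (δ * k) • (a * D b)

/-- The automorphism `a ↦ (-1)^{δ|a|} a`. -/
def twist (δ : ℤ) : SuperPoly deg →ₐ[ℂ] SuperPoly deg :=
  lift (fun x => sgn (δ * deg x) • gen deg x) (fun x y => by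
    simp only [smul_mul_smul_comm]
    rw [gen_mul_gen, smul_smul, smul_smul, mul_comm (sgn (δ * deg x)),
      mul_comm (sgn (deg x * deg y))])

open Classical in
/-- The homomorphism `a ↦ ((±a, ∂a/∂y), (0, a))` to `2 × 2` matrices, which encodes the partial
derivative along the generator `y` by its values on the generators. -/
def pderivMatrix (y : X) : SuperPoly deg →ₐ[ℂ] Matrix (Fin 2) (Fin 2) (SuperPoly deg) :=
  lift (fun x => !![sgn (deg y * deg x) • gen deg x, if x = y then 1 else 0; 0, gen deg x])
    (fun x z => by
      have h1 := gen_mul_gen deg x z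
      have hs : ∀ k : ℤ, sgn k * sgn k = 1 := sgn_mul_self
      ext i j
      fin_cases i <;> fin_cases j <;>
        simp only [Matrix.mul_apply, Matrix.smul_apply, Fin.sum_univ_two, Fin.zero_eta,
          Fin.mk_one, Matrix.of_apply, Matrix.cons_val', Matrix.cons_val_zero,
          Matrix.cons_val_one, Matrix.cons_val_fin_one, mul_zero, add_zero, zero_mul, zero_add,
          smul_zero]
      · simp only [smul_mul_smul_comm]
        rw [h1, smul_smul, smul_smul, mul_comm (sgn (deg y * deg x)),
          mul_comm (sgn (deg x * deg z))]
      · by_cases hx : x = y <;> by_cases hz : z = y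
        · subst hx; subst hz
          simp [smul_smul, smul_add, hs, add_comm]
        · subst hx
          simp [hz, smul_smul, hs]
        · subst hz
          simp [hx, mul_comm (deg z)]
        · simp [hx, hz]
      · exact h1)

/-- The partial (super)derivative `∂/∂y` along the generator `y`: the superderivation of degree
`-deg y` with `∂x/∂y = δ_{xy}`. -/
def pderiv (y : X) : Module.End ℂ (SuperPoly deg) where
  toFun p := pderivMatrix deg y p 0 1
  map_add' := by simp
  map_smul' := by simp

@[simp] lemma twist_gen (δ : ℤ) (x : X) :
    twist deg δ (gen deg x) = sgn (δ * deg x) • gen deg x := by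
  simp [twist]

open Classical in
@[simp] lemma pderiv_gen (x y : X) : pderiv deg y (gen deg x) = if x = y then 1 else 0 := by
  simp [pderiv, pderivMatrix]

@[simp] lemma pderiv_one (y : X) : pderiv deg y 1 = 0 := by
  simp [pderiv]

open Classical in
lemma pderivMatrix_apply (y : X) (p : SuperPoly deg) :
    pderivMatrix deg y p 0 0 = twist deg (deg y) p ∧ pderivMatrix deg y p 1 0 = 0 ∧
      pderivMatrix deg y p 1 1 = p := by
  induction p using gen_induction with
  | one => simp
  | add p q hp hq => simp [hp, hq]
  | smul c p hp => simp [hp]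
  | gen_mul x p hp =>
    have hg : pderivMatrix deg y (gen deg x) =
        !![sgn (deg y * deg x) • gen deg x, if x = y then 1 else 0; 0, gen deg x] := by
      simp [pderivMatrix]
    simp [map_mul, Matrix.mul_apply, Fin.sum_univ_two, hp, hg]

lemma pderiv_mul (y : X) (p q : SuperPoly deg) :
    pderiv deg y (p * q) = pderiv deg y p * q + twist deg (deg y) p * pderiv deg y q := by
  have hp := pderivMatrix_apply deg y p
  have hq := pderivMatrix_apply deg y q
  simp only [pderiv, LinearMap.coe_mk, AddHom.coe_mk, map_mul, Matrix.mul_apply,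
    Fin.sum_univ_two, hp, hq]
  rw [add_comm]

lemma twist_of_mem (δ k : ℤ) (a : SuperPoly deg) (ha : a ∈ homog deg k) :
    twist deg δ a = sgn (δ * k) • a := by
  have key : ∀ l : List X, twist deg δ (l.map (gen deg)).prod =
      sgn (δ * (l.map deg).sum) • (l.map (gen deg)).prod := by
    intro l
    induction l with
    | nil => simp [sgn]
    | cons x l ih =>
      simp only [List.map_cons, List.prod_cons, List.sum_cons, map_mul, twist_gen, ih, mul_add,
        sgn_add, smul_mul_smul_comm]
  induction ha using Submodule.span_induction with
  | mem p hp => obtain ⟨l, rfl, rfl⟩ := hp; exact key l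
  | zero => simp
  | add p q _ _ hp hq => rw [map_add, hp, hq, smul_add]
  | smul c p _ hp => rw [map_smul, hp, smul_comm]

lemma gen_mul_mem (x : X) (k : ℤ) (a : SuperPoly deg) (ha : a ∈ homog deg k) :
    gen deg x * a ∈ homog deg (deg x + k) := by
  induction ha using Submodule.span_induction with
  | mem p hp =>
    obtain ⟨l, rfl, rfl⟩ := hp
    exact Submodule.subset_span ⟨x :: l, by simp, by simp⟩
  | zero => simp
  | add p q _ _ hp hq => rw [mul_add]; exact add_mem hp hq
  | smul c p _ hp => rw [mul_smul_comm]; exact Submodule.smul_mem _ _ hp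

lemma isSuperDerivation_pderiv (y : X) : IsSuperDerivation deg (-deg y) (pderiv deg y) where
  map_homog k a ha := by
    have key : ∀ l : List X,
        pderiv deg y (l.map (gen deg)).prod ∈ homog deg ((l.map deg).sum + -deg y) := by
      intro l
      induction l with
      | nil => simp
      | cons x l ih =>
        simp only [List.map_cons, List.prod_cons, List.sum_cons, pderiv_mul, pderiv_gen, twist_gen]
        refine add_mem ?_ ?_
        · split_ifs with h
          · subst h
            rw [one_mul]
            exact Submodule.subset_span ⟨l, by ring, rfl⟩
          · simp
        · rw [smul_mul_assoc, add_assoc]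
          exact Submodule.smul_mem _ _ (gen_mul_mem deg x _ _ ih)
    induction ha using Submodule.span_induction with
    | mem p hp => obtain ⟨l, rfl, rfl⟩ := hp; exact key l
    | zero => simp
    | add p q _ _ hp hq => rw [map_add]; exact add_mem hp hq
    | smul c p _ hp => rw [map_smul]; exact Submodule.smul_mem _ _ hp
  leibniz k a ha b := by
    rw [pderiv_mul, twist_of_mem deg _ k a ha, smul_mul_assoc, neg_mul, sgn_neg]

/-! ### The algebra of differential operators -/

/-- The algebra `𝒟_P` of differential operators on `P = ℂ[X]`: the algebra of operators generated by
the multiplications by elements of `P` and the superderivations of `P`. -/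
def diffOps : Subalgebra ℂ (Module.End ℂ (SuperPoly deg)) :=
  Algebra.adjoin ℂ (Set.range (LinearMap.mulLeft ℂ) ∪ {D | ∃ δ, IsSuperDerivation deg δ D})

/-- Multiplication by `p`, as a differential operator. -/
def mulOp (p : SuperPoly deg) : diffOps deg :=
  ⟨LinearMap.mulLeft ℂ p, Algebra.subset_adjoin (Or.inl ⟨p, rfl⟩)⟩

/-- The coordinate vector field `∂/∂y`, as a differential operator. -/
def pderivOp (y : X) : diffOps deg :=
  ⟨pderiv deg y, Algebra.subset_adjoin (Or.inr ⟨_, isSuperDerivation_pderiv deg y⟩)⟩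

/-- `a` is a differential operator of degree `k`; thus `deg ∂_x = -deg x`. -/
def IsHomogOp (k : ℤ) (a : diffOps deg) : Prop :=
  ∀ l, ∀ p ∈ homog deg l, (a : Module.End ℂ (SuperPoly deg)) p ∈ homog deg (k + l)

end SuperPoly

open SuperPoly

/-- A differential `∂` on the polynomial superalgebra `P = ℂ[X]`: a superderivation of degree `1`
with square zero. -/
structure PolyDGA {X : Type} (deg : X → ℤ) where
  d : Module.End ℂ (SuperPoly deg)
  isSuperDerivation : IsSuperDerivation deg 1 d
  d_d : ∀ p, d (d p) = 0

namespace PolyDGA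

variable {X : Type} {deg : X → ℤ} (P : PolyDGA deg)

/-- `π : P → A` is a dg algebra resolution of the algebra `A` (in degree `0`, with differential
`0`): a morphism of dg algebras which induces an isomorphism on cohomology. -/
structure IsResolution {A : Type*} [CommRing A] [Algebra ℂ A] (π : SuperPoly deg →ₐ[ℂ] A) :
    Prop where
  map_of_ne_zero : ∀ k : ℤ, k ≠ 0 → ∀ p ∈ homog deg k, π p = 0
  map_d : ∀ p, π (P.d p) = 0
  surjective : ∀ a, ∃ p ∈ homog deg 0, P.d p = 0 ∧ π p = a
  injective : ∀ p ∈ homog deg 0, P.d p = 0 → π p = 0 → ∃ q ∈ homog deg (-1), P.d q = p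
  exact : ∀ k : ℤ, k ≠ 0 → ∀ p ∈ homog deg k, P.d p = 0 → ∃ q ∈ homog deg (k - 1), P.d q = p

/-- The differential `∂`, as an element of `𝒟_P`. -/
def dOp : diffOps deg :=
  ⟨P.d, Algebra.subset_adjoin (Or.inr ⟨1, P.isSuperDerivation⟩)⟩

end PolyDGA

/-- A dg module over the dg algebra `(𝒟_P, [∂, ·])`, where `[∂, a] = ∂ a - (-1)^{|a|} a ∂`. -/
structure DgDMod {X : Type} {deg : X → ℤ} (P : PolyDGA deg) where
  carrier : Type u
  [addCommGroup : AddCommGroup carrier]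
  [module : Module ℂ carrier]
  /-- the cohomological grading -/
  gr : ℤ → Submodule ℂ carrier
  isInternal : DirectSum.IsInternal gr
  /-- the action of `𝒟_P` -/
  act : diffOps deg →ₐ[ℂ] Module.End ℂ carrier
  act_mem : ∀ k l a m, IsHomogOp deg k a → m ∈ gr l → act a m ∈ gr (k + l)
  /-- the differential -/
  d : Module.End ℂ carrier
  d_mem : ∀ k, ∀ m ∈ gr k, d m ∈ gr (k + 1)
  d_d : ∀ m, d (d m) = 0
  leibniz : ∀ k a m, IsHomogOp deg k a →
    d (act a m) = act (P.dOp * a - sgn k • (a * P.dOp)) m + sgn k • act a (d m)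

namespace DgDMod

variable {X : Type} {deg : X → ℤ} {P : PolyDGA deg}

attribute [instance] DgDMod.addCommGroup DgDMod.module

/-- Morphisms of dg modules: linear maps of degree `0` that commute with the action and with the
differentials. -/
@[ext] structure Hom (M N : DgDMod.{u} P) where
  toLin : M.carrier →ₗ[ℂ] N.carrier
  map_gr : ∀ k, ∀ m ∈ M.gr k, toLin m ∈ N.gr k
  map_act : ∀ a m, toLin (M.act a m) = N.act a (toLin m)
  map_d : ∀ m, toLin (M.d m) = N.d (toLin m)

instance : Category (DgDMod.{u} P) where
  Hom := Hom
  id M := ⟨LinearMap.id, fun _ _ h => h, fun _ _ => rfl, fun _ => rfl⟩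
  comp f g := ⟨g.toLin ∘ₗ f.toLin, fun k m h => g.map_gr k _ (f.map_gr k m h),
    fun a m => by simp [f.map_act, g.map_act], fun m => by simp [f.map_d, g.map_d]⟩

end DgDMod

/-! ### Fields

A field `φ(z) = ∑ φ_{(n)} z^{-n-1}` on `M` is a `VertexOperator ℂ M`. -/

/-- The mode `φ_{(n)}` of a field. -/
abbrev mode {M : Type*} [AddCommGroup M] [Module ℂ M] (φ : VertexOperator ℂ M) (n : ℤ) :
    Module.End ℂ M :=
  VertexOperator.ncoeff φ n

namespace ChiralField

variable {M : Type*} [AddCommGroup M] [Module ℂ M]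

lemma exists_trunc (φ : VertexOperator ℂ M) (m : M) :
    ∃ N : ℕ, ∀ n : ℤ, (N : ℤ) ≤ n → mode φ n m = 0 := by
  refine ⟨(-((HahnModule.of ℂ).symm (φ m)).order).toNat, fun n hn => ?_⟩
  apply VertexOperator.ncoeff_eq_zero_of_lt_order
  omega

lemma ext_modes {φ ψ : VertexOperator ℂ M} (h : ∀ n m, mode φ n m = mode ψ n m) : φ = ψ := by
  ext m n
  have := h (-n - 1) m
  rw [mode, mode, VertexOperator.ncoeff_apply, VertexOperator.ncoeff_apply] at this
  rw [show -(-n - 1) - 1 = n by ring] at this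
  exact this

lemma mode_add (φ ψ : VertexOperator ℂ M) (n : ℤ) : mode (φ + ψ) n = mode φ n + mode ψ n := by
  simp only [mode, map_add, Pi.add_apply]

lemma mode_smul (a : ℂ) (φ : VertexOperator ℂ M) (n : ℤ) : mode (a • φ) n = a • mode φ n := by
  simp only [mode, map_smul, Pi.smul_apply]

/-- The field with modes `f n`. -/
def ofModes (f : ℤ → Module.End ℂ M) (hf : ∀ m, ∃ N : ℤ, ∀ n, N ≤ n → f n m = 0) :
    VertexOperator ℂ M :=
  VertexOperator.of_coeff (fun n => f (-n - 1)) fun m => by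
    obtain ⟨N, hN⟩ := hf m
    refine ⟨-N - 1, fun n hn => ?_⟩
    by_contra! h
    exact hn (hN _ (by omega))

@[simp] lemma mode_ofModes (f : ℤ → Module.End ℂ M) (hf) (n : ℤ) :
    mode (ofModes f hf) n = f n := by
  simp [ofModes, mode]

/-- The identity field `Id`, with modes `δ_{n,-1} Id`. -/
def idField : VertexOperator ℂ M :=
  ofModes (fun n => if n = -1 then LinearMap.id else 0)
    fun m => ⟨0, fun n hn => by rw [if_neg (by omega)]; rfl⟩

lemma finsum_eq_range {M : Type*} [AddCommGroup M] {f : ℕ → M} (N : ℕ) (h : ∀ j, N ≤ j → f j = 0) :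
    ∑ᶠ j, f j = ∑ j ∈ Finset.range N, f j := by
  apply finsum_eq_sum_of_support_subset
  intro j hj
  by_contra hn
  exact hj (h j (by simpa using hn))

/-- The sum of a family of operators which is finite on each vector. -/
def locSum (F : ℕ → Module.End ℂ M) (h : ∀ m, ∃ N, ∀ j, N ≤ j → F j m = 0) :
    Module.End ℂ M where
  toFun m := ∑ᶠ j, F j m
  map_add' m m' := by
    obtain ⟨N, hN⟩ := h m
    obtain ⟨N', hN'⟩ := h m'
    have h1 : ∀ j, max N N' ≤ j → F j m = 0 := fun j hj => hN j (le_trans (le_max_left _ _) hj)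
    have h2 : ∀ j, max N N' ≤ j → F j m' = 0 := fun j hj => hN' j (le_trans (le_max_right _ _) hj)
    rw [finsum_eq_range _ h1, finsum_eq_range _ h2,
      finsum_eq_range (max N N') (fun j hj => by simp [h1 j hj, h2 j hj]),
      ← Finset.sum_add_distrib]
    simp
  map_smul' c m := by
    obtain ⟨N, hN⟩ := h m
    rw [finsum_eq_range _ hN, finsum_eq_range N (fun j hj => by simp [hN j hj]), RingHom.id_apply,
      Finset.smul_sum]
    simp

lemma locSum_apply (F : ℕ → Module.End ℂ M) (h) (m : M) : locSum F h m = ∑ᶠ j, F j m := rfl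

lemma locSum_eq_range (F : ℕ → Module.End ℂ M) (h) {m : M} (N : ℕ)
    (hN : ∀ j, N ≤ j → F j m = 0) : locSum F h m = ∑ j ∈ Finset.range N, F j m :=
  finsum_eq_range N hN

/-- With `c(z)_- = ∑_{j < 0} c_{(j)} z^{-j-1}`, the field `(1/n!) ∂_z^n c(z)_- · φ(z)`. -/
def creation (n : ℕ) (c : VertexOperator ℂ M) : Module.End ℂ (VertexOperator ℂ M) where
  toFun φ := ofModes
    (fun k => locSum (fun j => ((n + j).choose n : ℂ) • (mode c (-n - 1 - j) ∘ₗ mode φ (k + j)))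
      fun m => by
        obtain ⟨N, hN⟩ := exists_trunc φ m
        exact ⟨(N - k).toNat, fun j hj => by
          simp only [LinearMap.smul_apply, LinearMap.comp_apply]
          rw [hN _ (by omega)]; simp⟩)
    fun m => by
      obtain ⟨N, hN⟩ := exists_trunc φ m
      refine ⟨N, fun k hk => ?_⟩
      rw [locSum_eq_range _ _ 0]
      · simp
      · intro j _
        simp only [LinearMap.smul_apply, LinearMap.comp_apply]
        rw [hN _ (by omega)]; simp
  map_add' φ ψ := by
    apply ext_modes
    intro k m
    obtain ⟨N, hN⟩ := exists_trunc φ m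
    obtain ⟨N', hN'⟩ := exists_trunc ψ m
    have h1 : ∀ j : ℕ, (max N N' - k).toNat ≤ j → mode φ (k + j) m = 0 :=
      fun j hj => hN _ (by omega)
    have h2 : ∀ j : ℕ, (max N N' - k).toNat ≤ j → mode ψ (k + j) m = 0 :=
      fun j hj => hN' _ (by omega)
    rw [mode_add]
    simp only [mode_ofModes, LinearMap.add_apply]
    rw [locSum_eq_range _ _ (max N N' - k).toNat, locSum_eq_range _ _ (max N N' - k).toNat,
      locSum_eq_range _ _ (max N N' - k).toNat, ← Finset.sum_add_distrib]
    · refine Finset.sum_congr rfl fun j _ => ?_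
      simp [mode_add]
    · intro j hj; simp [h2 j hj]
    · intro j hj; simp [h1 j hj]
    · intro j hj; simp [mode_add, h1 j hj, h2 j hj]
  map_smul' a φ := by
    apply ext_modes
    intro k m
    obtain ⟨N, hN⟩ := exists_trunc φ m
    have h1 : ∀ j : ℕ, (N - k).toNat ≤ j → mode φ (k + j) m = 0 := fun j hj => hN _ (by omega)
    rw [RingHom.id_apply, mode_smul]
    simp only [mode_ofModes, LinearMap.smul_apply]
    rw [locSum_eq_range _ _ (N - k).toNat, locSum_eq_range _ _ (N - k).toNat, Finset.smul_sum]
    · refine Finset.sum_congr rfl fun j _ => ?_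
      simp [mode_smul, smul_comm a]
    · intro j hj; simp [h1 j hj]
    · intro j hj; simp [mode_smul, h1 j hj]

/-- With `c(z)_+ = ∑_{j ≥ 0} c_{(j)} z^{-j-1}`, the field
`(-1)^{|c||φ|} φ(z) · (1/n!) ∂_z^n c(z)_+`, where `s` is the involution of `M` with
`s φ s = (-1)^{|c||φ|} φ`. -/
def annihilation (n : ℕ) (c : VertexOperator ℂ M) (s : Module.End ℂ M) :
    Module.End ℂ (VertexOperator ℂ M) where
  toFun φ := ofModes
    (fun k => locSum (fun j => ((-1) ^ n * ((n + j).choose n : ℂ)) •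
        (s ∘ₗ mode φ (k - n - 1 - j) ∘ₗ s ∘ₗ mode c j))
      fun m => by
        obtain ⟨N, hN⟩ := exists_trunc c m
        exact ⟨N, fun j hj => by
          simp only [LinearMap.smul_apply, LinearMap.comp_apply]
          rw [hN j (by omega)]; simp⟩)
    fun m => by
      obtain ⟨N, hN⟩ := exists_trunc c m
      choose K hK using fun j : ℕ => exists_trunc φ (s (mode c j m))
      refine ⟨(Finset.range N).sup K + n + 1 + N, fun k hk => ?_⟩
      rw [locSum_eq_range _ _ N]
      · refine Finset.sum_eq_zero fun j hj => ?_
        have hs := Finset.le_sup (f := K) hj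
        have hj' := Finset.mem_range.1 hj
        simp only [LinearMap.smul_apply, LinearMap.comp_apply]
        rw [hK j _ (by omega)]; simp
      · intro j hj
        simp only [LinearMap.smul_apply, LinearMap.comp_apply]
        rw [hN j (by omega)]; simp
  map_add' φ ψ := by
    apply ext_modes
    intro k m
    obtain ⟨N, hN⟩ := exists_trunc c m
    have h1 : ∀ j : ℕ, N ≤ j → mode c j m = 0 := fun j hj => hN _ (by omega)
    rw [mode_add]
    simp only [mode_ofModes, LinearMap.add_apply]
    rw [locSum_eq_range _ _ N, locSum_eq_range _ _ N, locSum_eq_range _ _ N,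
      ← Finset.sum_add_distrib]
    · refine Finset.sum_congr rfl fun j _ => ?_
      simp [mode_add]
    · intro j hj; simp [h1 j hj]
    · intro j hj; simp [h1 j hj]
    · intro j hj; simp [h1 j hj]
  map_smul' a φ := by
    apply ext_modes
    intro k m
    obtain ⟨N, hN⟩ := exists_trunc c m
    have h1 : ∀ j : ℕ, N ≤ j → mode c j m = 0 := fun j hj => hN _ (by omega)
    rw [RingHom.id_apply, mode_smul]
    simp only [mode_ofModes, LinearMap.smul_apply]
    rw [locSum_eq_range _ _ N, locSum_eq_range _ _ N, Finset.smul_sum]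
    · refine Finset.sum_congr rfl fun j _ => ?_
      simp [mode_smul, smul_comm a]
    · intro j hj; simp [h1 j hj]
    · intro j hj; simp [h1 j hj]

lemma creation_apply (n : ℕ) (c φ : VertexOperator ℂ M) (k : ℤ) (m : M) (N : ℕ)
    (hN : ∀ j : ℕ, N ≤ j → mode φ (k + j) m = 0) :
    mode (creation n c φ) k m = ∑ j ∈ Finset.range N,
      ((n + j).choose n : ℂ) • mode c (-n - 1 - j) (mode φ (k + j) m) := by
  change mode (ofModes _ _) k m = _
  rw [mode_ofModes, locSum_eq_range _ _ N]
  · rfl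
  · intro j hj; simp [hN j hj]

lemma annihilation_apply (n : ℕ) (c φ : VertexOperator ℂ M) (s : Module.End ℂ M) (k : ℤ) (m : M)
    (N : ℕ) (hN : ∀ j : ℕ, N ≤ j → mode c j m = 0) :
    mode (annihilation n c s φ) k m = ∑ j ∈ Finset.range N,
      ((-1) ^ n * ((n + j).choose n : ℂ)) • s (mode φ (k - n - 1 - j) (s (mode c j m))) := by
  change mode (ofModes _ _) k m = _
  rw [mode_ofModes, locSum_eq_range _ _ N]
  · rfl
  · intro j hj; simp [hN j hj]

/-- The normally ordered product `:(1/n!) ∂_z^n c(z) φ(z):`, where `s` is the involution of `M` with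
`s φ s = (-1)^{|c||φ|} φ`. -/
def normalOrder (n : ℕ) (c : VertexOperator ℂ M) (s : Module.End ℂ M) :
    Module.End ℂ (VertexOperator ℂ M) :=
  creation n c + annihilation n c s

section comm

variable {c c' : VertexOperator ℂ M} {s s' : Module.End ℂ M} {ε : ℂ} (n n' : ℕ)

lemma creation_comm
    (hneg : ∀ i j : ℤ, i < 0 → j < 0 → ∀ m, mode c i (mode c' j m) = ε • mode c' j (mode c i m)) :
    creation n c * creation n' c' = ε • (creation n' c' * creation n c) := by
  ext1 φ
  apply ext_modes
  intro k m
  obtain ⟨N, hN⟩ := exists_trunc φ m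
  have h1 : ∀ (b : ℤ) (d : VertexOperator ℂ M) (p : ℕ) (j : ℕ), (N - k).toNat ≤ j →
      mode (creation p d φ) (k + j) m = 0 := by
    intro _ d p j hj
    rw [creation_apply p d φ _ m 0 (fun l _ => hN _ (by omega))]
    simp
  have h2 : ∀ j l : ℕ, (N - k).toNat ≤ l → mode φ (k + j + l) m = 0 :=
    fun j l hl => hN _ (by omega)
  simp only [Module.End.mul_apply, LinearMap.smul_apply]
  rw [mode_smul,
    LinearMap.smul_apply, creation_apply n c _ k m _ (h1 0 c' n'),
    creation_apply n' c' _ k m _ (h1 0 c n)]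
  simp only [fun j : ℕ => creation_apply n' c' φ (k + j) m _ (h2 j),
    fun j : ℕ => creation_apply n c φ (k + j) m _ (h2 j), map_sum, Finset.smul_sum, map_smul]
  rw [Finset.sum_comm]
  refine Finset.sum_congr rfl fun j _ => Finset.sum_congr rfl fun l _ => ?_
  rw [hneg _ _ (by omega) (by omega), show k + l + j = k + j + l by ring]
  simp only [smul_smul]
  congr 1
  ring

lemma annihilation_comm (hε : ε * ε = 1)
    (hpos : ∀ i j : ℤ, 0 ≤ i → 0 ≤ j → ∀ m,
      mode c i (mode c' j m) = ε • mode c' j (mode c i m))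
    (hs : ∀ k m, s (mode c' k m) = ε • mode c' k (s m))
    (hs' : ∀ k m, s' (mode c k m) = ε • mode c k (s' m))
    (hss : ∀ m, s (s' m) = s' (s m)) :
    annihilation n c s * annihilation n' c' s' =
      ε • (annihilation n' c' s' * annihilation n c s) := by
  ext1 φ
  apply ext_modes
  intro k m
  obtain ⟨N, hN⟩ := exists_trunc c m
  obtain ⟨N', hN'⟩ := exists_trunc c' m
  have hN1 : ∀ j : ℕ, N ≤ j → mode c j m = 0 := fun j hj => hN j (by omega)
  have hN1' : ∀ j : ℕ, N' ≤ j → mode c' j m = 0 := fun j hj => hN' j (by omega)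
  have hr : ∀ k m, mode c' k (s m) = ε • s (mode c' k m) := by
    intro k m; rw [hs, smul_smul, hε, one_smul]
  have hr' : ∀ k m, mode c k (s' m) = ε • s' (mode c k m) := by
    intro k m; rw [hs', smul_smul, hε, one_smul]
  have hp' : ∀ i j : ℤ, 0 ≤ i → 0 ≤ j → ∀ m,
      mode c' i (mode c j m) = ε • mode c j (mode c' i m) := by
    intro i j hi hj m; rw [hpos j i hj hi, smul_smul, hε, one_smul]
  have h2 : ∀ j l : ℕ, N' ≤ l → mode c' l (s (mode c j m)) = 0 := by
    intro j l hl
    rw [hr, hp' _ _ (by omega) (by omega), hN1' l hl]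
    simp
  have h2' : ∀ j l : ℕ, N ≤ l → mode c l (s' (mode c' j m)) = 0 := by
    intro j l hl
    rw [hr', hpos _ _ (by omega) (by omega), hN1 l hl]
    simp
  simp only [Module.End.mul_apply, LinearMap.smul_apply]
  rw [mode_smul,
    LinearMap.smul_apply, annihilation_apply n c _ s k m N hN1,
    annihilation_apply n' c' _ s' k m N' hN1']
  simp only [fun j : ℕ => annihilation_apply n' c' φ s' (k - n - 1 - j) _ _ (h2 j),
    fun j : ℕ => annihilation_apply n c φ s (k - n' - 1 - j) _ _ (h2' j), map_sum,
    Finset.smul_sum, map_smul]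
  rw [Finset.sum_comm]
  refine Finset.sum_congr rfl fun j _ => Finset.sum_congr rfl fun l _ => ?_
  rw [hr, hr', hpos l j (by omega) (by omega)]
  simp only [map_smul, smul_smul, hss]
  rw [show k - n - 1 - l - n' - 1 - j = k - n' - 1 - j - n - 1 - l by ring]
  congr 1
  linear_combination (-((-1) ^ n * ((n + l).choose n : ℂ) *
    ((-1) ^ n' * ((n' + j).choose n' : ℂ)) * ε)) * hε

lemma creation_annihilation_comm
    (hs' : ∀ k m, s' (mode c k m) = ε • mode c k (s' m)) (hε : ε * ε = 1) :
    creation n c * annihilation n' c' s' = ε • (annihilation n' c' s' * creation n c) := by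
  ext1 φ
  apply ext_modes
  intro k m
  obtain ⟨N', hN'⟩ := exists_trunc c' m
  have hN1' : ∀ j : ℕ, N' ≤ j → mode c' j m = 0 := fun j hj => hN' j (by omega)
  choose K hK using fun j : ℕ => exists_trunc φ (s' (mode c' j m))
  obtain ⟨N, hN⟩ : ∃ N : ℕ, ∀ j : ℕ, N ≤ j → ∀ l < N',
      mode φ (k + j - n' - 1 - l) (s' (mode c' l m)) = 0 := by
    refine ⟨((Finset.range N').sup K + n' + 1 + N' - k).toNat, fun j hj l hl => hK l _ ?_⟩
    have := Finset.le_sup (f := K) (Finset.mem_range.2 hl)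
    omega
  have h1 : ∀ j : ℕ, N ≤ j → mode (annihilation n' c' s' φ) (k + j) m = 0 := by
    intro j hj
    rw [annihilation_apply _ _ _ _ _ _ _ hN1']
    refine Finset.sum_eq_zero fun l hl => ?_
    rw [hN j hj l (Finset.mem_range.1 hl)]
    simp
  simp only [Module.End.mul_apply, LinearMap.smul_apply]
  rw [mode_smul,
    LinearMap.smul_apply, creation_apply n c _ k m N h1,
    annihilation_apply n' c' _ s' k m N' hN1']
  simp only [fun j : ℕ => annihilation_apply n' c' φ s' (k + j) _ _ hN1', map_sum,
    Finset.smul_sum, map_smul]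
  rw [Finset.sum_comm]
  refine Finset.sum_congr rfl fun l hl => ?_
  rw [creation_apply n c φ _ _ N (fun j hj => by
    have := hN j hj l (Finset.mem_range.1 hl)
    rwa [show k - n' - 1 - l + j = k + j - n' - 1 - l by ring])]
  simp only [map_sum, Finset.smul_sum, map_smul, hs', smul_smul]
  refine Finset.sum_congr rfl fun j _ => ?_
  rw [show k - n' - 1 - l + j = k + j - n' - 1 - l by ring]
  congr 1
  linear_combination (-((-1) ^ n' * ((n' + l).choose n' : ℂ) * ((n + j).choose n : ℂ))) * hε

lemma normalOrder_comm (hε : ε * ε = 1)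
    (hneg : ∀ i j : ℤ, i < 0 → j < 0 → ∀ m, mode c i (mode c' j m) = ε • mode c' j (mode c i m))
    (hpos : ∀ i j : ℤ, 0 ≤ i → 0 ≤ j → ∀ m,
      mode c i (mode c' j m) = ε • mode c' j (mode c i m))
    (hs : ∀ k m, s (mode c' k m) = ε • mode c' k (s m))
    (hs' : ∀ k m, s' (mode c k m) = ε • mode c k (s' m))
    (hss : ∀ m, s (s' m) = s' (s m)) :
    normalOrder n c s * normalOrder n' c' s' =
      ε • (normalOrder n' c' s' * normalOrder n c s) := by
  have h3 := creation_annihilation_comm n' n (c := c') (c' := c) hs hε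
  have h3' : annihilation n c s * creation n' c' = ε • (creation n' c' * annihilation n c s) := by
    rw [h3, smul_smul, hε, one_smul]
  simp only [normalOrder, add_mul, mul_add, smul_add]
  rw [creation_comm n n' hneg, annihilation_comm n n' hε hpos hs hs' hss,
    creation_annihilation_comm n n' hs' hε, h3']
  abel

end comm

end ChiralField
/-! ### The vertex algebra of chiral differential operators -/

/-- The coordinates on the cotangent bundle: the functions `x_i` and the vector fields `∂_{x_i}`. -/
inductive Coord (ι : Type)
  | fn (i : ι)
  | vf (i : ι)

namespace Coord

variable {ι : Type} (deg : ι → ℤ)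

/-- The degrees: `deg ∂_{x_i} = -deg x_i`. -/
def degree : Coord ι → ℤ
  | fn i => deg i
  | vf i => -deg i

/-- The coordinate with which `g` has a nontrivial bracket. -/
def dual : Coord ι → Coord ι
  | fn i => vf i
  | vf i => fn i

/-- The value of the superbracket `[g_{(n)}, (dual g)_{(-n-1)}]`: since
`[∂_{x_i (n)}, x_{i (-n-1)}] = 1`, it is `1` for `g = ∂_{x_i}` and `-(-1)^{|x_i|}` for `g = x_i`. -/
def pairing : Coord ι → ℂ
  | fn i => -sgn (deg i)
  | vf _ => 1

lemma degree_dual (g : Coord ι) : degree deg (dual g) = -degree deg g := by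
  cases g <;> simp [degree, dual]

end Coord

namespace Chiral

variable {ι : Type} (deg : ι → ℤ)

/-- The degree of the jet `g^{(n)}` of a coordinate `g`. -/
def jetDeg (v : Coord ι × ℕ) : ℤ := Coord.degree deg v.1

/-- The underlying superspace of `𝒟^{ch}_P`: the polynomials in the jets `x_i^{(n)}`,
`∂_{x_i}^{(n)}`, `n ≥ 0`. The unit `1` is the vacuum. -/
abbrev Jet : Type := SuperPoly (jetDeg deg)

/-- The element `g^{(n)}`. -/
abbrev jet (g : Coord ι) (n : ℕ) : Jet deg := gen (jetDeg deg) (g, n)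

/-- The modes of the coordinate `g` on `𝒟^{ch}_P`: `g_{(-n-1)}` is the multiplication by `g^{(n)}`,
while `g_{(n)}`, for `n ≥ 0`, is the derivative along `(dual g)^{(n)}` times
`[g_{(n)}, (dual g)_{(-n-1)}]`. -/
def genMode (g : Coord ι) (n : ℤ) : Module.End ℂ (Jet deg) :=
  if n < 0 then LinearMap.mulLeft ℂ (jet deg g (-n - 1).toNat)
  else Coord.pairing deg g • pderiv (jetDeg deg) (Coord.dual g, n.toNat)

lemma genMode_of_neg (g : Coord ι) (n : ℤ) (hn : n < 0) (p : Jet deg) :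
    genMode deg g n p = jet deg g (-n - 1).toNat * p := by
  simp [genMode, hn]

lemma genMode_of_nonneg (g : Coord ι) (n : ℤ) (hn : 0 ≤ n) (p : Jet deg) :
    genMode deg g n p = Coord.pairing deg g • pderiv (jetDeg deg) (Coord.dual g, n.toNat) p := by
  simp [genMode, not_lt.2 hn]

lemma exists_pderiv_eq_zero (g : Coord ι) (p : Jet deg) :
    ∃ N : ℕ, ∀ n, N ≤ n → pderiv (jetDeg deg) (g, n) p = 0 := by
  induction p using gen_induction with
  | one => exact ⟨0, fun n _ => by simp⟩
  | add p q hp hq =>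
    obtain ⟨N, hN⟩ := hp
    obtain ⟨N', hN'⟩ := hq
    exact ⟨max N N', fun n hn => by
      rw [map_add, hN n (le_trans (le_max_left _ _) hn), hN' n (le_trans (le_max_right _ _) hn),
        add_zero]⟩
  | smul c p hp =>
    obtain ⟨N, hN⟩ := hp
    exact ⟨N, fun n hn => by rw [map_smul, hN n hn, smul_zero]⟩
  | gen_mul x p hp =>
    obtain ⟨N, hN⟩ := hp
    refine ⟨max N (x.2 + 1), fun n hn => ?_⟩
    have hx : x ≠ (g, n) := by
      rintro rfl
      exact absurd hn (by simp)
    rw [pderiv_mul, hN n (le_trans (le_max_left _ _) hn), pderiv_gen, if_neg hx]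
    simp

/-- The field `g(z)` of a coordinate `g`. -/
def genField (g : Coord ι) : VertexOperator ℂ (Jet deg) :=
  ChiralField.ofModes (genMode deg g) fun p => by
    obtain ⟨N, hN⟩ := exists_pderiv_eq_zero deg (Coord.dual g) p
    refine ⟨N, fun n hn => ?_⟩
    rw [genMode_of_nonneg deg g n (by omega), hN _ (by omega), smul_zero]

end Chiral

namespace SuperPoly

variable {X : Type} (deg : X → ℤ)

lemma twist_twist_comm (δ δ' : ℤ) (p : SuperPoly deg) :
    twist deg δ (twist deg δ' p) = twist deg δ' (twist deg δ p) := by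
  induction p using gen_induction with
  | one => simp
  | add p q hp hq => simp [hp, hq]
  | smul c p hp => simp [hp]
  | gen_mul x p hp => simp [hp, smul_smul, mul_comm]

lemma twist_pderiv (δ : ℤ) (y : X) (p : SuperPoly deg) :
    twist deg δ (pderiv deg y p) = sgn (δ * deg y) • pderiv deg y (twist deg δ p) := by
  induction p using gen_induction with
  | one => simp
  | add p q hp hq => simp [hp, hq]
  | smul c p hp => simp [hp, smul_comm c]
  | gen_mul x p hp =>
    simp only [pderiv_mul, map_add, map_mul, hp, twist_gen, pderiv_gen, map_smul, smul_add,
      smul_mul_assoc, mul_smul_comm, smul_smul]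
    congr 1
    · split_ifs with h
      · subst h
        simp [sgn_mul_self]
      · simp
    · congr 1
      ring

open Classical in
lemma pderiv_pderiv (y z : X) (p : SuperPoly deg) :
    pderiv deg y (pderiv deg z p) = sgn (deg y * deg z) • pderiv deg z (pderiv deg y p) := by
  induction p using gen_induction with
  | one => simp
  | add p q hp hq => simp [hp, hq]
  | smul c p hp => simp [hp, smul_comm c]
  | gen_mul x p hp =>
    have h1 : ∀ (c : Prop) [Decidable c] (w : X),
        pderiv deg w (if c then (1 : SuperPoly deg) else 0) = 0 := by
      intro c _ w
      split_ifs <;> simp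
    have h2 : ∀ (c : Prop) [Decidable c] (δ : ℤ),
        twist deg δ (if c then (1 : SuperPoly deg) else 0) = if c then 1 else 0 := by
      intro c _ δ
      split_ifs <;> simp
    simp only [pderiv_mul, map_add, hp, twist_gen, pderiv_gen, map_smul, smul_add, h1, h2,
      smul_mul_assoc, mul_smul_comm, smul_smul, zero_mul, zero_add]
    have e1 : (if x = z then (1 : SuperPoly deg) else 0) * pderiv deg y p =
        (sgn (deg y * deg z) * sgn (deg y * deg x)) •
          ((if x = z then (1 : SuperPoly deg) else 0) * pderiv deg y p) := by
      split_ifs with h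
      · subst h; simp [sgn_mul_self]
      · simp
    have e2 : sgn (deg z * deg x) • ((if x = y then (1 : SuperPoly deg) else 0) * pderiv deg z p) =
        sgn (deg y * deg z) • ((if x = y then (1 : SuperPoly deg) else 0) * pderiv deg z p) := by
      split_ifs with h
      · subst h; simp [mul_comm]
      · simp
    rw [← e1, e2, mul_comm (sgn (deg z * deg x)), mul_assoc]
    abel

end SuperPoly
namespace Chiral

variable {ι : Type} (deg : ι → ℤ)

lemma genMode_comm_of_neg (g h : Coord ι) (m n : ℤ) (hm : m < 0) (hn : n < 0) (p : Jet deg) :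
    genMode deg g m (genMode deg h n p) =
      sgn (Coord.degree deg g * Coord.degree deg h) • genMode deg h n (genMode deg g m p) := by
  simp only [genMode_of_neg, hm, hn, ← mul_assoc]
  rw [gen_mul_gen, smul_mul_assoc]
  rfl

lemma genMode_comm_of_nonneg (g h : Coord ι) (m n : ℤ) (hm : 0 ≤ m) (hn : 0 ≤ n) (p : Jet deg) :
    genMode deg g m (genMode deg h n p) =
      sgn (Coord.degree deg g * Coord.degree deg h) • genMode deg h n (genMode deg g m p) := by
  simp only [genMode_of_nonneg, hm, hn, map_smul]
  rw [pderiv_pderiv]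
  simp only [jetDeg, Coord.degree_dual, neg_mul_neg, smul_smul]
  congr 1
  ring

lemma twist_genMode (δ : ℤ) (g : Coord ι) (n : ℤ) (p : Jet deg) :
    twist (jetDeg deg) δ (genMode deg g n p) =
      sgn (δ * Coord.degree deg g) • genMode deg g n (twist (jetDeg deg) δ p) := by
  rcases lt_or_ge n 0 with hn | hn
  · simp [genMode_of_neg, hn, jetDeg]
  · simp only [genMode_of_nonneg, hn, map_smul, twist_pderiv, jetDeg, Coord.degree_dual, mul_neg,
      sgn_neg]
    rw [smul_comm]

/-- Assigns to the jet `g^{(n)}` the operator `φ(z) ↦ :(1/n!) ∂_z^n g(z) φ(z):`. -/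
def normalOrderHom : Jet deg →ₐ[ℂ] Module.End ℂ (VertexOperator ℂ (Jet deg)) :=
  SuperPoly.lift (fun v => ChiralField.normalOrder v.2 (genField deg v.1)
      (twist (jetDeg deg) (jetDeg deg v)).toLinearMap) (fun v w => by
    apply ChiralField.normalOrder_comm
    · exact sgn_mul_self _
    · intro i j hi hj p
      simpa [genField, jetDeg] using genMode_comm_of_neg deg v.1 w.1 i j hi hj p
    · intro i j hi hj p
      simpa [genField, jetDeg] using genMode_comm_of_nonneg deg v.1 w.1 i j hi hj p
    · intro k p
      simpa [genField, jetDeg] using twist_genMode deg (jetDeg deg v) w.1 k p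
    · intro k p
      simpa [genField, jetDeg, mul_comm] using twist_genMode deg (jetDeg deg w) v.1 k p
    · intro p
      exact twist_twist_comm _ _ _ p)

/-- The state-field correspondence of `𝒟^{ch}_P`:
`g_1^{(n_1)} ⋯ g_r^{(n_r)} ↦ :(1/n_1!) ∂_z^{n_1} g_1(z) ⋯ (1/n_r!) ∂_z^{n_r} g_r(z):`. -/
def Y : Jet deg →ₗ[ℂ] VertexOperator ℂ (Jet deg) where
  toFun v := normalOrderHom deg v ChiralField.idField
  map_add' := by simp
  map_smul' := by simp

/-- The `n`-th product `v_{(n)} w` of `𝒟^{ch}_P`. -/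
def nprod (v : Jet deg) (n : ℤ) (w : Jet deg) : Jet deg := mode (Y deg v) n w

/-- The embedding of `P` in `𝒟^{ch}_P`, `x_i ↦ x_i^{(0)}`. -/
def emb : SuperPoly deg →ₐ[ℂ] Jet deg :=
  SuperPoly.lift (fun i => jet deg (Coord.fn i) 0) (fun _ _ => gen_mul_gen (jetDeg deg) _ _)

variable {deg} in
/-- The differential `∂^{ch} = (∑_i f_{i (-1)} ∂_{x_i})_{(0)}` of `𝒟^{ch}_P`, where
`∂ = ∑_i f_i ∂_{x_i}`, that is, `f_i = ∂ x_i`. -/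
def dCh [Fintype ι] (P : PolyDGA deg) (v : Jet deg) : Jet deg :=
  nprod deg (∑ i, nprod deg (emb deg (P.d (gen deg i))) (-1) (jet deg (Coord.vf i) 0)) 0 v

end Chiral

open Chiral

/-! ### Modules -/

/-- A dg module over the dg vertex algebra `(𝒟^{ch}_P, ∂^{ch})`. -/
structure DgChMod {ι : Type} [Fintype ι] {deg : ι → ℤ} (P : PolyDGA deg) where
  carrier : Type u
  [addCommGroup : AddCommGroup carrier]
  [module : Module ℂ carrier]
  /-- the cohomological grading -/
  gr : ℤ → Submodule ℂ carrier
  isInternal : DirectSum.IsInternal gr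
  /-- the action: the field `v(z) = ∑ v_{(n)} z^{-n-1}` on the module attached to `v ∈ 𝒟^{ch}_P`;
  in particular `v_{(n)} m = 0` for `n ≫ 0` -/
  act : Jet deg →ₗ[ℂ] VertexOperator ℂ carrier
  /-- the vacuum acts as the identity -/
  act_vac : act 1 = ChiralField.idField
  /-- the Borcherds identity; all sums are finite -/
  borcherds : ∀ k l, ∀ a ∈ homog (jetDeg deg) k, ∀ b ∈ homog (jetDeg deg) l,
    ∀ (p q r : ℤ) (m : carrier),
      ∑ᶠ j : ℕ, Ring.choose p j • mode (act (nprod deg a (r + j) b)) (p + q - j) m =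
      ∑ᶠ j : ℕ, ((-1) ^ j * Ring.choose r j) •
        (mode (act a) (p + r - j) (mode (act b) (q + j) m)
          - (sgn r * sgn (k * l)) • mode (act b) (q + r - j) (mode (act a) (p + j) m))
  act_mem : ∀ k l, ∀ v ∈ homog (jetDeg deg) k, ∀ n, ∀ m ∈ gr l, mode (act v) n m ∈ gr (k + l)
  /-- the differential -/
  d : Module.End ℂ carrier
  d_mem : ∀ k, ∀ m ∈ gr k, d m ∈ gr (k + 1)
  d_d : ∀ m, d (d m) = 0
  leibniz : ∀ k, ∀ v ∈ homog (jetDeg deg) k, ∀ n m,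
    d (mode (act v) n m) = mode (act (dCh P v)) n m + sgn k • mode (act v) n (d m)

namespace DgChMod

variable {ι : Type} [Fintype ι] {deg : ι → ℤ} {P : PolyDGA deg}

attribute [instance] DgChMod.addCommGroup DgChMod.module

/-- Morphisms of dg modules: linear maps of degree `0` that commute with the action and with the
differentials. -/
@[ext] structure Hom (M N : DgChMod.{u} P) where
  toLin : M.carrier →ₗ[ℂ] N.carrier
  map_gr : ∀ k, ∀ m ∈ M.gr k, toLin m ∈ N.gr k
  map_act : ∀ v n m, toLin (mode (M.act v) n m) = mode (N.act v) n (toLin m)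
  map_d : ∀ m, toLin (M.d m) = N.d (toLin m)

instance : Category (DgChMod.{u} P) where
  Hom := Hom
  id M := ⟨LinearMap.id, fun _ _ h => h, fun _ _ _ => rfl, fun _ => rfl⟩
  comp f g := ⟨g.toLin ∘ₗ f.toLin, fun k m h => g.map_gr k _ (f.map_gr k m h),
    fun v n m => by simp only [LinearMap.comp_apply, f.map_act, g.map_act],
    fun m => by simp only [LinearMap.comp_apply, f.map_d, g.map_d]⟩

/-- The operator `x_{i (n)}`. -/
abbrev xMode (M : DgChMod.{u} P) (i : ι) (n : ℤ) : Module.End ℂ M.carrier :=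
  mode (M.act (jet deg (Coord.fn i) 0)) n

/-- The operator `∂_{x_i (n)}`. -/
abbrev vfMode (M : DgChMod.{u} P) (i : ι) (n : ℤ) : Module.End ℂ M.carrier :=
  mode (M.act (jet deg (Coord.vf i) 0)) n

/-- `M` is bounded if the operators `x_{i (n-1)}`, `∂_{x_i (n)}`, `n > 0`, which lower the conformal
weight by `n`, act locally nilpotently. -/
def IsBounded : ObjectProperty (DgChMod.{u} P) := fun M =>
  ∀ m, ∃ N : ℕ, 0 < N ∧ ∀ i, ∀ n : ℤ, 0 < n →
    (M.xMode i (n - 1) ^ N) m = 0 ∧ (M.vfMode i n ^ N) m = 0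

variable (P) in
/-- The category of bounded dg modules over `𝒟^{ch}_P`. -/
abbrev Bounded : Type (u + 1) := (IsBounded (P := P)).FullSubcategory

/-- The space of singular vectors
`Sing M = {m | x_{i (n-1)} m = ∂_{x_i (n)} m = 0 for all i and all n > 0}`. -/
def sing (M : DgChMod.{u} P) : Submodule ℂ M.carrier :=
  ⨅ i, ⨅ n : {n : ℤ // 0 < n}, LinearMap.ker (M.xMode i (n - 1)) ⊓ LinearMap.ker (M.vfMode i n)

/-- `e` identifies the dg `𝒟_P`-module `N` with `Sing M`, where the grading and the differential of
`Sing M` are the restrictions of those of `M`, the function `x_i` acts by `x_{i (-1)}` and the vector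
field `∂_{x_i}` acts by `∂_{x_i (0)}`. -/
structure IsSingModule (M : DgChMod.{u} P) (N : DgDMod.{u} P) (e : N.carrier ≃ₗ[ℂ] M.sing) :
    Prop where
  gr : ∀ k n, n ∈ N.gr k ↔ (e n : M.carrier) ∈ M.gr k
  act_x : ∀ i n, (e (N.act (mulOp deg (gen deg i)) n) : M.carrier) = M.xMode i (-1) (e n)
  act_vf : ∀ i n, (e (N.act (pderivOp deg i) n) : M.carrier) = M.vfMode i 0 (e n)
  d : ∀ n, (e (N.d n) : M.carrier) = M.d (e n)

end DgChMod

/-! ### Induction -/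

/-- The basis of the Lie superalgebra `𝔞̂`. The element `a^i_n` has the parity of `∂_{x_i}`, `b^i_n`
that of `x_i`, and `C` is even. -/
inductive HeisGen (ι : Type)
  | a (i : ι) (n : ℤ)
  | b (i : ι) (n : ℤ)
  | C

namespace HeisGen

variable {ι : Type} (deg : ι → ℤ)

/-- The degrees of the basis elements, whose parities are the parities of the degrees. -/
def degree : HeisGen ι → ℤ
  | a i _ => -deg i
  | b i _ => deg i
  | C => 0

open Classical in
/-- The superbracket of `𝔞̂`: `[u, v] = bracket u v • C`, with `[a^i_n, b^j_m] = δ_{ij} δ_{n,-m} C`. -/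
def bracket : HeisGen ι → HeisGen ι → ℂ
  | a i n, b j m => if i = j ∧ n = -m then 1 else 0
  | b j m, a i n => if i = j ∧ n = -m then -sgn (deg i * deg j) else 0
  | _, _ => 0

/-- `g` belongs to `𝔞̂_≥`, which is spanned by `C` and the `a^i_n`, `b^i_n` with `n ≥ 0`. -/
def IsNonneg : HeisGen ι → Prop
  | a _ n => 0 ≤ n
  | b _ n => 0 ≤ n
  | C => True

/-- The relations `u v - (-1)^{|u||v|} v u = [u, v]` of the universal enveloping algebra of `𝔞̂`. -/
inductive Rel : FreeAlgebra ℂ (HeisGen ι) → FreeAlgebra ℂ (HeisGen ι) → Prop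
  | comm (u v : HeisGen ι) : Rel (FreeAlgebra.ι ℂ u * FreeAlgebra.ι ℂ v)
      (sgn (degree deg u * degree deg v) • (FreeAlgebra.ι ℂ v * FreeAlgebra.ι ℂ u) +
        bracket deg u v • FreeAlgebra.ι ℂ C)

end HeisGen

section Induction

variable {ι : Type} (deg : ι → ℤ)

/-- The universal enveloping algebra `U(𝔞̂)`. -/
def UHeis : Type := RingQuot (HeisGen.Rel deg)

instance : Ring (UHeis deg) := inferInstanceAs (Ring (RingQuot (HeisGen.Rel deg)))

instance : Algebra ℂ (UHeis deg) := inferInstanceAs (Algebra ℂ (RingQuot (HeisGen.Rel deg)))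

/-- The image of a basis element of `𝔞̂` in `U(𝔞̂)`. -/
def UHeis.of (g : HeisGen ι) : UHeis deg :=
  RingQuot.mkAlgHom ℂ (HeisGen.Rel deg) (FreeAlgebra.ι ℂ g)

variable {deg} {P : PolyDGA deg}

/-- The action of `𝔞̂_≥` on a `𝒟_P`-module: `a^i_0`, `b^i_0` and `C` act as `∂_{x_i}`, `x_i` and the
identity, while `a^i_n` and `b^i_n` with `n > 0` act as `0`. -/
def DgDMod.heisAct (N : DgDMod.{u} P) : HeisGen ι → Module.End ℂ N.carrier
  | .a i n => if n = 0 then N.act (pderivOp deg i) else 0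
  | .b i n => if n = 0 then N.act (mulOp deg (gen deg i)) else 0
  | .C => LinearMap.id

/-- The relations `u g ⊗ n = u ⊗ g n`, `g ∈ 𝔞̂_≥`, as a left `U(𝔞̂)`-submodule. -/
def DgDMod.indRel (N : DgDMod.{u} P) : Submodule (UHeis deg) (UHeis deg ⊗[ℂ] N.carrier) :=
  Submodule.span _ {t | ∃ (u : UHeis deg) (g : HeisGen ι) (n : N.carrier), g.IsNonneg ∧
    t = (u * UHeis.of deg g) ⊗ₜ n - u ⊗ₜ N.heisAct g n}

/-- The induced module `Ind N = U(𝔞̂) ⊗_{U(𝔞̂_≥)} N`. -/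
abbrev DgDMod.Ind (N : DgDMod.{u} P) : Type u := (UHeis deg ⊗[ℂ] N.carrier) ⧸ N.indRel

/-- The element `u ⊗ n` of `Ind N`. -/
def DgDMod.indMk (N : DgDMod.{u} P) (u : UHeis deg) (n : N.carrier) : N.Ind :=
  Submodule.Quotient.mk (u ⊗ₜ n)

/-- The action of `𝔞̂` on a `𝒟^{ch}_P`-module: `a^i_n ↦ ∂_{x_i (n)}`, `b^i_n ↦ x_{i (n-1)}`,
`C ↦ Id`. -/
def DgChMod.heisAct [Fintype ι] (M : DgChMod.{u} P) : HeisGen ι → Module.End ℂ M.carrier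
  | .a i n => M.vfMode i n
  | .b i n => M.xMode i (n - 1)
  | .C => LinearMap.id

end Induction

end

noncomputable section

/-! ### Gradings -/

section Grading

variable {M N : Type*} [AddCommGroup M] [Module ℂ M] [AddCommGroup N] [Module ℂ N]
  {gr : ℤ → Submodule ℂ M}

/-! A module over 𝒟^ch_P is the same thing as a graded space with locally truncated modes g_(n) of
the coordinates g = x_i, ∂_{x_i} which satisfy the Heisenberg–Clifford relations. In one direction,
the Borcherds identity forces the field of g^{(n)} a to be a normally ordered product, so the modes
of the coordinates determine all fields (`DgChMod.heisRep`, `DgChMod.heisRep_act`). In the other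
direction, normally ordered products define the fields, and the Borcherds identity
(`HeisRep.resIter_act`) follows by induction on the length of the monomial a: the residues of a(z)
b(w), of b(w) a(z) and of the iterate obey parallel recursions when a is replaced by g^{(n)} a
(`resLeft_rec`, `resRight_rec`, `resIter_rec`).

The modes are then split by conformal weight. The zero modes x_{i(-1)}, ∂_{x_i(0)} satisfy the Weyl
relations and supercommute with all other modes. As 𝒟_P is the Weyl superalgebra on these generators
(`Weyl.equivDiff`), the singular vectors form a 𝒟_P-module. The other modes are pairs of creation
and annihilation operators whose vacuum vectors are the singular vectors. The map ℂ[creation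
operators] ⊗ Sing M → M is always injective, by a Poincaré lemma for polynomials. If M is bounded it
is also surjective, by an argument with the number operator (`IsFock.fockMap_injective`,
`IsFock.mem_range_fockMap`). So a bounded module is a Fock space over Sing M.

For the differential, let Q be the zero mode of the charge ∑ f_{i(-1)} ∂_{x_i}. It acts on singular
vectors as the element ∂ of 𝒟_P (`HeisRep.mode_charge`). The differential d of M and Q satisfy the
same Leibniz rule, so δ = d - Q supercommutes with the coordinates (`DgChMod.diff_op`). It follows
that d preserves Sing M, and that δ is determined by its restriction to Sing M, where it is d - ∂.

A map of singular vectors extends to the Fock spaces as id ⊗ g. Zero modes, the dilation that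
measures the degree, and δ are all semilinear over the creation operators, so compatibility with
them need only be checked on singular vectors (`DgChMod.extend_comm`). This gives full faithfulness.
For essential surjectivity, 𝒟^ch_P ⊗ N carries the zero modes through N, the other modes through the
first factor, and the differential Q + (±1) ⊗ (d - ∂). It needs Q² = 0, that is
`HeisRep.dCh_charge`: the obstruction has degree 2 and involves no jets of vector fields, which is
impossible when all deg x_i ≤ 0.

Finally the induced module is spanned by ℂ[creation operators] ⊗ N and maps to any bounded module
with singular vectors N. The composite is the Fock isomorphism, so both maps are isomorphisms
(`DgChMod.exists_indEquiv`). -/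

lemma grade_induction (h : DirectSum.IsInternal gr) {C : M → Prop} (zero : C 0)
    (add : ∀ m m', C m → C m' → C (m + m')) (mem : ∀ k, ∀ m ∈ gr k, C m) (m : M) : C m :=
  Submodule.iSup_induction gr (motive := C) (h.submodule_iSup_eq_top ▸ Submodule.mem_top) mem
    zero add

lemma grade_hom_ext (h : DirectSum.IsInternal gr) {f g : M →ₗ[ℂ] N}
    (hfg : ∀ k, ∀ m ∈ gr k, f m = g m) : f = g :=
  LinearMap.ext fun m => grade_induction h (C := fun m => f m = g m) (by simp)
    (fun m m' h1 h2 => by simp [h1, h2]) hfg m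

/-- The operator which acts on the component of degree `k` as the scalar `χ k`. -/
def gradeOp (h : DirectSum.IsInternal gr) (χ : ℤ → ℂ) : Module.End ℂ M :=
  (DirectSum.toModule ℂ ℤ M fun k => χ k • (gr k).subtype) ∘ₗ
    (LinearEquiv.ofBijective (DirectSum.coeLinearMap gr) h).symm.toLinearMap

lemma gradeOp_of_mem (h : DirectSum.IsInternal gr) (χ : ℤ → ℂ) {k : ℤ} {m : M} (hm : m ∈ gr k) :
    gradeOp h χ m = χ k • m := by
  have : (LinearEquiv.ofBijective (DirectSum.coeLinearMap gr) h).symm m =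
      DirectSum.lof ℂ ℤ (fun k => gr k) k ⟨m, hm⟩ := by
    rw [LinearEquiv.symm_apply_eq]
    exact (DirectSum.coeLinearMap_lof gr k ⟨m, hm⟩).symm
  simp [gradeOp, this]

lemma gradeOp_mul (h : DirectSum.IsInternal gr) (χ χ' : ℤ → ℂ) :
    gradeOp h χ * gradeOp h χ' = gradeOp h (χ * χ') :=
  grade_hom_ext h fun k m hm => by
    simp [gradeOp_of_mem h _ hm, smul_smul, mul_comm]

lemma gradeOp_one (h : DirectSum.IsInternal gr) : gradeOp h 1 = 1 :=
  grade_hom_ext h fun k m hm => by simp [gradeOp_of_mem h _ hm]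

lemma gradeOp_single_mem (h : DirectSum.IsInternal gr) (k : ℤ) (m : M) :
    gradeOp h (Pi.single k 1) m ∈ gr k := by
  refine grade_induction h (C := fun m => gradeOp h (Pi.single k 1) m ∈ gr k) (by simp)
    (fun m m' h1 h2 => by rw [map_add]; exact add_mem h1 h2) (fun l m hm => ?_) m
  rw [gradeOp_of_mem h _ hm]
  by_cases hl : l = k
  · subst hl; simpa using hm
  · simp [hl]

lemma gradeOp_comm_of_map {gr' : ℤ → Submodule ℂ N} (h : DirectSum.IsInternal gr)
    (h' : DirectSum.IsInternal gr') {f : M →ₗ[ℂ] N} {δ : ℤ}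
    (hf : ∀ k, ∀ m ∈ gr k, f m ∈ gr' (δ + k)) (χ : ℤ → ℂ) (m : M) :
    gradeOp h' χ (f m) = f (gradeOp h (fun k => χ (δ + k)) m) := by
  refine LinearMap.congr_fun (f := gradeOp h' χ ∘ₗ f)
    (g := f ∘ₗ gradeOp h (fun k => χ (δ + k))) (grade_hom_ext h fun k m hm => ?_) m
  simp [gradeOp_of_mem h _ hm, gradeOp_of_mem h' _ (hf k m hm)]

/-- Since 2 is not a root of unity, an integer degree k can be recovered from the scalar 2^k.
Gradings are treated below as eigenspace decompositions of one dilation. -/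
lemma two_zpow_injective : Function.Injective (fun k : ℤ => (2 : ℂ) ^ k) := by
  intro a b hab
  have h2 : ((2 : ℝ) ^ a) = (2 : ℝ) ^ b := by
    have := congrArg norm hab
    simpa using this
  exact zpow_right_injective₀ (by norm_num) (by norm_num) h2

/-- The components lie in eigenspaces for distinct eigenvalues, and eigenspaces are independent.
Only the spanning remains to be checked in each application. -/
lemma isInternal_of_le_eigenspace (f : Module.End ℂ M)
    (hf : ∀ k, ∀ m ∈ gr k, f m = (2 : ℂ) ^ k • m) (htop : ∀ m, m ∈ ⨆ k, gr k) :
    DirectSum.IsInternal gr := by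
  rw [DirectSum.isInternal_submodule_iff_iSupIndep_and_iSup_eq_top]
  refine ⟨((Module.End.eigenspaces_iSupIndep f).comp two_zpow_injective).mono fun k m hm => ?_,
    Submodule.eq_top_iff'.2 htop⟩
  exact Module.End.mem_eigenspace_iff.2 (hf k m hm)

/-- A component is the whole eigenspace, so membership in a degree becomes an equation. Maps that
commute with dilations are shown to preserve degrees in this way. -/
lemma mem_of_eigen (f : Module.End ℂ M) (hf : ∀ k, ∀ m ∈ gr k, f m = (2 : ℂ) ^ k • m)
    (htop : ∀ m, m ∈ ⨆ k, gr k) {k : ℤ} {m : M} (hm : f m = (2 : ℂ) ^ k • m) : m ∈ gr k := by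
  have h := isInternal_of_le_eigenspace f hf htop
  -- Divide by 2^l - 2^k in degree l. In degree k the inverse is `0⁻¹ = 0`, so the quotient is m
  -- with its component of degree k removed.
  have h1 : gradeOp h (fun l => ((2 : ℂ) ^ l - 2 ^ k)⁻¹) (f m - (2 : ℂ) ^ k • m) =
      m - gradeOp h (Pi.single k 1) m := by
    refine LinearMap.congr_fun
      (f := gradeOp h (fun l => ((2 : ℂ) ^ l - 2 ^ k)⁻¹) ∘ₗ (f - (2 : ℂ) ^ k • LinearMap.id))
      (g := LinearMap.id - gradeOp h (Pi.single k 1)) (grade_hom_ext h fun l m hm => ?_) m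
    have : (2 : ℂ) ^ l • m - (2 : ℂ) ^ k • m = ((2 : ℂ) ^ l - 2 ^ k) • m := by rw [sub_smul]
    simp only [LinearMap.comp_apply, LinearMap.sub_apply, LinearMap.smul_apply, LinearMap.id_apply,
      hf l m hm, this, map_smul, gradeOp_of_mem h _ hm, smul_smul]
    by_cases hl : l = k
    · subst hl; simp
    · have : (2 : ℂ) ^ l - 2 ^ k ≠ 0 := sub_ne_zero.2 fun e => hl (two_zpow_injective e)
      simp [hl, this]
  rw [hm, sub_self, map_zero, eq_comm, sub_eq_zero] at h1
  rw [h1]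
  exact gradeOp_single_mem h k m

/-- Every vector is the finite sum of its homogeneous projections, which stay in S by hypothesis,
and independence is again read off from the dilation restricted to S. -/
lemma isInternal_submodule (h : DirectSum.IsInternal gr) (S : Submodule ℂ M)
    (hS : ∀ k, ∀ m ∈ S, gradeOp h (Pi.single k 1) m ∈ S) :
    DirectSum.IsInternal fun k => (gr k).comap S.subtype := by
  have hχ : ∀ χ : ℤ → ℂ, ∀ m ∈ S, gradeOp h χ m ∈ S := by
    intro χ m hm
    -- Quantifying over all larger finite sets lets the supports of two summands be merged. The same
    -- device is used below for sums over infinitely many generators.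
    have key : ∀ m, ∃ F : Finset ℤ, ∀ F', F ⊆ F' →
        gradeOp h χ m = ∑ k ∈ F', χ k • gradeOp h (Pi.single k 1) m := by
      refine grade_induction h ⟨∅, by simp⟩ ?_ ?_
      · rintro m m' ⟨F, hF⟩ ⟨F', hF'⟩
        classical
        refine ⟨F ∪ F', fun G hG => ?_⟩
        rw [map_add, hF G (Finset.union_subset_left hG), hF' G (Finset.union_subset_right hG),
          ← Finset.sum_add_distrib]
        simp
      · intro k m hm
        refine ⟨{k}, fun F' hF' => ?_⟩
        rw [gradeOp_of_mem h _ hm, Finset.sum_eq_single k]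
        · simp [gradeOp_of_mem h _ hm]
        · intro l _ hl
          simp [gradeOp_of_mem h _ hm, hl.symm]
        · intro hk
          exact absurd (hF' (by simp)) hk
    obtain ⟨F, hF⟩ := key m
    rw [hF F subset_rfl]
    exact Submodule.sum_mem _ fun k _ => Submodule.smul_mem _ _ (hS k m hm)
  refine isInternal_of_le_eigenspace
    ((gradeOp h fun k => (2 : ℂ) ^ k).restrict (p := S) (q := S) (hχ _)) ?_ ?_
  · intro k m hm
    ext
    simpa using gradeOp_of_mem h _ hm
  · rintro ⟨m, hm⟩
    have key : ∀ m, ∃ F : Finset ℤ, ∀ F', F ⊆ F' →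
        m = ∑ k ∈ F', gradeOp h (Pi.single k 1) m := by
      refine grade_induction h ⟨∅, by simp⟩ ?_ ?_
      · rintro m m' ⟨F, hF⟩ ⟨F', hF'⟩
        classical
        refine ⟨F ∪ F', fun G hG => ?_⟩
        simp only [map_add, Finset.sum_add_distrib]
        rw [← hF G (Finset.union_subset_left hG), ← hF' G (Finset.union_subset_right hG)]
      · intro k m hm
        refine ⟨{k}, fun F' hF' => ?_⟩
        rw [Finset.sum_eq_single k]
        · simp [gradeOp_of_mem h _ hm]
        · intro l _ hl
          simp [gradeOp_of_mem h _ hm, hl.symm]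
        · intro hk
          exact absurd (hF' (by simp)) hk
    obtain ⟨F, hF⟩ := key m
    have : (⟨m, hm⟩ : S) = ∑ k ∈ F, ⟨gradeOp h (Pi.single k 1) m, hS k m hm⟩ := by
      ext
      simpa using hF F subset_rfl
    rw [this]
    exact Submodule.sum_mem _ fun k _ => Submodule.mem_iSup_of_mem k (gradeOp_single_mem h k m)

end Grading

/-! ### Gradings of polynomial superalgebras and the Euler operator -/

namespace SuperPoly

variable {X : Type} (deg : X → ℤ)

lemma algHom_ext {B : Type*} [Ring B] [Algebra ℂ B] {f g : SuperPoly deg →ₐ[ℂ] B}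
    (h : ∀ x, f (gen deg x) = g (gen deg x)) : f = g := by
  ext p
  induction p using gen_induction with
  | one => simp
  | add p q hp hq => simp [hp, hq]
  | smul c p hp => simp [hp]
  | gen_mul x p hp => simp [hp, h]

/-- The component of weight `k` with respect to a weight `w` on the generators. -/
def weightGr (w : X → ℤ) (k : ℤ) : Submodule ℂ (SuperPoly deg) :=
  Submodule.span ℂ {p | ∃ l : List X, (l.map w).sum = k ∧ p = (l.map (gen deg)).prod}

/-- The automorphism which multiplies the generator `x` by `2 ^ w x`. -/
def scale (w : X → ℤ) : SuperPoly deg →ₐ[ℂ] SuperPoly deg :=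
  lift (fun x => (2 : ℂ) ^ w x • gen deg x) (fun x y => by
    simp only [smul_mul_smul_comm]
    rw [gen_mul_gen, smul_smul, smul_smul, mul_comm ((2 : ℂ) ^ w x),
      mul_comm (sgn (deg x * deg y))])

lemma gen_mul_mem_weightGr (w : X → ℤ) (x : X) {k : ℤ} {a : SuperPoly deg}
    (ha : a ∈ weightGr deg w k) : gen deg x * a ∈ weightGr deg w (w x + k) := by
  induction ha using Submodule.span_induction with
  | mem p hp =>
    obtain ⟨l, rfl, rfl⟩ := hp
    exact Submodule.subset_span ⟨x :: l, by simp, by simp⟩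
  | zero => simp
  | add p q _ _ hp hq => rw [mul_add]; exact add_mem hp hq
  | smul c p _ hp => rw [mul_smul_comm]; exact Submodule.smul_mem _ _ hp

lemma one_mem_weightGr (w : X → ℤ) : (1 : SuperPoly deg) ∈ weightGr deg w 0 :=
  Submodule.subset_span ⟨[], by simp, by simp⟩

/-- The supercommutativity relations are homogeneous for every weight on the generators, so the
rescaling of the generators is well defined and has the monomials as eigenvectors. -/
lemma weightGr_isInternal (w : X → ℤ) : DirectSum.IsInternal (weightGr deg w) := by
  refine isInternal_of_le_eigenspace (scale deg w).toLinearMap (fun k m hm => ?_) fun m => ?_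
  · induction hm using Submodule.span_induction with
    | mem p hp =>
      obtain ⟨l, rfl, rfl⟩ := hp
      induction l with
      | nil => simp
      | cons x l ih =>
        simp only [AlgHom.toLinearMap_apply] at ih ⊢
        simp only [List.map_cons, List.prod_cons, List.sum_cons, map_mul, ih]
        simp [scale, zpow_add₀, smul_smul, mul_comm]
    | zero => simp
    | add p q _ _ hp hq => rw [map_add, hp, hq, smul_add]
    | smul c p _ hp => rw [map_smul, hp, smul_comm]
  · induction m using gen_induction with
    | one => exact Submodule.mem_iSup_of_mem 0 (one_mem_weightGr deg w)
    | add p q hp hq => exact add_mem hp hq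
    | smul c p hp => exact Submodule.smul_mem _ _ hp
    | gen_mul x p hp =>
      refine Submodule.iSup_induction _ (motive := fun p => gen deg x * p ∈ ⨆ k, weightGr deg w k)
        hp (fun k p hp => ?_) (by simp) fun p q hp hq => ?_
      · exact Submodule.mem_iSup_of_mem _ (gen_mul_mem_weightGr deg w x hp)
      · rw [mul_add]; exact add_mem hp hq

lemma homog_isInternal : DirectSum.IsInternal (homog deg) := weightGr_isInternal deg deg

lemma word_induction {k : ℤ} {C : ∀ p : SuperPoly deg, p ∈ homog deg k → Prop}
    (word : ∀ l : List X, ∀ h : (l.map deg).sum = k,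
      C (l.map (gen deg)).prod (Submodule.subset_span ⟨l, h, rfl⟩))
    (zero : C 0 (Submodule.zero_mem _))
    (add : ∀ p q hp hq, C p hp → C q hq → C (p + q) (add_mem hp hq))
    (smul : ∀ (c : ℂ) p hp, C p hp → C (c • p) (Submodule.smul_mem _ _ hp))
    {p : SuperPoly deg} (hp : p ∈ homog deg k) : C p hp := by
  refine Submodule.span_induction (p := C) ?_ zero add smul hp
  rintro _ ⟨l, h, rfl⟩
  exact word l h

/-- The Euler operator, which acts on the component of weight `k` as `k`. -/
def euler (w : X → ℤ) : Module.End ℂ (SuperPoly deg) :=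
  gradeOp (weightGr_isInternal deg w) fun k => (k : ℂ)

lemma euler_gen_mul (w : X → ℤ) (x : X) (p : SuperPoly deg) :
    euler deg w (gen deg x * p) = (w x : ℂ) • (gen deg x * p) + gen deg x * euler deg w p := by
  have := gradeOp_comm_of_map (weightGr_isInternal deg w) (weightGr_isInternal deg w)
    (f := LinearMap.mulLeft ℂ (gen deg x)) (δ := w x)
    (fun k m hm => gen_mul_mem_weightGr deg w x hm) (fun k => (k : ℂ)) p
  rw [LinearMap.mulLeft_apply] at this
  rw [euler, this, LinearMap.mulLeft_apply, ← mul_smul_comm, ← mul_add]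
  congr 1
  refine LinearMap.congr_fun (g := (w x : ℂ) • LinearMap.id + gradeOp _ fun k : ℤ => (k : ℂ))
    (grade_hom_ext (weightGr_isInternal deg w) fun l m hm => ?_) p
  simp [gradeOp_of_mem _ _ hm, add_smul]

/-- The sum of the w(y) y ∂_y obeys the recursion `euler_gen_mul` under multiplication by a
generator. There may be infinitely many generators, so the sum runs over any finite set that is
large enough for p. -/
lemma euler_eq_sum (w : X → ℤ) (p : SuperPoly deg) : ∃ F : Finset X, ∀ F', F ⊆ F' →
    euler deg w p = ∑ y ∈ F', (w y : ℂ) • (gen deg y * pderiv deg y p) := by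
  classical
  induction p using gen_induction with
  | one =>
    refine ⟨∅, fun F' _ => ?_⟩
    rw [euler, gradeOp_of_mem _ _ (one_mem_weightGr deg w)]
    simp
  | add p q hp hq =>
    obtain ⟨F, hF⟩ := hp
    obtain ⟨F', hF'⟩ := hq
    refine ⟨F ∪ F', fun G hG => ?_⟩
    rw [map_add, hF G (Finset.union_subset_left hG), hF' G (Finset.union_subset_right hG),
      ← Finset.sum_add_distrib]
    simp [mul_add]
  | smul c p hp =>
    obtain ⟨F, hF⟩ := hp
    refine ⟨F, fun G hG => ?_⟩
    rw [map_smul, hF G hG, Finset.smul_sum]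
    simp [smul_comm c]
  | gen_mul x p hp =>
    obtain ⟨F, hF⟩ := hp
    refine ⟨insert x F, fun G hG => ?_⟩
    rw [euler_gen_mul, hF G ((Finset.subset_insert _ _).trans hG), Finset.mul_sum]
    simp only [pderiv_mul, pderiv_gen, mul_add, smul_add, Finset.sum_add_distrib]
    congr 1
    · rw [Finset.sum_eq_single x]
      · simp
      · intro y _ hy
        simp [hy.symm]
      · intro hx
        exact absurd (hG (by simp)) hx
    -- The sign from moving ∂_y past x cancels the sign from exchanging x and y.
    · refine Finset.sum_congr rfl fun y _ => ?_
      rw [mul_smul_comm, twist_gen, smul_mul_assoc, mul_smul_comm, ← mul_assoc, ← mul_assoc,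
        gen_mul_gen deg x y, mul_comm (deg x), smul_mul_assoc]

/-- The projection to the constants. -/
def const : Module.End ℂ (SuperPoly deg) :=
  gradeOp (weightGr_isInternal deg fun _ => 1) (Pi.single 0 1)

lemma const_mem (p : SuperPoly deg) : ∃ c : ℂ, const deg p = c • 1 := by
  have h := gradeOp_single_mem (weightGr_isInternal deg fun _ => 1) 0 p
  have : ∀ q ∈ weightGr deg (fun _ => 1) 0, ∃ c : ℂ, q = c • 1 := by
    intro q hq
    induction hq using Submodule.span_induction with
    | mem q hq =>
      obtain ⟨l, hl, rfl⟩ := hq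
      cases l with
      | nil => exact ⟨1, by simp⟩
      | cons x l =>
        simp at hl
        omega
    | zero => exact ⟨0, by simp⟩
    | add p q _ _ hp hq =>
      obtain ⟨a, rfl⟩ := hp
      obtain ⟨b, rfl⟩ := hq
      exact ⟨a + b, by rw [add_smul]⟩
    | smul c p _ hp =>
      obtain ⟨a, rfl⟩ := hp
      exact ⟨c * a, by rw [smul_smul]⟩
  exact this _ h

variable {S : Type*} [AddCommGroup S] [Module ℂ S]

/-- A Poincaré lemma: the Euler operator ∑ y ∂_y kills t, and it is invertible away from the
constants in characteristic zero. It will identify vacuum vectors of Fock spaces. -/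
lemma exists_eq_one_tmul {t : SuperPoly deg ⊗[ℂ] S}
    (ht : ∀ y, (pderiv deg y).rTensor S t = 0) : ∃ s : S, t = 1 ⊗ₜ s := by
  -- The inverse of the polynomial degree; on constants the convention `0⁻¹ = 0` applies.
  set E' := gradeOp (weightGr_isInternal deg fun _ => 1) fun k => (k : ℂ)⁻¹ with hE'
  have h1 : E' * euler deg (fun _ => 1) + const deg = 1 := by
    rw [hE', euler, gradeOp_mul, const]
    refine grade_hom_ext (weightGr_isInternal deg fun _ => 1) fun k p hp => ?_
    simp only [LinearMap.add_apply, gradeOp_of_mem _ _ hp]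
    by_cases hk : k = 0
    · subst hk; simp
    · simp [hk]
  have h2 : ∀ t : SuperPoly deg ⊗[ℂ] S, ∃ F : Finset X, ∀ F', F ⊆ F' →
      (euler deg fun _ => 1).rTensor S t =
        ∑ y ∈ F', (LinearMap.mulLeft ℂ (gen deg y)).rTensor S ((pderiv deg y).rTensor S t) := by
    classical
    intro t
    induction t with
    | zero => exact ⟨∅, by simp⟩
    | tmul p s =>
      obtain ⟨F, hF⟩ := euler_eq_sum deg (fun _ => 1) p
      refine ⟨F, fun G hG => ?_⟩
      simp only [LinearMap.rTensor_tmul, hF G hG, TensorProduct.sum_tmul]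
      simp
    | add p q hp hq =>
      obtain ⟨F, hF⟩ := hp
      obtain ⟨F', hF'⟩ := hq
      refine ⟨F ∪ F', fun G hG => ?_⟩
      rw [map_add, hF G (Finset.union_subset_left hG), hF' G (Finset.union_subset_right hG),
        ← Finset.sum_add_distrib]
      simp
  obtain ⟨F, hF⟩ := h2 t
  have h3 : (euler deg fun _ => 1).rTensor S t = 0 := by
    rw [hF F subset_rfl]
    simp [ht]
  have h4 : t = (const deg).rTensor S t := by
    have := LinearMap.congr_fun (congrArg (LinearMap.rTensor S) h1) t
    rw [LinearMap.rTensor_add, Module.End.mul_eq_comp, LinearMap.rTensor_comp] at this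
    simp only [LinearMap.add_apply, LinearMap.comp_apply, h3, map_zero, zero_add] at this
    rw [this, Module.End.one_eq_id, LinearMap.rTensor_id, LinearMap.id_apply]
  have h5 : ∀ t : SuperPoly deg ⊗[ℂ] S, ∃ s : S, (const deg).rTensor S t = 1 ⊗ₜ s := by
    intro t
    induction t with
    | zero => exact ⟨0, by simp⟩
    | tmul p s =>
      obtain ⟨c, hc⟩ := const_mem deg p
      exact ⟨c • s, by rw [LinearMap.rTensor_tmul, hc, TensorProduct.smul_tmul]⟩
    | add p q hp hq =>
      obtain ⟨a, ha⟩ := hp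
      obtain ⟨b, hb⟩ := hq
      exact ⟨a + b, by rw [map_add, ha, hb, TensorProduct.tmul_add]⟩
  obtain ⟨s, hs⟩ := h5 t
  exact ⟨s, h4.trans hs⟩

end SuperPoly

/-! ### Representations of Heisenberg–Clifford superalgebras on a Fock space -/

/-- All words of length `n` in the operators `a` kill `m`. -/
def KilledByWords {X M : Type*} [AddCommGroup M] [Module ℂ M] (a : X → Module.End ℂ M) :
    ℕ → M → Prop
  | 0, m => m = 0
  | n + 1, m => ∀ x, KilledByWords a n (a x m)

namespace KilledByWords

variable {X M : Type*} [AddCommGroup M] [Module ℂ M] {a : X → Module.End ℂ M}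

lemma zero (n : ℕ) : KilledByWords a n 0 := by
  induction n with
  | zero => rfl
  | succ n ih => intro x; rwa [map_zero]

lemma add {n : ℕ} {m m' : M} (h : KilledByWords a n m) (h' : KilledByWords a n m') :
    KilledByWords a n (m + m') := by
  induction n generalizing m m' with
  | zero => simp_all [KilledByWords]
  | succ n ih => intro x; rw [map_add]; exact ih (h x) (h' x)

lemma smul {n : ℕ} {m : M} (c : ℂ) (h : KilledByWords a n m) : KilledByWords a n (c • m) := by
  induction n generalizing m with
  | zero => simp_all [KilledByWords]
  | succ n ih => intro x; rw [map_smul]; exact ih (h x)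

lemma succ {n : ℕ} {m : M} (h : KilledByWords a n m) : KilledByWords a (n + 1) m := by
  induction n generalizing m with
  | zero =>
    intro x
    simp only [KilledByWords] at h ⊢
    simp [h]
  | succ n ih => intro x; exact ih (h x)

lemma mono {n n' : ℕ} {m : M} (h : KilledByWords a n m) (hn : n ≤ n') : KilledByWords a n' m := by
  induction n', hn using Nat.le_induction with
  | base => exact h
  | succ n' _ ih => exact ih.succ

lemma pow_eq_zero {n : ℕ} {m : M} (h : KilledByWords a n m) (x : X) : (a x ^ n) m = 0 := by
  induction n generalizing m with
  | zero => simpa [KilledByWords] using h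
  | succ n ih => rw [pow_succ]; exact ih (h x)

/-- A word longer than the sum of the e(x) contains some letter x more than e(x) times, and letters
can be reordered up to scalars. In the induction, applying one letter lowers its exponent by one and
leaves the other exponents unchanged. -/
lemma of_pow {ε : X → X → ℂ} (hcomm : ∀ x y m, a x (a y m) = ε x y • a y (a x m))
    (e : X →₀ ℕ) {m : M} (h : ∀ x, (a x ^ (e x + 1)) m = 0) : ∃ n, KilledByWords a n m := by
  classical
  have key : ∀ n (e : X →₀ ℕ), (e.sum fun _ k => k) = n → ∀ m, (∀ x, (a x ^ (e x + 1)) m = 0) →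
      KilledByWords a (n + 1) m := by
    intro n
    induction n with
    | zero =>
      intro e he m h x
      have hx : e x = 0 := by
        by_contra hx
        have := Finset.single_le_sum (f := fun y => e y) (fun _ _ => Nat.zero_le _)
          (Finsupp.mem_support_iff.2 hx)
        simp only [Finsupp.sum] at he
        omega
      simpa [KilledByWords, hx] using h x
    | succ n ih =>
      intro e he m h x
      by_cases hx : e x = 0
      · have : a x m = 0 := by simpa [hx] using h x
        rw [this]
        exact KilledByWords.zero _
      · have hle : Finsupp.single x 1 ≤ e := by
          rw [Finsupp.single_le_iff]
          omega
        refine ih (e - Finsupp.single x 1) ?_ _ fun y => ?_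
        · have h2 : ((e - Finsupp.single x 1) + Finsupp.single x 1).sum (fun _ k => k) = n + 1 := by
            rw [tsub_add_cancel_of_le hle, he]
          rw [Finsupp.sum_add_index' (by simp) (by simp)] at h2
          simpa using h2
        · by_cases hy : y = x
          · subst hy
            have h3 := h y
            rw [pow_succ] at h3
            have : (e - Finsupp.single y 1 : X →₀ ℕ) y + 1 = e y := by
              simp only [Finsupp.coe_tsub, Pi.sub_apply, Finsupp.single_eq_same]
              omega
            rw [this]
            exact h3
          · have h3 : ∀ k m, (a y ^ k) (a x m) = ε y x ^ k • a x ((a y ^ k) m) := by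
              intro k
              induction k with
              | zero => simp
              | succ k ihk =>
                intro m
                rw [pow_succ (a y), Module.End.mul_apply, hcomm, map_smul, ihk, smul_smul, pow_succ,
                  Module.End.mul_apply, mul_comm]
            have h4 : (e - Finsupp.single x 1 : X →₀ ℕ) y = e y := by
              simp [Ne.symm hy]
            rw [h4, h3, h y, map_zero, smul_zero]
  exact ⟨_, key _ e rfl m h⟩

end KilledByWords

/-- Creation operators `cr y` and annihilation operators `an y` with the canonical
supercommutation relations. -/
structure IsFock {X : Type} (deg : X → ℤ) {M : Type*} [AddCommGroup M] [Module ℂ M]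
    (cr an : X → Module.End ℂ M) : Prop where
  cr_cr : ∀ x y, cr x * cr y = sgn (deg x * deg y) • (cr y * cr x)
  an_an : ∀ x y m, an x (an y m) = sgn (deg x * deg y) • an y (an x m)
  an_cr : ∀ x m, an x (cr x m) = m + sgn (deg x * deg x) • cr x (an x m)
  an_cr_ne : ∀ x y m, x ≠ y → an x (cr y m) = sgn (deg x * deg y) • cr y (an x m)

namespace IsFock

variable {X : Type} {deg : X → ℤ} {M : Type*} [AddCommGroup M] [Module ℂ M]
  {cr an : X → Module.End ℂ M} (h : IsFock deg cr an)

/-- The vectors killed by the annihilation operators. -/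
def vac (an : X → Module.End ℂ M) : Submodule ℂ M := ⨅ y, LinearMap.ker (an y)

lemma mem_vac {m : M} : m ∈ vac an ↔ ∀ y, an y m = 0 := by simp [vac]

include h in
-- Moving an annihilation operator through a polynomial in the creation operators differentiates
-- that polynomial. On vacuum vectors only the derivative survives (`an_fockMap`).
lemma an_lift (y : X) (p : SuperPoly deg) (m : M) :
    an y (SuperPoly.lift cr h.cr_cr p m) = SuperPoly.lift cr h.cr_cr (SuperPoly.pderiv deg y p) m +
      SuperPoly.lift cr h.cr_cr (SuperPoly.twist deg (deg y) p) (an y m) := by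
  classical
  induction p using SuperPoly.gen_induction generalizing m with
  | one => simp
  | add p q hp hq => simp only [map_add, LinearMap.add_apply, hp, hq]; abel
  | smul c p hp => simp only [map_smul, LinearMap.smul_apply, hp, smul_add]
  | gen_mul x p hp =>
    simp only [map_mul, SuperPoly.lift_gen, Module.End.mul_apply, SuperPoly.pderiv_mul,
      SuperPoly.pderiv_gen, SuperPoly.twist_gen, map_add, LinearMap.add_apply, map_smul,
      LinearMap.smul_apply]
    by_cases hx : x = y
    · subst hx
      rw [h.an_cr, hp]
      simp [smul_add, add_assoc]
    · rw [h.an_cr_ne _ _ _ (Ne.symm hx), hp]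
      simp [hx, smul_add]

/-- The map `p ⊗ m ↦ p m` from the Fock space with values in the vacuum vectors. -/
def fockMap : SuperPoly deg ⊗[ℂ] vac an →ₗ[ℂ] M :=
  TensorProduct.lift
    ((LinearMap.lcomp ℂ M (vac an).subtype) ∘ₗ (SuperPoly.lift cr h.cr_cr).toLinearMap)

@[simp] lemma fockMap_tmul (p : SuperPoly deg) (m : vac an) :
    h.fockMap (p ⊗ₜ m) = SuperPoly.lift cr h.cr_cr p m := rfl

lemma an_fockMap (y : X) (t : SuperPoly deg ⊗[ℂ] vac an) :
    an y (h.fockMap t) = h.fockMap ((SuperPoly.pderiv deg y).rTensor _ t) := by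
  induction t with
  | zero => simp
  | add s t hs ht => simp [hs, ht]
  | tmul p m => simp [h.an_lift, mem_vac.1 m.2 y]

lemma cr_fockMap (y : X) (t : SuperPoly deg ⊗[ℂ] vac an) :
    cr y (h.fockMap t) =
      h.fockMap ((LinearMap.mulLeft ℂ (SuperPoly.gen deg y)).rTensor _ t) := by
  induction t with
  | zero => simp
  | add s t hs ht => simp [hs, ht]
  | tmul p m => simp

lemma killedByWords_gen_mul {n : ℕ} {p : SuperPoly deg}
    (hp : KilledByWords (SuperPoly.pderiv deg) n p) (x : X) :
    KilledByWords (SuperPoly.pderiv deg) (n + 1) (SuperPoly.gen deg x * p) := by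
  classical
  induction n generalizing p with
  | zero =>
    simp only [KilledByWords] at hp
    subst hp
    rw [mul_zero]
    exact KilledByWords.zero _
  | succ n ih =>
    intro y
    rw [SuperPoly.pderiv_mul, SuperPoly.pderiv_gen, SuperPoly.twist_gen, smul_mul_assoc]
    refine KilledByWords.add ?_ (KilledByWords.smul _ (ih (hp y)))
    split_ifs
    · rwa [one_mul]
    · rw [zero_mul]; exact KilledByWords.zero _

lemma exists_killedByWords (p : SuperPoly deg) :
    ∃ n, KilledByWords (SuperPoly.pderiv deg) n p := by
  induction p using SuperPoly.gen_induction with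
  | one => exact ⟨1, fun x => SuperPoly.pderiv_one deg x⟩
  | add p q hp hq =>
    obtain ⟨n, hn⟩ := hp
    obtain ⟨n', hn'⟩ := hq
    exact ⟨max n n', (hn.mono (le_max_left _ _)).add (hn'.mono (le_max_right _ _))⟩
  | smul c p hp =>
    obtain ⟨n, hn⟩ := hp
    exact ⟨n, hn.smul c⟩
  | gen_mul x p hp =>
    obtain ⟨n, hn⟩ := hp
    exact ⟨n + 1, killedByWords_gen_mul hn x⟩

lemma exists_killedByWords_rTensor {S : Type*} [AddCommGroup S] [Module ℂ S]
    (t : SuperPoly deg ⊗[ℂ] S) :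
    ∃ n, KilledByWords (fun y => (SuperPoly.pderiv deg y).rTensor S) n t := by
  induction t with
  | zero => exact ⟨0, rfl⟩
  | add s t hs ht =>
    obtain ⟨n, hn⟩ := hs
    obtain ⟨n', hn'⟩ := ht
    exact ⟨max n n', (hn.mono (le_max_left _ _)).add (hn'.mono (le_max_right _ _))⟩
  | tmul p s =>
    obtain ⟨n, hn⟩ := exists_killedByWords p
    refine ⟨n, ?_⟩
    induction n generalizing p with
    | zero => simp_all [KilledByWords]
    | succ n ih => intro x; exact ih _ (hn x)

/-- The annihilation operators act as partial derivatives, so the kernel is stable under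
differentiation, which is nilpotent on each element. A kernel element with vanishing derivatives is
1 ⊗ s and maps to s. Nothing about the size of M enters. -/
lemma fockMap_injective : Function.Injective h.fockMap := by
  rw [← LinearMap.ker_eq_bot, Submodule.eq_bot_iff]
  intro t ht
  obtain ⟨n, hn⟩ := exists_killedByWords_rTensor t
  induction n generalizing t with
  | zero => exact hn
  | succ n ih =>
    have h1 : ∀ y, (SuperPoly.pderiv deg y).rTensor (vac an) t = 0 := fun y => by
      refine ih _ ?_ (hn y)
      rw [LinearMap.mem_ker, ← h.an_fockMap, LinearMap.mem_ker.1 ht, map_zero]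
    obtain ⟨s, rfl⟩ := SuperPoly.exists_eq_one_tmul deg h1
    have : s = 0 := by simpa using ht
    simp [this]

/-- Vectors with finitely many active annihilation operators which are killed by all long words in
the annihilation operators are generated by vacuum vectors. -/
lemma mem_range_fockMap (F : Finset X) {n : ℕ} {m : M} (hn : KilledByWords an n m)
    (hF : ∀ y, y ∉ F → an y m = 0) : m ∈ LinearMap.range h.fockMap := by
  classical
  -- The number operator of the modes in F. For y in F it satisfies an y ∘ H = (H + 1) ∘ an y.
  set H : Module.End ℂ M := ∑ y ∈ F, cr y * an y with hH
  have anH : ∀ y ∈ F, ∀ m, an y (H m) = H (an y m) + an y m := by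
    intro y hy m
    simp only [hH, LinearMap.sum_apply, map_sum, Module.End.mul_apply]
    -- For odd y the relation of an y with itself says that its square is zero, so the sign is
    -- harmless.
    have e1 : sgn (deg y * deg y) • cr y (an y (an y m)) = cr y (an y (an y m)) := by
      conv_rhs => rw [h.an_an y y, map_smul]
    have e2 : ∀ z ∈ F.erase y, an y (cr z (an z m)) = cr z (an z (an y m)) := fun z hz => by
      rw [h.an_cr_ne _ _ _ (Finset.ne_of_mem_erase hz).symm, h.an_an y z, map_smul, smul_smul,
        sgn_mul_self, one_smul]
    rw [← Finset.add_sum_erase _ _ hy, ← Finset.add_sum_erase _ _ hy, h.an_cr, e1,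
      Finset.sum_congr rfl e2]
    abel
  have anH' : ∀ y, y ∉ F → ∀ m, an y m = 0 → an y (H m) = 0 := by
    intro y hy m hm
    simp only [hH, LinearMap.sum_apply, map_sum, Module.End.mul_apply]
    refine Finset.sum_eq_zero fun z hz => ?_
    rw [h.an_cr_ne _ _ _ (fun e => hy (by rw [e]; exact hz)), h.an_an y z, hm]
    simp
  -- the product of the `H - t` for `1 ≤ t ≤ k` is `c + H *` something
  let R : ℕ → Module.End ℂ M := fun k => ((List.range k).map fun t : ℕ => H - ((t : ℂ) + 1) • 1).prod
  have R_succ : ∀ k, R (k + 1) = R k * (H - ((k : ℂ) + 1) • 1) := by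
    intro k
    simp [R, List.range_succ]
  have H_R : ∀ k, H * R k = R k * H := by
    intro k
    induction k with
    | zero => simp [R]
    | succ k ih => rw [R_succ, ← mul_assoc, ih, mul_assoc, mul_assoc]; congr 1; simp [mul_sub, sub_mul]
  -- Passing an y to the right turns each factor H - t into H - t + 1, and the factor with t = 1
  -- becomes H.
  have an_R : ∀ y ∈ F, ∀ k m, an y (R (k + 1) m) = H (R k (an y m)) := by
    intro y hy k
    induction k with
    | zero =>
      intro m
      simp [R, anH y hy]
    | succ k ih =>
      intro m
      rw [R_succ, Module.End.mul_apply, ih, R_succ k, Module.End.mul_apply]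
      congr 2
      simp only [LinearMap.sub_apply, LinearMap.smul_apply, Module.End.one_apply, map_sub, map_smul,
        anH y hy]
      push_cast
      module
  have an_R' : ∀ y, y ∉ F → ∀ k m, an y m = 0 → an y (R k m) = 0 := by
    intro y hy k
    induction k with
    | zero => intro m hm; simpa [R] using hm
    | succ k ih =>
      intro m hm
      rw [R_succ]
      refine ih _ ?_
      simp [anH' y hy m hm, hm]
  -- The equation H R_n m = 0 is carried along because, applied to the vectors an y m, it makes
  -- R_{n+1} m a vacuum vector.
  have key : ∀ n m, KilledByWords an (n + 1) m → (∀ y, y ∉ F → an y m = 0) →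
      m ∈ LinearMap.range h.fockMap ∧ H (R n m) = 0 := by
    intro n
    induction n with
    | zero =>
      intro m hm _
      have hm' : ∀ y, an y m = 0 := hm
      refine ⟨⟨1 ⊗ₜ ⟨m, mem_vac.2 hm'⟩, by simp⟩, ?_⟩
      simp [R, hH, hm']
    | succ n ih =>
      intro m hm hmF
      have h1 : ∀ y, an y m ∈ LinearMap.range h.fockMap ∧ H (R n (an y m)) = 0 := fun y =>
        ih _ (hm y) fun z hz => by rw [h.an_an, hmF z hz]; simp
      have h2 : ∀ y, an y (R (n + 1) m) = 0 := by
        intro y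
        by_cases hy : y ∈ F
        · rw [an_R y hy, (h1 y).2]
        · exact an_R' y hy _ _ (hmF y hy)
      have hLH : ∀ m ∈ LinearMap.range h.fockMap, H m ∈ LinearMap.range h.fockMap := by
        rintro _ ⟨t, rfl⟩
        simp only [hH, LinearMap.sum_apply, Module.End.mul_apply]
        refine Submodule.sum_mem _ fun y _ => ?_
        rw [h.an_fockMap, h.cr_fockMap]
        exact ⟨_, rfl⟩
      have hHm : H m ∈ LinearMap.range h.fockMap := by
        simp only [hH, LinearMap.sum_apply, Module.End.mul_apply]
        refine Submodule.sum_mem _ fun y _ => ?_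
        obtain ⟨t, ht⟩ := (h1 y).1
        rw [← ht, h.cr_fockMap]
        exact ⟨_, rfl⟩
      -- The range is stable under H and contains H m, so modulo the range H - t acts on m as -t and
      -- R_k m is (-1)^k k! m. The constant is nonzero, so m can be recovered from the vacuum vector
      -- R_{n+1} m.
      have h3 : ∀ k, ∃ c : ℂ, c ≠ 0 ∧ R k m - c • m ∈ LinearMap.range h.fockMap := by
        intro k
        induction k with
        | zero => exact ⟨1, one_ne_zero, by simp [R]⟩
        | succ k ihk =>
          obtain ⟨c, hc, hk⟩ := ihk
          refine ⟨-((k : ℂ) + 1) * c, mul_ne_zero (neg_ne_zero.2 (Nat.cast_add_one_ne_zero k)) hc, ?_⟩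
          have e : R (k + 1) m - (-((k : ℂ) + 1) * c) • m =
              H (R k m - c • m) + c • H m - ((k : ℂ) + 1) • (R k m - c • m) := by
            rw [R_succ, Module.End.mul_apply, LinearMap.sub_apply, map_sub,
              show R k (H m) = (R k * H) m from rfl, ← H_R]
            simp only [Module.End.mul_apply, LinearMap.smul_apply, Module.End.one_apply, map_smul,
              map_sub]
            module
          rw [e]
          exact sub_mem (add_mem (hLH _ hk) (Submodule.smul_mem _ _ hHm))
            (Submodule.smul_mem _ _ hk)
      obtain ⟨c, hc, hk⟩ := h3 (n + 1)
      have h4 : R (n + 1) m ∈ LinearMap.range h.fockMap :=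
        ⟨1 ⊗ₜ ⟨_, mem_vac.2 h2⟩, by simp⟩
      refine ⟨?_, ?_⟩
      · have := Submodule.smul_mem _ c⁻¹ (sub_mem h4 hk)
        rwa [sub_sub_cancel, smul_smul, inv_mul_cancel₀ hc, one_smul] at this
      · simp [hH, h2]
  exact (key n m hn.succ hF).1

end IsFock

/-! ### Binomial identities -/

/-- The generalized binomial coefficient `p(p-1)⋯(p-j+1)/j!` as a complex number. -/
def binom (p : ℤ) (j : ℕ) : ℂ := ((Ring.choose p j : ℤ) : ℂ)

lemma binom_natCast (n j : ℕ) : binom n j = (n.choose j : ℂ) := by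
  simp [binom, Ring.choose_natCast]

lemma binom_neg (n k : ℕ) : binom (-n - 1) k = (-1) ^ k * ((n + k).choose n : ℂ) := by
  have h : Ring.choose (-((n : ℤ) + 1)) k = (-1) ^ k * ((n + k).choose n : ℤ) := by
    rw [Ring.choose_neg']
    have : ((n : ℤ) + 1) + k - 1 = ((n + k : ℕ) : ℤ) := by push_cast; ring
    rw [Ring.multichoose_eq, this, Ring.choose_natCast, Nat.choose_symm_add]
    simp [Int.negOnePow_def, Units.smul_def]
  rw [binom, show -(n : ℤ) - 1 = -((n : ℤ) + 1) by ring, h]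
  push_cast
  ring

lemma binom_zero_left (j : ℕ) : binom 0 j = if j = 0 then 1 else 0 := by
  rw [binom, Ring.choose_zero_ite]
  split_ifs <;> simp

lemma sum_binom_mul_binom (a b : ℤ) (t : ℕ) :
    ∑ x ∈ Finset.HasAntidiagonal.antidiagonal t, binom a x.1 * binom b x.2 = binom (a + b) t := by
  rw [binom, Ring.add_choose_eq t (Commute.all a b)]
  simp [binom]

/-- Both sides are the multinomial coefficient (n+k+l)!/(n! k! l!), and so are both sides of
`choose_mul_choose_add`. -/
lemma choose_mul_choose_swap (n k l : ℕ) :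
    ((n + k).choose n : ℂ) * ((n + k + l).choose (n + k) : ℂ) =
      ((n + l).choose n : ℂ) * ((n + l + k).choose (n + l) : ℂ) := by
  simp only [Nat.cast_add_choose]
  rw [show n + l + k = n + k + l by ring]
  have := fun i : ℕ => (Nat.cast_ne_zero (R := ℂ)).2 i.factorial_ne_zero
  field_simp [this]

lemma choose_mul_choose_add (n k l : ℕ) :
    ((n + k).choose n : ℂ) * ((n + k + l).choose (n + k) : ℂ) =
      ((n + (k + l)).choose n : ℂ) * ((k + l).choose k : ℂ) := by
  simp only [Nat.cast_add_choose]
  rw [show n + k + l = n + (k + l) by ring]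
  have := fun i : ℕ => (Nat.cast_ne_zero (R := ℂ)).2 i.factorial_ne_zero
  field_simp [this]

/-- After exchanging the two binomial factors this is Vandermonde's identity for the upper indices p
and -(n+l)-1. -/
lemma sum_binom_choose (p : ℤ) (n l t : ℕ) :
    ∑ x ∈ Finset.HasAntidiagonal.antidiagonal t, binom p x.1 * ((-1) ^ x.2 * (((n + x.2).choose n : ℂ) *
      ((n + x.2 + l).choose (n + x.2) : ℂ))) = ((n + l).choose n : ℂ) * binom (p - n - 1 - l) t := by
  have := sum_binom_mul_binom p (-(n + l : ℕ) - 1) t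
  rw [show p + (-((n + l : ℕ) : ℤ) - 1) = p - n - 1 - l by push_cast; ring] at this
  rw [← this, Finset.mul_sum]
  refine Finset.sum_congr rfl fun x _ => ?_
  rw [choose_mul_choose_swap, binom_neg]
  ring

lemma sum_alt_binom_choose (r : ℤ) (n i t : ℕ) :
    ∑ x ∈ Finset.HasAntidiagonal.antidiagonal t, ((-1) ^ x.1 * binom r x.1) * (((n + x.2).choose n : ℂ) *
      ((n + x.2 + i).choose (n + x.2) : ℂ)) =
      ((n + i).choose n : ℂ) * ((-1) ^ t * binom (r - n - 1 - i) t) := by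
  have := sum_binom_choose r n i t
  have h : ((n + i).choose n : ℂ) * ((-1) ^ t * binom (r - n - 1 - i) t) =
    (-1) ^ t * (((n + i).choose n : ℂ) * binom (r - n - 1 - i) t) := by ring
  rw [h, ← this, Finset.mul_sum]
  refine Finset.sum_congr rfl fun x hx => ?_
  rw [← Finset.HasAntidiagonal.mem_antidiagonal.1 hx, pow_add]
  have : ((-1 : ℂ) ^ x.2) * (-1) ^ x.2 = 1 := by rw [← mul_pow]; simp
  linear_combination (-((-1) ^ x.1 * binom r x.1 * (((n + x.2).choose n : ℂ) *
      ((n + x.2 + i).choose (n + x.2) : ℂ)))) * this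

/-! ### Finite sums -/

section Sums

variable {M : Type*} [AddCommGroup M] [Module ℂ M]

/-- Summation along antidiagonals: the box contains every pair with j + k < T, and all other pairs
contribute zero. -/
lemma sum_range_conv (x y : ℕ → ℂ) (v : ℕ → M) {T J K : ℕ} (hv : ∀ t, T ≤ t → v t = 0)
    (hJ : T ≤ J) (hK : T ≤ K) :
    ∑ j ∈ Finset.range J, ∑ k ∈ Finset.range K, (x j * y k) • v (j + k) =
      ∑ t ∈ Finset.range T, (∑ z ∈ Finset.HasAntidiagonal.antidiagonal t, x z.1 * y z.2) • v t := by
  simp only [Finset.sum_smul]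
  rw [← Finset.sum_product', Finset.sum_sigma']
  refine Finset.sum_bij_ne_zero (fun (a : ℕ × ℕ) _ _ => (⟨a.1 + a.2, a⟩ : Σ _ : ℕ, ℕ × ℕ)) ?_ ?_ ?_ ?_
  · intro a _ ha
    have : a.1 + a.2 < T := by
      by_contra h
      exact ha (by rw [hv _ (by omega), smul_zero])
    simp [this]
  · rintro a _ _ b _ _ hab
    simp only [Sigma.mk.injEq, heq_eq_eq] at hab
    exact hab.2
  · rintro ⟨t, z⟩ hz _
    simp only [Finset.mem_sigma, Finset.mem_range, Finset.HasAntidiagonal.mem_antidiagonal] at hz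
    obtain ⟨ht, rfl⟩ := hz
    exact ⟨z, by simp; omega, by assumption, rfl⟩
  · rintro a _ _
    rfl

lemma sum_range_choose_shift (i : ℕ) (f : ℕ → M) {K L : ℕ} (hf : ∀ k, K ≤ k → f k = 0)
    (hL : K ≤ L) (y : ℕ → ℂ) (hy : ∀ k, k < i → y k = 0) :
    ∑ l ∈ Finset.range L, y (i + l) • f (i + l) = ∑ k ∈ Finset.range K, y k • f k := by
  have h1 : ∑ k ∈ Finset.range (i + L), y k • f k = ∑ k ∈ Finset.range K, y k • f k := by
    refine (Finset.sum_subset (fun k hk => ?_) fun k _ hk => ?_).symm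
    · simp only [Finset.mem_range] at hk ⊢; omega
    · rw [hf k (by simpa using hk), smul_zero]
  rw [← h1, Finset.sum_range_add, right_eq_add]
  exact Finset.sum_eq_zero fun k hk => by rw [hy k (Finset.mem_range.1 hk), zero_smul]

end Sums

/-! ### The Borcherds identity for normally ordered products -/

namespace ChiralField

variable {M : Type*} [AddCommGroup M] [Module ℂ M]

lemma exists_trunc_family (φ : ℕ → VertexOperator ℂ M) (m : ℕ → M) (K : ℕ) :
    ∃ N : ℕ, ∀ i < K, ∀ n : ℤ, (N : ℤ) ≤ n → mode (φ i) n (m i) = 0 := by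
  choose N hN using fun i => exists_trunc (φ i) (m i)
  refine ⟨(Finset.range K).sup N, fun i hi n hn => hN i n ?_⟩
  have := Finset.le_sup (f := N) (Finset.mem_range.2 hi)
  omega

/-- The residue of `z^p w^q (z-w)^r φ(z) ψ(w)`, expanded in the domain `|z| > |w|`. -/
def resLeft (φ ψ : VertexOperator ℂ M) (p q r : ℤ) (m : M) : M :=
  ∑ᶠ j : ℕ, ((-1) ^ j * binom r j) • mode φ (p + r - j) (mode ψ (q + j) m)

/-- Up to sign, the residue of `z^p w^q (z-w)^r ψ(w) φ(z)`, expanded in the domain `|w| > |z|`. -/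
def resRight (φ ψ : VertexOperator ℂ M) (p q r : ℤ) (m : M) : M :=
  ∑ᶠ j : ℕ, ((-1) ^ j * binom r j) • mode ψ (q + r - j) (mode φ (p + j) m)

/-- The residue of `z^p w^q (z-w)^r Θ(w, z-w)`, expanded in the domain `|w| > |z-w|`, where `Θ t` is
the coefficient of `(z-w)^{-t-1}` in `Θ`. -/
def resIter (Θ : ℤ → VertexOperator ℂ M) (p q r : ℤ) (m : M) : M :=
  ∑ᶠ j : ℕ, binom p j • mode (Θ (r + j)) (p + q - j) m

lemma resLeft_eq (φ ψ : VertexOperator ℂ M) (p q r : ℤ) (m : M) (N : ℕ)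
    (hN : ∀ j : ℕ, N ≤ j → mode ψ (q + j) m = 0) :
    resLeft φ ψ p q r m = ∑ j ∈ Finset.range N,
      ((-1) ^ j * binom r j) • mode φ (p + r - j) (mode ψ (q + j) m) :=
  finsum_eq_range N fun j hj => by rw [hN j hj]; simp

lemma resRight_eq (φ ψ : VertexOperator ℂ M) (p q r : ℤ) (m : M) (N : ℕ)
    (hN : ∀ j : ℕ, N ≤ j → mode φ (p + j) m = 0) :
    resRight φ ψ p q r m = ∑ j ∈ Finset.range N,
      ((-1) ^ j * binom r j) • mode ψ (q + r - j) (mode φ (p + j) m) :=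
  finsum_eq_range N fun j hj => by rw [hN j hj]; simp

lemma resIter_eq (Θ : ℤ → VertexOperator ℂ M) (p q r : ℤ) (m : M) (N : ℕ)
    (hN : ∀ j : ℕ, N ≤ j → Θ (r + j) = 0) :
    resIter Θ p q r m = ∑ j ∈ Finset.range N, binom p j • mode (Θ (r + j)) (p + q - j) m :=
  finsum_eq_range N fun j hj => by rw [hN j hj]; simp [mode]

/-- `φ'` is the normally ordered product `:(1/n!) ∂_z^n γ(z) φ(z):`, where `η = (-1)^{|γ||φ|}`. -/
def IsNormalOrder (γ φ : VertexOperator ℂ M) (n : ℕ) (η : ℂ) (φ' : VertexOperator ℂ M) : Prop :=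
  ∀ (k : ℤ) (m : M) (N N' : ℕ), (∀ j : ℕ, N ≤ j → mode φ (k + j) m = 0) →
    (∀ j : ℕ, N' ≤ j → mode γ j m = 0) →
    mode φ' k m =
      ∑ j ∈ Finset.range N, ((n + j).choose n : ℂ) • mode γ (-n - 1 - j) (mode φ (k + j) m) +
      ∑ j ∈ Finset.range N', ((-1) ^ n * η * ((n + j).choose n : ℂ)) •
        mode φ (k - n - 1 - j) (mode γ j m)

variable {γ φ φ' ψ : VertexOperator ℂ M} {n : ℕ} {η ε : ℂ} {ψ' : ℕ → VertexOperator ℂ M} {I : ℕ}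

/-- In φ' ψ the creation modes of γ already stand on the left. The annihilation modes have to pass
ψ, at the cost of ε and of the contractions ψ' i. A contraction carries the kernel (1/n!) ∂_z^n
(z-w)^{-i-1}, up to the constant (-1)^n C(n+i,n) a power of z-w, so it is a residue with r lowered
to r - n - 1 - i. On coefficients this is a Vandermonde sum. The formula is stated for all large N
so that the three recursions can be compared at a common N. -/
lemma resLeft_rec (hφ : IsNormalOrder γ φ n η φ')
    (hψ : ∀ p q m, mode γ p (mode ψ q m) = ε • mode ψ q (mode γ p m) +
      ∑ i ∈ Finset.range I, binom p i • mode (ψ' i) (p + q - i) m) (p q r : ℤ) (m : M) :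
    ∃ N₀ : ℕ, ∀ N, N₀ ≤ N → resLeft φ' ψ p q r m =
      ∑ k ∈ Finset.range N, ((n + k).choose n : ℂ) •
        mode γ (-n - 1 - k) (resLeft φ ψ (p + k) q r m) +
      ∑ k ∈ Finset.range N, ((-1) ^ n * η * ε * ((n + k).choose n : ℂ)) •
        resLeft φ ψ (p - n - 1 - k) q r (mode γ k m) +
      ∑ i ∈ Finset.range I, ((-1) ^ n * η * ((n + i).choose n : ℂ)) •
        resLeft φ (ψ' i) p q (r - n - 1 - i) m := by
  obtain ⟨K₀, hK₀⟩ := exists_trunc γ m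
  obtain ⟨J₁, hJ₁⟩ := exists_trunc ψ m
  obtain ⟨J₂, hJ₂⟩ := exists_trunc_family (fun _ => ψ) (fun k => mode γ k m) K₀
  obtain ⟨J₃, hJ₃⟩ := exists_trunc_family ψ' (fun _ => m) I
  -- the bounds on the summation indices
  set T := (J₃ - q).toNat with hT
  set J := (J₁ - q).toNat + (J₂ - q).toNat + T + I with hJ
  obtain ⟨K₁, hK₁⟩ := exists_trunc_family (fun _ => φ) (fun j => mode ψ (q + j) m) J
  obtain ⟨K₂, hK₂⟩ := exists_trunc_family (fun _ => γ) (fun j => mode ψ (q + j) m) J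
  refine ⟨K₀ + (K₁ - p - r + J).toNat + K₂ + T + I, fun K hK => ?_⟩
  have hψJ : ∀ j : ℕ, J ≤ j → mode ψ (q + j) m = 0 := fun j hj => hJ₁ _ (by omega)
  have hψT : ∀ i < I, ∀ j : ℕ, T ≤ j → mode (ψ' i) (q + j) m = 0 :=
    fun i hi j hj => hJ₃ i hi _ (by omega)
  have hψγ : ∀ k : ℕ, ∀ j : ℕ, J ≤ j → mode ψ (q + j) (mode γ k m) = 0 := by
    intro k j hj
    by_cases hk : k < K₀
    · exact hJ₂ k hk _ (by omega)
    · rw [hK₀ _ (by omega), map_zero]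
  rw [resLeft_eq _ _ _ _ _ _ J hψJ]
  have e1 : ∀ j ∈ Finset.range J, ((-1) ^ j * binom r j) •
      mode φ' (p + r - j) (mode ψ (q + j) m) =
      ∑ k ∈ Finset.range K, ((n + k).choose n : ℂ) • mode γ (-n - 1 - k)
        (((-1) ^ j * binom r j) • mode φ (p + k + r - j) (mode ψ (q + j) m)) +
      ∑ k ∈ Finset.range K, ((-1) ^ n * η * ε * ((n + k).choose n : ℂ)) •
        (((-1) ^ j * binom r j) •
          mode φ (p - n - 1 - k + r - j) (mode ψ (q + j) (mode γ k m))) +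
      ∑ k ∈ Finset.range K, ∑ i ∈ Finset.range I,
        ((-1) ^ n * η * ((n + k).choose n : ℂ) * ((-1) ^ j * binom r j) * binom k i) •
          mode φ (p + r - n - 1 - (j + k : ℕ)) (mode (ψ' i) (q + (j + k : ℕ) - i) m) := by
    intro j hj
    have hj' := Finset.mem_range.1 hj
    rw [hφ _ _ K K (fun k hk => hK₁ j hj' _ (by omega)) (fun k hk => hK₂ j hj' _ (by omega)),
      smul_add, Finset.smul_sum, Finset.smul_sum]
    conv_rhs => rw [add_assoc, ← Finset.sum_add_distrib]
    congr 1
    · refine Finset.sum_congr rfl fun k _ => ?_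
      rw [map_smul, smul_comm, show p + k + r - j = p + r - j + k by ring]
    · refine Finset.sum_congr rfl fun k _ => ?_
      rw [hψ, map_add, map_smul, map_sum, smul_add, smul_add, Finset.smul_sum, Finset.smul_sum]
      congr 1
      · rw [show p - n - 1 - k + r - j = p + r - j - n - 1 - k by ring]
        simp only [smul_smul]
        congr 1
        ring
      · refine Finset.sum_congr rfl fun i _ => ?_
        rw [map_smul]
        simp only [smul_smul]
        rw [show p + r - n - 1 - ((j + k : ℕ) : ℤ) = p + r - j - n - 1 - k by push_cast; ring,
          show q + ((j + k : ℕ) : ℤ) - i = k + (q + j) - i by push_cast; ring]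
        congr 1
        ring
  rw [Finset.sum_congr rfl e1, Finset.sum_add_distrib, Finset.sum_add_distrib]
  congr 1
  · congr 1
    · rw [Finset.sum_comm]
      refine Finset.sum_congr rfl fun k _ => ?_
      rw [resLeft_eq _ _ _ _ _ _ J hψJ, map_sum, Finset.smul_sum]
    · rw [Finset.sum_comm]
      refine Finset.sum_congr rfl fun k _ => ?_
      rw [resLeft_eq _ _ _ _ _ _ J (hψγ k), Finset.smul_sum]
  · simp only [Finset.sum_comm (s := Finset.range K) (t := Finset.range I)]
    rw [Finset.sum_comm]
    refine Finset.sum_congr rfl fun i hi => ?_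
    have hi' := Finset.mem_range.1 hi
    rw [resLeft_eq _ _ _ _ _ _ T (hψT i hi'), Finset.smul_sum]
    -- The factor `binom k i` vanishes for k < i. After the substitution k = i + l the vectors
    -- depend on j + l only, so the double sum can be collected along antidiagonals.
    have e2 : ∀ j ∈ Finset.range J, ∑ k ∈ Finset.range K,
        ((-1) ^ n * η * ((n + k).choose n : ℂ) * ((-1) ^ j * binom r j) * binom k i) •
          mode φ (p + r - n - 1 - (j + k : ℕ)) (mode (ψ' i) (q + (j + k : ℕ) - i) m) =
        ∑ l ∈ Finset.range (K - i), (((-1) ^ j * binom r j) * ((-1) ^ n * η *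
          (((n + l).choose n : ℂ) * ((n + l + i).choose (n + l) : ℂ)))) •
          mode φ (p + r - n - 1 - i - (j + l : ℕ)) (mode (ψ' i) (q + (j + l : ℕ)) m) := by
      intro j _
      conv_lhs => rw [show K = i + (K - i) by omega, Finset.sum_range_add]
      rw [Finset.sum_eq_zero, zero_add]
      · refine Finset.sum_congr rfl fun l _ => ?_
        rw [choose_mul_choose_swap]
        rw [show p + r - n - 1 - ((j + (i + l) : ℕ) : ℤ) = p + r - n - 1 - i - (j + l : ℕ) by
          push_cast; ring, show q + ((j + (i + l) : ℕ) : ℤ) - i = q + (j + l : ℕ) by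
          push_cast; ring, binom_natCast]
        congr 1
        have := choose_mul_choose_add n i l
        rw [show n + i + l = n + (i + l) by ring] at this ⊢
        linear_combination (-((-1) ^ n * η * ((-1) ^ j * binom r j))) * this
      · intro k hk
        rw [binom_natCast, Nat.choose_eq_zero_of_lt (Finset.mem_range.1 hk)]
        simp
    rw [Finset.sum_congr rfl e2, sum_range_conv (T := T) (fun j => (-1) ^ j * binom r j)
      (fun l => (-1) ^ n * η * (((n + l).choose n : ℂ) * ((n + l + i).choose (n + l) : ℂ)))
      (fun t => mode φ (p + r - n - 1 - i - (t : ℕ)) (mode (ψ' i) (q + (t : ℕ)) m))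
      (fun t ht => by rw [hψT i hi' t ht, map_zero]) (by omega) (by omega)]
    refine Finset.sum_congr rfl fun t _ => ?_
    rw [smul_smul, show p + (r - n - 1 - i) - t = p + r - n - 1 - i - t by ring, mul_assoc,
      ← sum_alt_binom_choose r n i t, Finset.mul_sum]
    congr 1
    refine Finset.sum_congr rfl fun x _ => ?_
    ring

/-- Now the annihilation modes of γ already stand on the right, and it is the creation modes that
have to pass ψ. Their contractions give the expansion of the same kernel in the opposite domain,
with the opposite sign. -/
lemma resRight_rec (hφ : IsNormalOrder γ φ n η φ') (hε : ε * ε = 1)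
    (hψ : ∀ p q m, mode γ p (mode ψ q m) = ε • mode ψ q (mode γ p m) +
      ∑ i ∈ Finset.range I, binom p i • mode (ψ' i) (p + q - i) m) (p q r : ℤ) (m : M) :
    ∃ N₀ : ℕ, ∀ N, N₀ ≤ N → resRight φ' ψ p q r m =
      ∑ k ∈ Finset.range N, (ε * ((n + k).choose n : ℂ)) •
        mode γ (-n - 1 - k) (resRight φ ψ (p + k) q r m) +
      ∑ k ∈ Finset.range N, ((-1) ^ n * η * ((n + k).choose n : ℂ)) •
        resRight φ ψ (p - n - 1 - k) q r (mode γ k m) -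
      ∑ i ∈ Finset.range I, (ε * (-1) ^ i * ((n + i).choose n : ℂ)) •
        resRight φ (ψ' i) p q (r - n - 1 - i) m := by
  obtain ⟨K₀, hK₀⟩ := exists_trunc γ m
  obtain ⟨T₀, hT₀⟩ := exists_trunc φ m
  obtain ⟨J₁, hJ₁⟩ := exists_trunc_family (fun _ => φ) (fun k => mode γ k m) K₀
  set T := (T₀ - p).toNat with hT
  refine ⟨T + K₀, fun K hK => ?_⟩
  set J := T + (J₁ - p + n + 1 + K).toNat with hJ
  have hψ' : ∀ k q v, mode ψ q (mode γ k v) = ε • mode γ k (mode ψ q v) -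
      ε • ∑ i ∈ Finset.range I, binom k i • mode (ψ' i) (k + q - i) v := by
    intro k q v
    rw [hψ, smul_add, smul_smul, hε, one_smul, add_sub_cancel_right]
  have hφT : ∀ t : ℕ, T ≤ t → mode φ (p + t) m = 0 := fun t ht => hT₀ _ (by omega)
  have hφγ : ∀ k ∈ Finset.range K, ∀ j : ℕ, J ≤ j →
      mode φ (p - n - 1 - k + j) (mode γ k m) = 0 := by
    intro k hk j hj
    have := Finset.mem_range.1 hk
    by_cases hk : k < K₀
    · exact hJ₁ k hk _ (by omega)
    · rw [hK₀ _ (by omega), map_zero]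
  have hN1 : ∀ j k : ℕ, K ≤ k → mode φ (p + j + k) m = 0 := fun j k hk => hT₀ _ (by omega)
  have hN2 : ∀ k : ℕ, K ≤ k → mode γ k m = 0 := fun k hk => hK₀ _ (by omega)
  have hφ' : ∀ j : ℕ, J ≤ j → mode φ' (p + j) m = 0 := by
    intro j hj
    rw [hφ _ _ 0 K (fun k _ => hT₀ _ (by omega)) hN2, Finset.sum_range_zero, zero_add]
    refine Finset.sum_eq_zero fun k hk => ?_
    rw [show p + j - n - 1 - k = p - n - 1 - k + j by ring, hφγ k hk j hj, smul_zero]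
  rw [resRight_eq _ _ _ _ _ _ J hφ']
  have e1 : ∀ j ∈ Finset.range J, ((-1) ^ j * binom r j) •
      mode ψ (q + r - j) (mode φ' (p + j) m) =
      ∑ k ∈ Finset.range K, (ε * ((n + k).choose n : ℂ)) • mode γ (-n - 1 - k)
        (((-1) ^ j * binom r j) • mode ψ (q + r - j) (mode φ (p + k + j) m)) +
      ∑ k ∈ Finset.range K, ((-1) ^ n * η * ((n + k).choose n : ℂ)) •
        (((-1) ^ j * binom r j) •
          mode ψ (q + r - j) (mode φ (p - n - 1 - k + j) (mode γ k m))) -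
      ∑ k ∈ Finset.range K, ∑ i ∈ Finset.range I, (((-1) ^ j * binom r j) *
        (ε * (-1) ^ i * (((n + k).choose n : ℂ) * ((n + k + i).choose (n + k) : ℂ)))) •
          mode (ψ' i) (q + (r - n - 1 - i) - (j + k : ℕ)) (mode φ (p + (j + k : ℕ)) m) := by
    intro j hj
    rw [hφ _ _ K K (hN1 j) hN2, map_add, smul_add, map_sum, map_sum, Finset.smul_sum,
      Finset.smul_sum, add_sub_right_comm (_ : M), ← Finset.sum_sub_distrib]
    congr 1
    · refine Finset.sum_congr rfl fun k _ => ?_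
      rw [map_smul, hψ', smul_sub, smul_sub, map_smul, Finset.smul_sum, Finset.smul_sum,
        Finset.smul_sum]
      congr 1
      · rw [show p + k + j = p + j + k by ring]
        simp only [smul_smul]
        congr 1
        ring
      · refine Finset.sum_congr rfl fun i _ => ?_
        have := binom_neg (n + k) i
        rw [show -((n + k : ℕ) : ℤ) - 1 = -n - 1 - k by push_cast; ring] at this
        rw [this, show q + (r - n - 1 - i) - ((j + k : ℕ) : ℤ) = -n - 1 - k + (q + r - j) - i by
          push_cast; ring, show p + ((j + k : ℕ) : ℤ) = p + j + k by push_cast; ring]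
        simp only [smul_smul]
        congr 1
        ring
    · refine Finset.sum_congr rfl fun k _ => ?_
      rw [map_smul, smul_comm, show p - n - 1 - k + j = p + j - n - 1 - k by ring]
  rw [Finset.sum_congr rfl e1, Finset.sum_sub_distrib, Finset.sum_add_distrib]
  congr 1
  · congr 1
    · rw [Finset.sum_comm]
      refine Finset.sum_congr rfl fun k _ => ?_
      rw [resRight_eq _ _ _ _ _ _ J (fun j hj => hT₀ _ (by omega)), map_sum, Finset.smul_sum]
    · rw [Finset.sum_comm]
      refine Finset.sum_congr rfl fun k hk => ?_
      rw [resRight_eq _ _ _ _ _ _ J (hφγ k hk), Finset.smul_sum]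
  · simp only [Finset.sum_comm (s := Finset.range K) (t := Finset.range I)]
    rw [Finset.sum_comm]
    refine Finset.sum_congr rfl fun i hi => ?_
    rw [resRight_eq _ _ _ _ _ _ T hφT, Finset.smul_sum,
      sum_range_conv (T := T) (fun j => (-1) ^ j * binom r j)
      (fun k => ε * (-1) ^ i * (((n + k).choose n : ℂ) * ((n + k + i).choose (n + k) : ℂ)))
      (fun t => mode (ψ' i) (q + (r - n - 1 - i) - (t : ℕ)) (mode φ (p + (t : ℕ)) m))
      (fun t ht => by rw [hφT t ht, map_zero]) (by omega) (by omega)]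
    refine Finset.sum_congr rfl fun t _ => ?_
    rw [smul_smul, mul_assoc, ← sum_alt_binom_choose r n i t, Finset.mul_sum]
    congr 1
    refine Finset.sum_congr rfl fun x _ => ?_
    ring

/-- Near z = w the Taylor expansion of (1/n!) ∂^n γ(z) has the terms C(n+k,n) (z-w)^k (1/(n+k)!)
∂^{n+k} γ(w), which is why the products ρ (n+k) (t+k) occur. Combined with the expansion of z^p, the
creation and the annihilation parts each sum up by a Vandermonde identity. The contractions Ψ i pass
through unchanged. -/
lemma resIter_rec {Θ Θ' : ℤ → VertexOperator ℂ M} {ρ : ℕ → ℤ → VertexOperator ℂ M}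
    {Ψ : ℕ → ℤ → VertexOperator ℂ M} {T₀ : ℤ} (hΘ : ∀ t, T₀ ≤ t → Θ t = 0)
    (hΨ : ∀ i t, T₀ ≤ t → Ψ i t = 0)
    (hρ : ∀ N t, IsNormalOrder γ (Θ t) N (η * ε) (ρ N t))
    (hΘ' : ∀ t (N : ℕ), T₀ - t ≤ N →
      Θ' t = ∑ k ∈ Finset.range N, ((n + k).choose n : ℂ) • ρ (n + k) (t + k) +
        ∑ i ∈ Finset.range I, ((-1) ^ n * η * ((n + i).choose n : ℂ)) • Ψ i (t - n - 1 - i))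
    (p q r : ℤ) (m : M) :
    ∃ N₀ : ℕ, ∀ N, N₀ ≤ N → resIter Θ' p q r m =
      ∑ k ∈ Finset.range N, ((n + k).choose n : ℂ) •
        mode γ (-n - 1 - k) (resIter Θ (p + k) q r m) +
      ∑ k ∈ Finset.range N, ((-1) ^ n * η * ε * ((n + k).choose n : ℂ)) •
        resIter Θ (p - n - 1 - k) q r (mode γ k m) +
      ∑ i ∈ Finset.range I, ((-1) ^ n * η * ((n + i).choose n : ℂ)) •
        resIter (Ψ i) p q (r - n - 1 - i) m := by
  obtain ⟨K₀, hK₀⟩ := exists_trunc γ m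
  set T := (T₀ - r).toNat with hT
  obtain ⟨L₀, hL₀⟩ := exists_trunc_family (fun t => Θ (r + t)) (fun _ => m) T
  -- for `K ≥ K₁`, the modes `Θ (r + t)_{p + q + K - t}` kill `m`
  set K₁ := (L₀ - p - q + T).toNat with hK₁
  refine ⟨K₀ + K₁, fun K hK => ?_⟩
  have hmode0 : ∀ (k : ℤ) (m : M), mode (0 : VertexOperator ℂ M) k m = 0 := fun k m => by
    simp [mode]
  have hΘT : ∀ t : ℕ, T ≤ t → Θ (r + t) = 0 := fun t ht => hΘ _ (by omega)
  have hΘm : ∀ t : ℕ, ∀ k : ℕ, K ≤ k → mode (Θ (r + t)) (p + q + k - t) m = 0 := by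
    intro t k hk
    by_cases ht : t < T
    · exact hL₀ t ht _ (by omega)
    · rw [hΘT t (by omega), hmode0]
  have hρ0 : ∀ N t, T₀ ≤ t → ρ N t = 0 := by
    intro N t ht
    apply ext_modes
    intro k m
    obtain ⟨K', hK'⟩ := exists_trunc γ m
    rw [hρ N t k m 0 K' (fun j _ => by rw [hΘ t ht, hmode0]) (fun j hj => hK' _ (by omega)),
      hΘ t ht]
    simp [hmode0]
  set J := T + (T₀ - r + n + 1 + I).toNat with hJ
  have hΘ'J : ∀ j : ℕ, J ≤ j → Θ' (r + j) = 0 := by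
    intro j hj
    rw [hΘ' _ 0 (by omega), Finset.sum_range_zero, zero_add]
    refine Finset.sum_eq_zero fun i hi => ?_
    have := Finset.mem_range.1 hi
    rw [hΨ _ _ (by omega), smul_zero]
  rw [resIter_eq _ _ _ _ _ J hΘ'J]
  have e0 : ∀ j ∈ Finset.range J, binom p j • mode (Θ' (r + j)) (p + q - j) m =
      ∑ k ∈ Finset.range T, (binom p j * ((n + k).choose n : ℂ)) •
        mode (ρ (n + k) (r + (j + k : ℕ))) (p + q - j) m +
      ∑ i ∈ Finset.range I, ((-1) ^ n * η * ((n + i).choose n : ℂ)) •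
        (binom p j • mode (Ψ i (r - n - 1 - i + j)) (p + q - j) m) := by
    intro j _
    rw [hΘ' (r + j) T (by omega)]
    simp only [mode, map_add, map_sum, map_smul, Pi.add_apply, Finset.sum_apply, Pi.smul_apply,
      LinearMap.add_apply, LinearMap.sum_apply, LinearMap.smul_apply, smul_add, Finset.smul_sum,
      smul_smul]
    congr 1
    · refine Finset.sum_congr rfl fun k _ => ?_
      rw [show r + ((j + k : ℕ) : ℤ) = r + j + k by push_cast; ring]
    · refine Finset.sum_congr rfl fun i _ => ?_
      rw [show r + j - n - 1 - i = r - n - 1 - i + j by ring, mul_comm (binom p j)]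
  rw [Finset.sum_congr rfl e0, Finset.sum_add_distrib]
  congr 1
  · have e1 : ∀ j ∈ Finset.range J, ∀ k ∈ Finset.range T,
        (binom p j * ((n + k).choose n : ℂ)) •
        mode (ρ (n + k) (r + (j + k : ℕ))) (p + q - j) m =
        ∑ K' ∈ Finset.range K, (binom p j * (((n + K').choose n : ℂ) * (K'.choose k : ℂ))) •
          mode γ (-n - 1 - K') (mode (Θ (r + (j + k : ℕ))) (p + q + K' - (j + k : ℕ)) m) +
        ∑ l ∈ Finset.range K, (binom p j * ((-1) ^ n * η * ε * ((-1) ^ k *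
          (((n + k).choose n : ℂ) * ((n + k + l).choose (n + k) : ℂ))))) •
          mode (Θ (r + (j + k : ℕ))) (p - n - 1 - l + q - (j + k : ℕ)) (mode γ l m) := by
      intro j hj k hk
      have hv : ∀ l : ℕ, K ≤ l →
          mode (Θ (r + (j + k : ℕ))) (p + q - j + l) m = 0 := fun l hl => by
        have := hΘm (j + k) (k + l) (by omega)
        rwa [show p + q + ((k + l : ℕ) : ℤ) - ((j + k : ℕ) : ℤ) = p + q - j + l by
          push_cast; ring] at this
      rw [hρ _ _ _ _ K K hv (fun l hl => hK₀ _ (by omega)), smul_add, Finset.smul_sum,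
        Finset.smul_sum]
      congr 1
      · have := sum_range_choose_shift k (fun K' : ℕ => mode γ (-n - 1 - K')
          (mode (Θ (r + (j + k : ℕ))) (p + q + K' - (j + k : ℕ)) m)) (K := K) (L := K)
          (fun K' hK' => by rw [hΘm _ _ hK', map_zero]) le_rfl
          (fun K' => binom p j * (((n + K').choose n : ℂ) * (K'.choose k : ℂ)))
          (fun K' hK' => by rw [Nat.choose_eq_zero_of_lt hK']; simp)
        rw [← this]
        refine Finset.sum_congr rfl fun l _ => ?_
        rw [← choose_mul_choose_add, smul_smul, mul_assoc,
          show -((n + k : ℕ) : ℤ) - 1 - l = -n - 1 - ((k + l : ℕ) : ℤ) by push_cast; ring,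
          show p + q - j + l = p + q + ((k + l : ℕ) : ℤ) - ((j + k : ℕ) : ℤ) by push_cast; ring]
      · refine Finset.sum_congr rfl fun l _ => ?_
        rw [smul_smul, show p + q - j - ((n + k : ℕ) : ℤ) - 1 - l =
          p - n - 1 - l + q - ((j + k : ℕ) : ℤ) by push_cast; ring, pow_add]
        congr 1
        ring
    rw [Finset.sum_congr rfl fun j hj => Finset.sum_congr rfl (e1 j hj)]
    simp only [Finset.sum_add_distrib]
    congr 1
    · simp only [Finset.sum_comm (s := Finset.range T) (t := Finset.range K)]
      rw [Finset.sum_comm]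
      refine Finset.sum_congr rfl fun K' _ => ?_
      rw [sum_range_conv (T := T) (fun j => binom p j)
        (fun k => ((n + K').choose n : ℂ) * (K'.choose k : ℂ))
        (fun t => mode γ (-n - 1 - K') (mode (Θ (r + (t : ℕ))) (p + q + K' - (t : ℕ)) m))
        (fun t ht => by rw [hΘT t ht, hmode0, map_zero]) (by omega) le_rfl,
        resIter_eq _ _ _ _ _ T hΘT, map_sum, Finset.smul_sum]
      refine Finset.sum_congr rfl fun t _ => ?_
      rw [map_smul, smul_smul, show p + K' + q - t = p + q + K' - t by ring,
        ← sum_binom_mul_binom, Finset.mul_sum]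
      congr 1
      refine Finset.sum_congr rfl fun x _ => ?_
      rw [binom_natCast]
      ring
    · simp only [Finset.sum_comm (s := Finset.range T) (t := Finset.range K)]
      rw [Finset.sum_comm]
      refine Finset.sum_congr rfl fun l _ => ?_
      rw [sum_range_conv (T := T) (fun j => binom p j)
        (fun k => (-1) ^ n * η * ε * ((-1) ^ k *
          (((n + k).choose n : ℂ) * ((n + k + l).choose (n + k) : ℂ))))
        (fun t => mode (Θ (r + (t : ℕ))) (p - n - 1 - l + q - (t : ℕ)) (mode γ l m))
        (fun t ht => by rw [hΘT t ht, hmode0]) (by omega) le_rfl,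
        resIter_eq _ _ _ _ _ T hΘT, Finset.smul_sum]
      refine Finset.sum_congr rfl fun t _ => ?_
      rw [smul_smul, mul_assoc ((-1) ^ n * η * ε), ← sum_binom_choose, Finset.mul_sum]
      congr 1
      refine Finset.sum_congr rfl fun x _ => ?_
      ring
  · rw [Finset.sum_comm]
    refine Finset.sum_congr rfl fun i hi => ?_
    have := Finset.mem_range.1 hi
    rw [resIter_eq _ _ _ _ _ J (fun j hj => hΨ _ _ (by omega)), Finset.smul_sum]

end ChiralField

/-! ### Graded smooth modules over the Heisenberg–Clifford superalgebra -/

open Classical in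
/-- The coefficient of the identity in the supercommutator `[g_{(p)}, h_{(q)}]`. -/
def Coord.contr {ι : Type} (deg : ι → ℤ) (g h : Coord ι) (p q : ℤ) : ℂ :=
  if h = dual g ∧ p + q = -1 then pairing deg g else 0

lemma Coord.dual_dual {ι : Type} (g : Coord ι) : dual (dual g) = g := by cases g <;> rfl

/-- A graded space with locally truncated operators `g_{(n)}` for the coordinates `g` which satisfy
the commutation relations of the fields of `𝒟^{ch}_P`. -/
structure HeisRep {ι : Type} (deg : ι → ℤ) (M : Type*) [AddCommGroup M] [Module ℂ M] where
  gr : ℤ → Submodule ℂ M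
  isInternal : DirectSum.IsInternal gr
  op : Coord ι → ℤ → Module.End ℂ M
  op_mem : ∀ g n k, ∀ m ∈ gr k, op g n m ∈ gr (Coord.degree deg g + k)
  trunc : ∀ g m, ∃ N : ℤ, ∀ n, N ≤ n → op g n m = 0
  comm : ∀ g h p q m, op g p (op h q m) =
    sgn (Coord.degree deg g * Coord.degree deg h) • op h q (op g p m) +
      Coord.contr deg g h p q • m

namespace HeisRep

open Chiral SuperPoly ChiralField

variable {ι : Type} {deg : ι → ℤ} {M : Type*} [AddCommGroup M] [Module ℂ M] (R : HeisRep deg M)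

/-- The involution `m ↦ (-1)^{δ|m|} m`. -/
def sign (δ : ℤ) : Module.End ℂ M := gradeOp R.isInternal fun k => sgn (δ * k)

lemma sign_sign (δ : ℤ) (m : M) : R.sign δ (R.sign δ m) = m := by
  have : R.sign δ * R.sign δ = 1 := by
    rw [sign, gradeOp_mul, ← gradeOp_one R.isInternal]
    congr 1
    ext k
    simp [sgn_mul_self]
  exact LinearMap.congr_fun this m

lemma sign_comm (δ δ' : ℤ) (m : M) : R.sign δ (R.sign δ' m) = R.sign δ' (R.sign δ m) := by
  have : R.sign δ * R.sign δ' = R.sign δ' * R.sign δ := by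
    rw [sign, sign, gradeOp_mul, gradeOp_mul, mul_comm]
  exact LinearMap.congr_fun this m

lemma sign_of_mem (δ : ℤ) {k : ℤ} {m : M} (hm : m ∈ R.gr k) : R.sign δ m = sgn (δ * k) • m :=
  gradeOp_of_mem _ _ hm

lemma sign_map {f : Module.End ℂ M} {α : ℤ} (hf : ∀ k, ∀ m ∈ R.gr k, f m ∈ R.gr (α + k))
    (δ : ℤ) (m : M) : R.sign δ (f m) = sgn (δ * α) • f (R.sign δ m) := by
  refine LinearMap.congr_fun (f := R.sign δ ∘ₗ f) (g := sgn (δ * α) • (f ∘ₗ R.sign δ))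
    (grade_hom_ext R.isInternal fun k m hm => ?_) m
  simp [R.sign_of_mem _ hm, R.sign_of_mem _ (hf k m hm), mul_add, sgn_add, smul_smul]

lemma sign_op (δ : ℤ) (g : Coord ι) (n : ℤ) (m : M) :
    R.sign δ (R.op g n m) = sgn (δ * Coord.degree deg g) • R.op g n (R.sign δ m) :=
  R.sign_map (R.op_mem g n) δ m

lemma sign_mem (δ : ℤ) {k : ℤ} {m : M} (hm : m ∈ R.gr k) : R.sign δ m ∈ R.gr k := by
  rw [R.sign_of_mem δ hm]
  exact Submodule.smul_mem _ _ hm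

/-- The field `g(z)`. -/
def field (g : Coord ι) : VertexOperator ℂ M := ofModes (R.op g) (R.trunc g)

@[simp] lemma mode_field (g : Coord ι) (n : ℤ) : mode (R.field g) n = R.op g n := by simp [field]

lemma comm_of_ne {g h : Coord ι} {p q : ℤ} (hpq : p + q ≠ -1) (m : M) : R.op g p (R.op h q m) =
    sgn (Coord.degree deg g * Coord.degree deg h) • R.op h q (R.op g p m) := by
  rw [R.comm]
  simp [Coord.contr, hpq]

/-- Assigns to the jet `g^{(n)}` the operator `φ(z) ↦ :(1/n!) ∂_z^n g(z) φ(z):`. -/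
def orderHom : Jet deg →ₐ[ℂ] Module.End ℂ (VertexOperator ℂ M) :=
  SuperPoly.lift (fun v => normalOrder v.2 (R.field v.1) (R.sign (jetDeg deg v))) (fun v w => by
    apply normalOrder_comm
    · exact sgn_mul_self _
    · intro i j hi hj p
      simpa [jetDeg] using R.comm_of_ne (g := v.1) (h := w.1) (by omega) p
    · intro i j hi hj p
      simpa [jetDeg] using R.comm_of_ne (g := v.1) (h := w.1) (by omega) p
    · intro k p
      simpa [jetDeg] using R.sign_op (jetDeg deg v) w.1 k p
    · intro k p
      simpa [jetDeg, mul_comm] using R.sign_op (jetDeg deg w) v.1 k p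
    · intro p
      exact R.sign_comm _ _ p)

/-- The fields attached to the elements of `𝒟^{ch}_P`. -/
def act : Jet deg →ₗ[ℂ] VertexOperator ℂ M where
  toFun v := R.orderHom v idField
  map_add' := by simp
  map_smul' := by simp

lemma act_one : R.act 1 = idField := by simp [act]

lemma act_gen_mul (g : Coord ι) (n : ℕ) (a : Jet deg) :
    R.act (jet deg g n * a) =
      normalOrder n (R.field g) (R.sign (Coord.degree deg g)) (R.act a) := by
  simp [act, orderHom, jetDeg]

lemma mode_idField (n : ℤ) (m : M) :
    mode (idField : VertexOperator ℂ M) n m = if n = -1 then m else 0 := by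
  simp only [idField, mode_ofModes]
  split_ifs <;> rfl

lemma mode_act_one (n : ℤ) (m : M) : mode (R.act 1) n m = if n = -1 then m else 0 := by
  rw [R.act_one, mode_idField]

lemma mode_zero (n : ℤ) (m : M) : mode (0 : VertexOperator ℂ M) n m = 0 := by simp [mode]

lemma mode_normalOrder (g : Coord ι) (n : ℕ) (φ : VertexOperator ℂ M) (k : ℤ) (m : M) (N N' : ℕ)
    (hN : ∀ j : ℕ, N ≤ j → mode φ (k + j) m = 0) (hN' : ∀ j : ℕ, N' ≤ j → R.op g j m = 0) :
    mode (normalOrder n (R.field g) (R.sign (Coord.degree deg g)) φ) k m =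
      ∑ j ∈ Finset.range N, ((n + j).choose n : ℂ) • R.op g (-n - 1 - j) (mode φ (k + j) m) +
      ∑ j ∈ Finset.range N', ((-1) ^ n * ((n + j).choose n : ℂ)) •
        R.sign (Coord.degree deg g) (mode φ (k - n - 1 - j)
          (R.sign (Coord.degree deg g) (R.op g j m))) := by
  rw [normalOrder, LinearMap.add_apply, mode_add, LinearMap.add_apply,
    creation_apply _ _ _ _ _ N hN, annihilation_apply _ _ _ _ _ _ N' (by simpa using hN')]
  simp

/-- The modes of `φ` have degree `α`. -/
def HasDegree (φ : VertexOperator ℂ M) (α : ℤ) : Prop :=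
  ∀ n k, ∀ m ∈ R.gr k, mode φ n m ∈ R.gr (α + k)

lemma HasDegree.normalOrder {R : HeisRep deg M} {φ : VertexOperator ℂ M} {α : ℤ}
    (h : R.HasDegree φ α) (g : Coord ι) (n : ℕ) :
    R.HasDegree (normalOrder n (R.field g) (R.sign (Coord.degree deg g)) φ)
      (Coord.degree deg g + α) := by
  intro k l m hm
  obtain ⟨N, hN⟩ := exists_trunc φ m
  obtain ⟨N', hN'⟩ := exists_trunc (R.field g) m
  rw [R.mode_normalOrder g n φ k m (N - k).toNat N' (fun j hj => hN _ (by omega))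
    (fun j hj => by simpa using hN' _ (Int.ofNat_le.2 hj))]
  refine add_mem (Submodule.sum_mem _ fun j _ => Submodule.smul_mem _ _ ?_)
    (Submodule.sum_mem _ fun j _ => Submodule.smul_mem _ _ ?_)
  · rw [add_assoc]
    exact R.op_mem _ _ _ _ (h _ _ _ hm)
  · refine R.sign_mem _ ?_
    rw [add_comm (Coord.degree deg g), add_assoc]
    exact h _ _ _ (R.sign_mem _ (R.op_mem _ _ _ _ hm))

/-- On a homogeneous field, conjugation by the involution is the scalar (-1)^{|γ||φ|}. This gives
the scalar form of normal ordering on which the recursions rest. -/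
lemma HasDegree.isNormalOrder {R : HeisRep deg M} {φ : VertexOperator ℂ M} {α : ℤ}
    (h : R.HasDegree φ α) (g : Coord ι) (n : ℕ) :
    IsNormalOrder (R.field g) φ n (sgn (Coord.degree deg g * α))
      (ChiralField.normalOrder n (R.field g) (R.sign (Coord.degree deg g)) φ) := by
  intro k m N N' hN hN'
  rw [R.mode_normalOrder g n φ k m N N' hN (by simpa using hN')]
  simp only [mode_field]
  congr 1
  refine Finset.sum_congr rfl fun j _ => ?_
  rw [R.sign_map (h _), R.sign_sign, smul_smul]
  congr 1
  ring

lemma hasDegree_idField : R.HasDegree idField 0 := by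
  intro n k m hm
  rw [mode_idField, zero_add]
  split_ifs
  · exact hm
  · exact Submodule.zero_mem _

lemma hasDegree_act {α : ℤ} {a : Jet deg} (ha : a ∈ homog (jetDeg deg) α) :
    R.HasDegree (R.act a) α := by
  induction ha using word_induction with
  | word l h =>
    subst h
    induction l with
    | nil => simpa [R.act_one] using R.hasDegree_idField
    | cons x l ih =>
      simp only [List.map_cons, List.prod_cons, List.sum_cons]
      rw [R.act_gen_mul x.1 x.2]
      exact ih.normalOrder x.1 x.2
  | zero =>
    intro n k m _
    rw [map_zero, mode_zero]
    exact Submodule.zero_mem _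
  | add p q _ _ hp hq =>
    intro n k m hm
    rw [map_add, mode_add]
    exact add_mem (hp n k m hm) (hq n k m hm)
  | smul c p _ hp =>
    intro n k m hm
    rw [map_smul, mode_smul]
    exact Submodule.smul_mem _ _ (hp n k m hm)

lemma isNormalOrder_act {α : ℤ} {a : Jet deg} (ha : a ∈ homog (jetDeg deg) α) (g : Coord ι)
    (n : ℕ) : IsNormalOrder (R.field g) (R.act a) n (sgn (Coord.degree deg g * α))
      (R.act (jet deg g n * a)) := by
  rw [R.act_gen_mul]
  exact (R.hasDegree_act ha).isNormalOrder g n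

/-- The identity field has a single nonzero mode, so at most one term of the creation part (for n <
0) or of the annihilation part (for n ≥ 0) survives in :g(z) Id:. -/
lemma mode_act_jet (g : Coord ι) (n : ℤ) : mode (R.act (jet deg g 0)) n = R.op g n := by
  ext m
  obtain ⟨N', hN'⟩ := exists_trunc (R.field g) m
  have h := R.isNormalOrder_act (one_mem_weightGr (jetDeg deg) (jetDeg deg)) g 0 n m (-n).toNat N'
    (fun j hj => by rw [mode_act_one, if_neg (by omega)]) (fun j hj => hN' _ (by omega))
  rw [mul_one] at h
  rw [h]
  simp only [mode_act_one, mode_field, Nat.zero_add, Nat.choose_zero_right]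
  rcases lt_or_ge n 0 with hn | hn
  · rw [Finset.sum_eq_single (-1 - n).toNat, Finset.sum_eq_zero, add_zero]
    · rw [if_pos (by omega)]
      simp only [Nat.cast_one, one_smul, Nat.cast_zero]
      congr 2
      omega
    · intro j _
      rw [if_neg (by push_cast; omega), smul_zero]
    · intro j _ hj
      rw [if_neg (by omega), map_zero, smul_zero]
    · intro h
      exact absurd (Finset.mem_range.2 (by omega)) h
  · rw [Finset.sum_eq_zero, zero_add]
    · by_cases hnN : n.toNat < N'
      · rw [Finset.sum_eq_single n.toNat]
        · rw [if_pos (by push_cast; omega)]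
          simp [sgn, Int.toNat_of_nonneg hn]
        · intro j _ hj
          rw [if_neg (by push_cast; omega), smul_zero]
        · intro h
          exact absurd (Finset.mem_range.2 (by omega)) h
      · rw [Finset.sum_eq_zero]
        · have := hN' n (by omega)
          rw [mode_field] at this
          exact this.symm
        · intro j hj
          have := Finset.mem_range.1 hj
          rw [if_neg (by push_cast; omega), smul_zero]
    · intro j hj
      have := Finset.mem_range.1 hj
      rw [if_neg (by omega), map_zero, smul_zero]

/-! ### The vacuum module -/

lemma genMode_mem (g : Coord ι) (n k : ℤ) (p : Jet deg) (hp : p ∈ homog (jetDeg deg) k) :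
    genMode deg g n p ∈ homog (jetDeg deg) (Coord.degree deg g + k) := by
  rcases lt_or_ge n 0 with hn | hn
  · rw [genMode_of_neg _ _ _ hn]
    exact gen_mul_mem (jetDeg deg) (g, (-n - 1).toNat) k p hp
  · rw [genMode_of_nonneg _ _ _ hn]
    refine Submodule.smul_mem _ _ ?_
    have := (isSuperDerivation_pderiv (jetDeg deg) (Coord.dual g, n.toNat)).map_homog k p hp
    rwa [jetDeg, Coord.degree_dual, neg_neg, add_comm] at this

variable (deg) in
/-- The action of the coordinates on `𝒟^{ch}_P`. -/
def vacuumRep : HeisRep deg (Jet deg) where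
  gr := homog (jetDeg deg)
  isInternal := homog_isInternal _
  op := genMode deg
  op_mem := genMode_mem
  trunc g m := by
    obtain ⟨N, hN⟩ := exists_pderiv_eq_zero deg (Coord.dual g) m
    refine ⟨N, fun n hn => ?_⟩
    rw [genMode_of_nonneg deg g n (by omega), hN _ (by omega), smul_zero]
  comm g h p q m := by
    classical
    rcases lt_or_ge p 0 with hp | hp <;> rcases lt_or_ge q 0 with hq | hq
    · rw [genMode_comm_of_neg deg g h p q hp hq, Coord.contr, if_neg (by omega), zero_smul,
        add_zero]
    · rw [genMode_of_neg _ _ _ hp, genMode_of_nonneg _ _ _ hq, genMode_of_neg _ _ _ hp,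
        genMode_of_nonneg _ _ _ hq, pderiv_mul, pderiv_gen, twist_gen]
      simp only [jetDeg, Coord.degree_dual, smul_add, smul_mul_assoc, smul_smul, neg_mul, sgn_neg,
        mul_smul_comm]
      have hs : sgn (Coord.degree deg g * Coord.degree deg h) * (Coord.pairing deg h *
          sgn (Coord.degree deg h * Coord.degree deg g)) = Coord.pairing deg h := by
        rw [mul_comm (Coord.degree deg h)]
        linear_combination Coord.pairing deg h *
          sgn_mul_self (Coord.degree deg g * Coord.degree deg h)
      rw [add_right_comm, hs, right_eq_add, Coord.contr]
      by_cases hh : h = Coord.dual g ∧ p + q = -1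
      · obtain ⟨rfl, hpq⟩ := hh
        rw [if_pos (⟨rfl, hpq⟩ : Coord.dual g = Coord.dual g ∧ p + q = -1), if_pos (by rw [Coord.dual_dual]; congr 1; omega), one_mul,
          Coord.degree_dual, ← add_smul]
        -- The pairing of dual coordinates is super-antisymmetric.
        have : sgn (Coord.degree deg g * -Coord.degree deg g) * Coord.pairing deg (Coord.dual g) +
            Coord.pairing deg g = 0 := by
          rw [mul_neg, sgn_neg]
          cases g with
          | fn i =>
            simp only [Coord.degree, Coord.pairing, Coord.dual, mul_one]
            rcases Int.even_or_odd (deg i) with h | h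
            · rw [sgn, sgn, h.neg_one_zpow, (h.mul_left _).neg_one_zpow]; ring
            · rw [sgn, sgn, h.neg_one_zpow, (h.mul h).neg_one_zpow]; ring
          | vf i =>
            simp only [Coord.degree, Coord.pairing, Coord.dual, neg_mul_neg]
            rcases Int.even_or_odd (deg i) with h | h
            · rw [sgn, sgn, h.neg_one_zpow, (h.mul_left _).neg_one_zpow]; ring
            · rw [sgn, sgn, h.neg_one_zpow, (h.mul h).neg_one_zpow]; ring
        rw [this, zero_smul]
      · rw [if_neg hh, if_neg, zero_mul, smul_zero, zero_smul, add_zero]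
        rintro e
        rw [Prod.mk.injEq] at e
        exact hh ⟨by rw [e.1, Coord.dual_dual], by omega⟩
    · rw [genMode_of_neg _ _ _ hq, genMode_of_nonneg _ _ _ hp, genMode_of_neg _ _ _ hq,
        genMode_of_nonneg _ _ _ hp, pderiv_mul, pderiv_gen, twist_gen]
      simp only [jetDeg, Coord.degree_dual, smul_add, smul_mul_assoc, smul_smul, neg_mul, sgn_neg,
        mul_smul_comm]
      rw [add_comm, mul_comm (Coord.pairing deg g), Coord.contr]
      congr 1
      by_cases hh : h = Coord.dual g ∧ p + q = -1
      · obtain ⟨rfl, hpq⟩ := hh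
        rw [if_pos (⟨rfl, hpq⟩ : Coord.dual g = Coord.dual g ∧ p + q = -1), if_pos (by congr 1; omega), one_mul]
      · rw [if_neg hh, if_neg, zero_mul, smul_zero, zero_smul]
        rintro e
        rw [Prod.mk.injEq] at e
        exact hh ⟨e.1, by omega⟩
    · rw [genMode_comm_of_nonneg deg g h p q hp hq, Coord.contr, if_neg (by omega), zero_smul,
        add_zero]

lemma vacuumRep_sign (δ : ℤ) : (vacuumRep deg).sign δ = (twist (jetDeg deg) δ).toLinearMap :=
  grade_hom_ext (homog_isInternal _) fun k m hm => by
    rw [(vacuumRep deg).sign_of_mem δ hm, AlgHom.toLinearMap_apply, twist_of_mem _ _ _ _ hm]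

/-- The vertex algebra is its own vacuum representation, so every statement about the fields of a
general representation applies to the n-th products. -/
lemma vacuumRep_act : (vacuumRep deg).act = Y deg := by
  ext1 v
  change (vacuumRep deg).orderHom v idField = normalOrderHom deg v idField
  congr 1
  induction v using gen_induction with
  | one => rw [map_one, map_one]
  | add p q hp hq => rw [map_add, map_add, hp, hq]
  | smul c p hp => rw [map_smul, map_smul, hp]
  | gen_mul x p hp =>
    rw [map_mul, map_mul, hp]
    congr 1
    rw [orderHom, normalOrderHom, lift_gen, lift_gen, vacuumRep_sign]
    rfl

lemma nprod_jet (g : Coord ι) (n : ℤ) (b : Jet deg) :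
    nprod deg (jet deg g 0) n b = genMode deg g n b := by
  rw [nprod, ← vacuumRep_act, mode_act_jet]
  rfl

lemma nprod_mem {k l : ℤ} {a b : Jet deg} (ha : a ∈ homog (jetDeg deg) k)
    (hb : b ∈ homog (jetDeg deg) l) (n : ℤ) : nprod deg a n b ∈ homog (jetDeg deg) (k + l) := by
  rw [nprod, ← vacuumRep_act]
  exact (vacuumRep deg).hasDegree_act ha n l b hb

/-- The commutator formula for a coordinate and an arbitrary field. -/
lemma op_act (g : Coord ι) {β : ℤ} {b : Jet deg} (hb : b ∈ homog (jetDeg deg) β) :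
    ∃ N₀ : ℕ, ∀ N, N₀ ≤ N → ∀ (p q : ℤ) (m : M), R.op g p (mode (R.act b) q m) =
      sgn (Coord.degree deg g * β) • mode (R.act b) q (R.op g p m) +
        ∑ i ∈ Finset.range N, binom p i • mode (R.act (genMode deg g i b)) (p + q - i) m := by
  classical
  induction hb using word_induction with
  | word l h =>
    subst h
    induction l with
    | nil =>
      refine ⟨0, fun N _ p q m => ?_⟩
      rw [Finset.sum_eq_zero]
      · simp only [List.map_nil, List.prod_nil, List.sum_nil, mode_act_one]
        split_ifs <;> simp [sgn]
      · intro i _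
        rw [genMode_of_nonneg _ _ _ (by omega)]
        simp [mode_zero]
    | cons x l ih =>
      obtain ⟨h, n⟩ := x
      obtain ⟨N₀, hN₀⟩ := ih
      have hb : (l.map (gen (jetDeg deg))).prod ∈ homog (jetDeg deg) (l.map (jetDeg deg)).sum :=
        Submodule.subset_span ⟨l, rfl, rfl⟩
      simp only [List.map_cons, List.prod_cons, List.sum_cons]
      set b := (l.map (gen (jetDeg deg))).prod with hb_def
      set β := (l.map (jetDeg deg)).sum with hβ
      -- With n + 1 the range contains i = n, the only index at which g_(i) contracts with h^{(n)}.
      refine ⟨max N₀ (n + 1), fun N hN p q m => ?_⟩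
      have ih := hN₀ N ((le_max_left _ _).trans hN)
      have hnN : n < N := lt_of_lt_of_le (Nat.lt_succ_self n) ((le_max_right _ _).trans hN)
      clear hN₀ hN
      have hgen : ∀ i : ℕ, genMode deg g i (jet deg h n * b) =
          (if h = Coord.dual g ∧ i = n then Coord.pairing deg g else 0) • b +
          sgn (Coord.degree deg g * Coord.degree deg h) • (jet deg h n * genMode deg g i b) := by
        intro i
        have := (vacuumRep deg).comm g h i (-n - 1) b
        change genMode deg g i (genMode deg h _ b) = _ • genMode deg h _ (genMode deg g i b) + _
          at this
        simp only [genMode_of_neg deg h (-n - 1) (by omega),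
          show (-(-(n : ℤ) - 1) - 1).toNat = n by omega] at this
        rw [this, add_comm, Coord.contr]
        congr 2
        refine if_congr (and_congr_right fun _ => ?_) rfl rfl
        omega
      have hφ := R.isNormalOrder_act hb h n
      have hgb : ∀ i : ℕ, genMode deg g i b ∈ homog (jetDeg deg) (Coord.degree deg g + β) :=
        fun i => (vacuumRep deg).op_mem g i β b hb
      have hφ' := fun i : ℕ => R.isNormalOrder_act (hgb i) h n
      obtain ⟨K₁, hK₁⟩ := exists_trunc (R.act b) m
      obtain ⟨K₂, hK₂⟩ := exists_trunc (R.act b) (R.op g p m)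
      obtain ⟨K₃, hK₃⟩ := exists_trunc_family (fun i : ℕ => R.act (genMode deg g i b))
        (fun _ => m) N
      obtain ⟨L₁, hL₁⟩ := exists_trunc (R.field h) m
      obtain ⟨L₂, hL₂⟩ := exists_trunc (R.field h) (R.op g p m)
      set K := (K₁ - q).toNat + (K₂ - q).toNat + (K₃ - p - q + N).toNat + (p - n).toNat + 1
      set L := L₁ + L₂ + (-p).toNat
      set γ := Coord.degree deg g
      set χ := Coord.degree deg h
      rw [hφ q m K L (fun j hj => hK₁ _ (by omega)) (fun j hj => hL₁ _ (by omega)),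
        hφ q (R.op g p m) K L (fun j hj => hK₂ _ (by omega)) (fun j hj => hL₂ _ (by omega))]
      have e3 : ∀ i ∈ Finset.range N,
          binom p i • mode (R.act (genMode deg g i (jet deg h n * b))) (p + q - i) m =
          (binom p i * if h = Coord.dual g ∧ i = n then Coord.pairing deg g else 0) •
              mode (R.act b) (p + q - i) m +
          (∑ j ∈ Finset.range K, (sgn (γ * χ) * ((n + j).choose n : ℂ)) • R.op h (-n - 1 - j)
            (binom p i • mode (R.act (genMode deg g i b)) (p + (q + j) - i) m) +
          ∑ j ∈ Finset.range L, ((-1) ^ n * sgn (χ * β) * ((n + j).choose n : ℂ)) •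
            binom p i • mode (R.act (genMode deg g i b)) (p + (q - n - 1 - j) - i)
              (R.op h j m)) := by
        intro i hi
        have hi' := Finset.mem_range.1 hi
        rw [hgen, map_add, map_smul, map_smul, mode_add, mode_smul, mode_smul, LinearMap.add_apply,
          LinearMap.smul_apply, LinearMap.smul_apply, hφ' i (p + q - i) m K L
          (fun j hj => hK₃ i hi' _ (by omega)) (fun j hj => hL₁ _ (by omega)), smul_add, smul_smul]
        congr 1
        simp only [mode_field, smul_add, Finset.smul_sum, map_smul]
        congr 1
        · refine Finset.sum_congr rfl fun j _ => ?_
          simp only [smul_smul]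
          rw [show p + (q + j) - i = p + q - i + j by ring]
          congr 1
          ring
        · refine Finset.sum_congr rfl fun j _ => ?_
          simp only [smul_smul]
          rw [show p + (q - n - 1 - j) - i = p + q - i - n - 1 - j by ring]
          congr 1
          have hs : sgn (χ * (γ + β)) = sgn (γ * χ) * sgn (χ * β) := by
            rw [mul_add, sgn_add, mul_comm χ γ]
          rw [hs]
          linear_combination (binom p i * (-1) ^ n * ((n + j).choose n : ℂ) * sgn (χ * β)) *
            sgn_mul_self (γ * χ)
      rw [Finset.sum_congr rfl e3]
      simp only [mode_field, map_add, map_sum, map_smul, Finset.sum_add_distrib, R.comm g h, ih,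
        smul_add, Finset.smul_sum]
      -- the three kinds of terms: `g` passes to the right, `g` contracts with `h`, `g` acts on `b`
      have e4 : ∑ i ∈ Finset.range N, (binom p i *
          if h = Coord.dual g ∧ i = n then Coord.pairing deg g else 0) •
          mode (R.act b) (p + q - i) m =
          (if h = Coord.dual g then binom p n * Coord.pairing deg g else 0) •
            mode (R.act b) (p + q - n) m := by
        rw [Finset.sum_eq_single n]
        · by_cases hh : h = Coord.dual g <;> simp [hh]
        · intro i _ hi
          simp [hi]
        · intro h
          exact absurd (Finset.mem_range.2 hnN) h
      -- At most one contraction survives: for p ≥ n the creation term with j = p - n, for p < 0 the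
      -- annihilation term with j = -1 - p. For 0 ≤ p < n there is none, and `binom p n` is zero.
      have e5 : ∑ j ∈ Finset.range K, ((n + j).choose n : ℂ) •
            Coord.contr deg g h p (-n - 1 - j) • mode (R.act b) (q + j) m +
          ∑ j ∈ Finset.range L, ((-1) ^ n * sgn (χ * β) * ((n + j).choose n : ℂ)) •
            sgn (γ * β) • Coord.contr deg g h p j • mode (R.act b) (q - n - 1 - j) m =
          (if h = Coord.dual g then binom p n * Coord.pairing deg g else 0) •
            mode (R.act b) (p + q - n) m := by
        by_cases hh : h = Coord.dual g
        · have hs : sgn (χ * β) * sgn (γ * β) = 1 := by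
            have : χ = -γ := by rw [← Coord.degree_dual, ← hh]
            rw [this, neg_mul, sgn_neg, sgn_mul_self]
          simp only [Coord.contr, hh, true_and, if_true]
          rcases lt_or_ge p 0 with hp | hp
          · rw [Finset.sum_eq_zero, zero_add, Finset.sum_eq_single (-1 - p).toNat]
            · have hb := binom_neg (-1 - p).toNat n
              rw [show -((-1 - p).toNat : ℤ) - 1 = p by omega] at hb
              have hc : ((-1 - p).toNat + n).choose (-1 - p).toNat = (n + (-1 - p).toNat).choose n :=
                Nat.choose_symm_add.trans (by rw [Nat.add_comm])
              rw [if_pos (by omega), hb, show q - n - 1 - ((-1 - p).toNat : ℤ) = p + q - n by omega,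
                hc]
              simp only [smul_smul]
              congr 1
              linear_combination ((-1) ^ n * ((n + (-1 - p).toNat).choose n : ℂ) *
                Coord.pairing deg g) * hs
            · intro j _ hj
              rw [if_neg (by omega), zero_smul, smul_zero, smul_zero]
            · intro hj
              exact absurd (Finset.mem_range.2 (by omega)) hj
            · intro j _
              rw [if_neg (by omega), zero_smul, smul_zero]
          · rw [add_comm, Finset.sum_eq_zero, zero_add]
            · have hb := binom_natCast p.toNat n
              rw [Int.toNat_of_nonneg hp] at hb
              rw [hb]
              by_cases hpn : p < n
              · rw [Nat.choose_eq_zero_of_lt (by omega), Finset.sum_eq_zero]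
                · simp
                · intro j _
                  rw [if_neg (by omega), zero_smul, smul_zero]
              · rw [Finset.sum_eq_single (p - n).toNat]
                · rw [if_pos (by omega), show n + (p - n).toNat = p.toNat by omega,
                    show q + ((p - n).toNat : ℤ) = p + q - n by omega, smul_smul]
                · intro j _ hj
                  rw [if_neg (by omega), zero_smul, smul_zero]
                · intro hj
                  exact absurd (Finset.mem_range.2 (by omega)) hj
            · intro j _
              rw [if_neg (by omega), zero_smul, smul_zero, smul_zero]
        · simp [Coord.contr, hh]
      rw [e4, ← e5, Finset.sum_comm (s := Finset.range N), Finset.sum_comm (s := Finset.range N)]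
      have hs : sgn (γ * (jetDeg deg (h, n) + β)) = sgn (γ * χ) * sgn (γ * β) := by
        rw [mul_add, sgn_add]
        rfl
      simp only [hs, smul_smul, mul_comm, mul_left_comm, mul_assoc]
      abel
  | zero => exact ⟨0, fun N _ p q m => by simp [mode_zero]⟩
  | add b b' _ _ hb hb' =>
    obtain ⟨N, hN⟩ := hb
    obtain ⟨N', hN'⟩ := hb'
    refine ⟨max N N', fun K hK p q m => ?_⟩
    simp only [map_add, mode_add, LinearMap.add_apply, hN K ((le_max_left _ _).trans hK),
      hN' K ((le_max_right _ _).trans hK), smul_add, Finset.sum_add_distrib]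
    abel
  | smul c b _ hb =>
    obtain ⟨N, hN⟩ := hb
    refine ⟨N, fun K hK p q m => ?_⟩
    simp only [map_smul, mode_smul, LinearMap.smul_apply, hN K hK, smul_add, Finset.smul_sum]
    simp only [smul_comm c]

/-! ### The Borcherds identity -/

lemma sgn_toNat {k : ℤ} (hk : 0 ≤ k) : ((-1) ^ k.toNat : ℂ) = sgn k := by
  rw [sgn, ← zpow_natCast, Int.toNat_of_nonneg hk]

/-- In terms of residues in z of z^p (z-w)^r: the expansions for |z| > |w| and |w| > |z| agree when
r ≥ 0, and for r < 0 they differ by the residue at z = w, the binomial coefficient of p and -1-r. -/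
lemma binom_unit (p r : ℤ) : (if r < 0 then binom p (-1 - r).toNat else 0) =
    (if 0 ≤ p + r + 1 then (-1) ^ (p + r + 1).toNat * binom r (p + r + 1).toNat else 0) -
      sgn r * (if p < 0 then (-1) ^ (-1 - p).toNat * binom r (-1 - p).toNat else 0) := by
  have hs1 : sgn 1 = -1 := by simp [sgn]
  rcases lt_or_ge r 0 with hr | hr <;> rcases lt_or_ge p 0 with hp | hp
  · rw [if_pos hr, if_neg (by omega), if_pos hp]
    have h1 := binom_neg (-1 - p).toNat (-1 - r).toNat
    have h2 := binom_neg (-1 - r).toNat (-1 - p).toNat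
    rw [show -((-1 - p).toNat : ℤ) - 1 = p by omega] at h1
    rw [show -((-1 - r).toNat : ℤ) - 1 = r by omega] at h2
    rw [h1, h2, Nat.choose_symm_add, Nat.add_comm (-1 - p).toNat, sgn_toNat (by omega),
      sgn_toNat (by omega), show -1 - r = -(1 + r) by ring, sgn_neg, sgn_add, hs1]
    linear_combination (sgn r * (((-(1 + r)).toNat + (-1 - p).toNat).choose
      (-(1 + r)).toNat : ℂ)) * sgn_mul_self (-1 - p)
  · rw [if_pos hr, if_neg (not_lt.2 hp)]
    have h1 := binom_natCast p.toNat (-1 - r).toNat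
    rw [Int.toNat_of_nonneg hp] at h1
    rw [h1]
    split_ifs with h
    · have h2 := binom_neg (-1 - r).toNat (p + r + 1).toNat
      rw [show -((-1 - r).toNat : ℤ) - 1 = r by omega] at h2
      rw [h2, show (-1 - r).toNat + (p + r + 1).toNat = p.toNat by omega, sgn_toNat h, ← mul_assoc,
        sgn_mul_self]
      ring
    · rw [Nat.choose_eq_zero_of_lt (by omega)]
      simp
  · rw [if_neg (not_lt.2 hr), if_pos hp]
    have h1 := fun k => binom_natCast r.toNat k
    rw [Int.toNat_of_nonneg hr] at h1
    rw [h1, h1]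
    split_ifs with h
    · have e : sgn (r + (-1 - p)) = sgn (p + r + 1) := by
        rw [show r + (-1 - p) = (p + r + 1) + (-((p + 1) + (p + 1))) by ring, sgn_add (p + r + 1),
          sgn_neg, sgn_add (p + 1), sgn_mul_self, mul_one]
      rw [sgn_toNat h, sgn_toNat (by omega), ← Nat.choose_symm (show (-1 - p).toNat ≤ r.toNat by
        omega), show r.toNat - (-1 - p).toNat = (p + r + 1).toNat by omega, ← e, sgn_add]
      ring
    · rw [Nat.choose_eq_zero_of_lt (show r.toNat < (-1 - p).toNat by omega)]
      simp
  · rw [if_neg (not_lt.2 hr), if_neg (not_lt.2 hp), if_pos (by omega)]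
    have h1 := fun k => binom_natCast r.toNat k
    rw [Int.toNat_of_nonneg hr] at h1
    rw [h1, Nat.choose_eq_zero_of_lt (by omega)]
    simp

lemma finsum_ite_eq {N : Type*} [AddCommGroup N] (f : ℕ → N) (k : ℤ) :
    (∑ᶠ j : ℕ, if (j : ℤ) = k then f j else 0) = if 0 ≤ k then f k.toNat else 0 := by
  split_ifs with hk
  · rw [finsum_eq_single _ k.toNat, if_pos (Int.toNat_of_nonneg hk)]
    intro j hj
    rw [if_neg (by omega)]
  · exact (finsum_congr fun j => by rw [if_neg (by omega)]).trans finsum_zero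

lemma nprod_one (n : ℤ) (b : Jet deg) : nprod deg 1 n b = if n = -1 then b else 0 := by
  rw [nprod, ← vacuumRep_act, mode_act_one]

/-- The vacuum has a single nonzero product with b and a single nonzero mode on M, so each of the
three sums has at most one nonzero term. The comparison of their coefficients is `binom_unit`. -/
lemma resIter_one (b : Jet deg) (p q r : ℤ) (m : M) :
    resIter (fun t => R.act (nprod deg 1 t b)) p q r m =
      resLeft (R.act 1) (R.act b) p q r m - sgn r • resRight (R.act 1) (R.act b) p q r m := by
  have h1 : resIter (fun t => R.act (nprod deg 1 t b)) p q r m =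
      (if r < 0 then binom p (-1 - r).toNat else 0) • mode (R.act b) (p + q + r + 1) m := by
    have := finsum_ite_eq (fun j : ℕ => binom p j • mode (R.act b) (p + q - j) m) (-1 - r)
    rw [resIter]
    refine (finsum_congr fun j => ?_).trans (this.trans ?_)
    · rw [nprod_one]
      by_cases h : (j : ℤ) = -1 - r
      · rw [if_pos (by omega), if_pos h]
      · rw [if_neg (by omega), if_neg h, map_zero, mode_zero, smul_zero]
    · by_cases h : r < 0
      · rw [if_pos (by omega), if_pos h, show p + q - ((-1 - r).toNat : ℤ) = p + q + r + 1 by omega]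
      · rw [if_neg (by omega), if_neg h, zero_smul]
  have h2 : resLeft (R.act 1) (R.act b) p q r m =
      (if 0 ≤ p + r + 1 then (-1) ^ (p + r + 1).toNat * binom r (p + r + 1).toNat else 0) •
        mode (R.act b) (p + q + r + 1) m := by
    have := finsum_ite_eq (fun j : ℕ => ((-1) ^ j * binom r j) • mode (R.act b) (q + j) m)
      (p + r + 1)
    rw [resLeft]
    refine (finsum_congr fun j => ?_).trans (this.trans ?_)
    · rw [mode_act_one]
      by_cases h : (j : ℤ) = p + r + 1
      · rw [if_pos (by omega), if_pos h]
      · rw [if_neg (by omega), if_neg h, smul_zero]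
    · split_ifs with h
      · rw [show q + ((p + r + 1).toNat : ℤ) = p + q + r + 1 by omega]
      · rw [zero_smul]
  have h3 : resRight (R.act 1) (R.act b) p q r m =
      (if p < 0 then (-1) ^ (-1 - p).toNat * binom r (-1 - p).toNat else 0) •
        mode (R.act b) (p + q + r + 1) m := by
    have := finsum_ite_eq (fun j : ℕ => ((-1) ^ j * binom r j) • mode (R.act b) (q + r - j) m)
      (-1 - p)
    rw [resRight]
    refine (finsum_congr fun j => ?_).trans (this.trans ?_)
    · rw [mode_act_one]
      by_cases h : (j : ℤ) = -1 - p
      · rw [if_pos (by omega), if_pos h]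
      · rw [if_neg (by omega), if_neg h, map_zero, smul_zero]
    · by_cases h : p < 0
      · rw [if_pos (by omega), if_pos h, show q + r - ((-1 - p).toNat : ℤ) = p + q + r + 1 by omega]
      · rw [if_neg (by omega), if_neg h, zero_smul]
  rw [h1, h2, h3, binom_unit, sub_smul, smul_smul]

/-- The Borcherds identity. -/
lemma resIter_act {α β : ℤ} {a b : Jet deg} (ha : a ∈ homog (jetDeg deg) α)
    (hb : b ∈ homog (jetDeg deg) β) (p q r : ℤ) (m : M) :
    resIter (fun t => R.act (nprod deg a t b)) p q r m =
      resLeft (R.act a) (R.act b) p q r m -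
        (sgn r * sgn (α * β)) • resRight (R.act a) (R.act b) p q r m := by
  induction ha using word_induction generalizing b β p q r m with
  | word l h =>
    subst h
    -- The second argument and all exponents stay free, because the contraction terms replace b by
    -- g_(i) b and lower r.
    induction l generalizing b β p q r m with
    | nil => simpa [sgn] using R.resIter_one b p q r m
    | cons x l ih =>
      obtain ⟨g, n⟩ := x
      have ha : (l.map (gen (jetDeg deg))).prod ∈ homog (jetDeg deg) (l.map (jetDeg deg)).sum :=
        Submodule.subset_span ⟨l, rfl, rfl⟩
      simp only [List.map_cons, List.prod_cons, List.sum_cons]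
      set a := (l.map (gen (jetDeg deg))).prod
      set α := (l.map (jetDeg deg)).sum
      set γ := Coord.degree deg g
      obtain ⟨I₁, hI₁⟩ := R.op_act g hb
      obtain ⟨I₂, hI₂⟩ := exists_pderiv_eq_zero deg (Coord.dual g) b
      set I := max I₁ I₂
      have hgI : ∀ i : ℕ, I ≤ i → genMode deg g i b = 0 := fun i hi => by
        rw [genMode_of_nonneg _ _ _ (by omega), Int.toNat_natCast,
          hI₂ i ((le_max_right _ _).trans hi), smul_zero]
      have hgb : ∀ i : ℕ, genMode deg g i b ∈ homog (jetDeg deg) (γ + β) :=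
        fun i => genMode_mem g i β b hb
      obtain ⟨T₁, hT₁⟩ := exists_trunc (Y deg a) b
      obtain ⟨T₂, hT₂⟩ := exists_trunc_family (fun _ => Y deg a) (fun i => genMode deg g i b) I
      have hT₂' : ∀ (i : ℕ) (t : ℤ), (T₂ : ℤ) ≤ t → nprod deg a t (genMode deg g i b) = 0 := by
        intro i t ht
        by_cases hi : i < I
        · exact hT₂ i hi t ht
        · rw [hgI i (not_lt.1 hi), nprod, map_zero]
      have hψ := fun p q m => hI₁ I (le_max_left _ _) p q m
      have hψ' : ∀ p q m, mode (R.field g) p (mode (R.act b) q m) =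
          sgn (γ * β) • mode (R.act b) q (mode (R.field g) p m) + ∑ i ∈ Finset.range I,
            binom p i • mode (R.act (genMode deg g i b)) (p + q - i) m := by
        simpa using hψ
      obtain ⟨N₁, hN₁⟩ := resLeft_rec (R.isNormalOrder_act ha g n) hψ' p q r m
      obtain ⟨N₂, hN₂⟩ := resRight_rec (R.isNormalOrder_act ha g n) (sgn_mul_self _) hψ' p q r m
      obtain ⟨N₃, hN₃⟩ := resIter_rec (γ := R.field g) (n := n) (η := sgn (γ * α))
        (ε := sgn (γ * β)) (I := I) (T₀ := max T₁ T₂)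
        (Θ := fun t => R.act (nprod deg a t b))
        (Θ' := fun t => R.act (nprod deg (jet deg g n * a) t b))
        (ρ := fun N t => R.act (jet deg g N * nprod deg a t b))
        (Ψ := fun i t => R.act (nprod deg a t (genMode deg g i b)))
        (fun t ht => by
          have : nprod deg a t b = 0 := hT₁ t ((le_max_left _ _).trans ht)
          simp only [this, map_zero])
        (fun i t ht => by
          simp only [hT₂' i t ((le_max_right _ _).trans ht), map_zero])
        (fun N t => by
          have := R.isNormalOrder_act (nprod_mem ha hb t) g N
          rwa [mul_add, sgn_add] at this)
        -- The recursion for the products (g^{(n)} a)_(t) b is normal ordering in the vacuum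
        -- representation, where the creation mode of index -n-1-k multiplies by g^{(n+k)}.
        (fun t N hN => by
          have := (vacuumRep deg).isNormalOrder_act ha g n t b N I
            (fun j hj => by
              rw [vacuumRep_act]
              exact hT₁ _ (by omega))
            (fun j hj => by
              rw [mode_field]
              exact hgI j hj)
          rw [vacuumRep_act] at this
          change nprod deg (jet deg g n * a) t b = _ at this
          simp only [this, map_add, map_sum, map_smul, mode_field]
          congr 1
          refine Finset.sum_congr rfl fun k _ => ?_
          have : (vacuumRep deg).op g (-n - 1 - k) = genMode deg g (-n - 1 - k) := rfl
          rw [this, genMode_of_neg _ _ _ (by omega),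
            show (-(-(n : ℤ) - 1 - k) - 1).toNat = n + k by omega]
          rfl) p q r m
      set N := max N₁ (max N₂ N₃)
      rw [hN₁ N (le_max_left _ _), hN₂ N ((le_max_left _ _).trans (le_max_right _ _)),
        hN₃ N ((le_max_right _ _).trans (le_max_right _ _))]
      simp only [ih hb, ih (hgb _), map_sub, map_smul, smul_sub, smul_add, Finset.sum_sub_distrib,
        Finset.smul_sum, smul_smul]
      have hs1 : sgn ((γ + α) * β) = sgn (γ * β) * sgn (α * β) := by rw [add_mul, sgn_add]
      have e1 : ∑ k ∈ Finset.range N, (((n + k).choose n : ℂ) * (sgn r * sgn (α * β))) •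
            mode (R.field g) (-n - 1 - k) (resRight (R.act a) (R.act b) (p + k) q r m) =
          ∑ k ∈ Finset.range N, (sgn r * sgn ((γ + α) * β) * (sgn (γ * β) *
            ((n + k).choose n : ℂ))) •
            mode (R.field g) (-n - 1 - k) (resRight (R.act a) (R.act b) (p + k) q r m) := by
        refine Finset.sum_congr rfl fun k _ => ?_
        congr 1
        rw [hs1]
        linear_combination (-(sgn r * sgn (α * β) * ((n + k).choose n : ℂ))) * sgn_mul_self (γ * β)
      have e2 : ∑ k ∈ Finset.range N, ((-1) ^ n * sgn (γ * α) * sgn (γ * β) *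
            ((n + k).choose n : ℂ) * (sgn r * sgn (α * β))) •
            resRight (R.act a) (R.act b) (p - n - 1 - k) q r (mode (R.field g) k m) =
          ∑ k ∈ Finset.range N, (sgn r * sgn ((γ + α) * β) * ((-1) ^ n * sgn (γ * α) *
            ((n + k).choose n : ℂ))) •
            resRight (R.act a) (R.act b) (p - n - 1 - k) q r (mode (R.field g) k m) := by
        refine Finset.sum_congr rfl fun k _ => ?_
        congr 1
        rw [hs1]
        ring
      -- The minus sign of the contractions in the right residue is matched by lowering r by n + 1 +
      -- i, which changes `sgn r` by -(-1)^n (-1)^i.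
      have e3 : ∑ i ∈ Finset.range I, ((-1) ^ n * sgn (γ * α) * ((n + i).choose n : ℂ) *
            (sgn (r - n - 1 - i) * sgn (α * (γ + β)))) •
            resRight (R.act a) (R.act (genMode deg g i b)) p q (r - n - 1 - i) m =
          -∑ i ∈ Finset.range I, (sgn r * sgn ((γ + α) * β) * (sgn (γ * β) * (-1) ^ i *
            ((n + i).choose n : ℂ))) •
            resRight (R.act a) (R.act (genMode deg g i b)) p q (r - n - 1 - i) m := by
        rw [← Finset.sum_neg_distrib]
        refine Finset.sum_congr rfl fun i _ => ?_
        rw [← neg_smul]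
        congr 1
        have h1 : sgn (α * (γ + β)) = sgn (γ * α) * sgn (α * β) := by
          rw [mul_add, sgn_add, mul_comm α γ]
        have h2 : sgn (r - n - 1 - i) = -(sgn r * (-1) ^ n * (-1) ^ i) := by
          rw [show r - n - 1 - i = r + -(n + 1 + i) by ring, sgn_add, sgn_neg, sgn_add, sgn_add]
          simp only [sgn, zpow_natCast, zpow_one]
          ring
        have h3 : ((-1 : ℂ) ^ n) * (-1) ^ n = 1 := by rw [← mul_pow]; simp
        rw [h1, h2, hs1]
        linear_combination (-(sgn (γ * α) * ((n + i).choose n : ℂ) * sgn r * (-1) ^ i *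
          sgn (γ * α) * sgn (α * β))) * h3 - (((n + i).choose n : ℂ) * sgn r * (-1) ^ i *
          sgn (α * β)) * sgn_mul_self (γ * α) + (sgn r * sgn (α * β) * (-1) ^ i *
          ((n + i).choose n : ℂ)) * sgn_mul_self (γ * β)
      rw [e1, e2, e3]
      simp only [jetDeg]
      abel
  | zero =>
    simp [resIter, resLeft, resRight, nprod, mode_zero]
  | add a a' ha ha' h h' =>
    obtain ⟨N₁, h₁⟩ := exists_trunc (R.act b) m
    obtain ⟨N₂, h₂⟩ := exists_trunc (R.act a) m
    obtain ⟨N₃, h₃⟩ := exists_trunc (R.act a') m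
    obtain ⟨N₄, h₄⟩ := exists_trunc (Y deg a) b
    obtain ⟨N₅, h₅⟩ := exists_trunc (Y deg a') b
    have h₄' : ∀ t, (N₄ : ℤ) ≤ t → nprod deg a t b = 0 := h₄
    have h₅' : ∀ t, (N₅ : ℤ) ≤ t → nprod deg a' t b = 0 := h₅
    have hadd : ∀ t, nprod deg (a + a') t b = nprod deg a t b + nprod deg a' t b := fun t => by
      simp only [nprod, map_add, mode_add, LinearMap.add_apply]
    -- A common bound turns all sums of finite support into sums over one range, where additivity is
    -- evident.
    set N := (N₁ - q).toNat + (N₂ - p).toNat + (N₃ - p).toNat + (N₄ - r).toNat + (N₅ - r).toNat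
    have h := h hb p q r m
    have h' := h' hb p q r m
    have v1 : ∀ j : ℕ, N ≤ j → mode (R.act b) (q + j) m = 0 := fun j hj => h₁ _ (by omega)
    have v2 : ∀ j : ℕ, N ≤ j → mode (R.act a) (p + j) m = 0 := fun j hj => h₂ _ (by omega)
    have v3 : ∀ j : ℕ, N ≤ j → mode (R.act a') (p + j) m = 0 := fun j hj => h₃ _ (by omega)
    have v4 : ∀ j : ℕ, N ≤ j → nprod deg a (r + j) b = 0 := fun j hj => h₄' _ (by omega)
    have v5 : ∀ j : ℕ, N ≤ j → nprod deg a' (r + j) b = 0 := fun j hj => h₅' _ (by omega)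
    rw [resIter_eq _ _ _ _ _ N (fun j hj => by simp only [v4 j hj, map_zero]),
      resLeft_eq _ _ _ _ _ _ N v1, resRight_eq _ _ _ _ _ _ N v2] at h
    rw [resIter_eq _ _ _ _ _ N (fun j hj => by simp only [v5 j hj, map_zero]),
      resLeft_eq _ _ _ _ _ _ N v1, resRight_eq _ _ _ _ _ _ N v3] at h'
    rw [resIter_eq _ _ _ _ _ N (fun j hj => by simp only [hadd, v4 j hj, v5 j hj, add_zero,
      map_zero]), resLeft_eq _ _ _ _ _ _ N v1, resRight_eq _ _ _ _ _ _ N (fun j hj => by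
        rw [map_add, mode_add, LinearMap.add_apply, v2 j hj, v3 j hj, add_zero])]
    simp only [hadd, map_add, mode_add, LinearMap.add_apply, smul_add, Finset.sum_add_distrib,
      h, h']
    abel
  | smul c a ha h =>
    obtain ⟨N₁, h₁⟩ := exists_trunc (R.act b) m
    obtain ⟨N₂, h₂⟩ := exists_trunc (R.act a) m
    obtain ⟨N₄, h₄⟩ := exists_trunc (Y deg a) b
    have h₄' : ∀ t, (N₄ : ℤ) ≤ t → nprod deg a t b = 0 := h₄
    have hsmul : ∀ t, nprod deg (c • a) t b = c • nprod deg a t b := fun t => by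
      simp only [nprod, map_smul, mode_smul, LinearMap.smul_apply]
    set N := (N₁ - q).toNat + (N₂ - p).toNat + (N₄ - r).toNat
    have h := h hb p q r m
    have v1 : ∀ j : ℕ, N ≤ j → mode (R.act b) (q + j) m = 0 := fun j hj => h₁ _ (by omega)
    have v2 : ∀ j : ℕ, N ≤ j → mode (R.act a) (p + j) m = 0 := fun j hj => h₂ _ (by omega)
    have v4 : ∀ j : ℕ, N ≤ j → nprod deg a (r + j) b = 0 := fun j hj => h₄' _ (by omega)
    rw [resIter_eq _ _ _ _ _ N (fun j hj => by simp only [v4 j hj, map_zero]),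
      resLeft_eq _ _ _ _ _ _ N v1, resRight_eq _ _ _ _ _ _ N v2] at h
    rw [resIter_eq _ _ _ _ _ N (fun j hj => by simp only [hsmul, v4 j hj, smul_zero,
      map_zero]), resLeft_eq _ _ _ _ _ _ N v1, resRight_eq _ _ _ _ _ _ N (fun j hj => by
        rw [map_smul, mode_smul, LinearMap.smul_apply, v2 j hj, smul_zero])]
    simp only [hsmul, map_smul, mode_smul, LinearMap.smul_apply, smul_comm _ c, ← Finset.smul_sum,
      h, smul_sub]

end HeisRep

/-! ### The Weyl superalgebra and differential operators -/

namespace Weyl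

open SuperPoly

variable {ι : Type} (deg : ι → ℤ)

open Classical in
/-- The supercommutators of the coordinates `x_i`, `∂_{x_i}`. -/
def contr (g h : Coord ι) : ℂ := if h = g.dual then Coord.pairing deg g else 0

/-- The relations of the Weyl superalgebra. -/
inductive Rel : FreeAlgebra ℂ (Coord ι) → FreeAlgebra ℂ (Coord ι) → Prop
  | comm (g h : Coord ι) : Rel (FreeAlgebra.ι ℂ g * FreeAlgebra.ι ℂ h)
      (sgn (g.degree deg * h.degree deg) • (FreeAlgebra.ι ℂ h * FreeAlgebra.ι ℂ g) +
        contr deg g h • 1)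

/-- The Weyl superalgebra. -/
abbrev Alg : Type := RingQuot (Rel deg)

/-- The generators of the Weyl superalgebra. -/
def of (g : Coord ι) : Alg deg := RingQuot.mkAlgHom ℂ (Rel deg) (FreeAlgebra.ι ℂ g)

lemma of_mul_of (g h : Coord ι) : of deg g * of deg h =
    sgn (g.degree deg * h.degree deg) • (of deg h * of deg g) + contr deg g h • 1 := by
  have h := RingQuot.mkAlgHom_rel ℂ (Rel.comm (deg := deg) g h)
  simpa [of] using h

/-- Operators which satisfy the relations of the Weyl superalgebra. -/
def IsRep {B : Type*} [Ring B] [Algebra ℂ B] (f : Coord ι → B) : Prop :=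
  ∀ g h, f g * f h = sgn (g.degree deg * h.degree deg) • (f h * f g) + contr deg g h • 1

variable {deg}

/-- The universal property of the Weyl superalgebra. -/
def lift {B : Type*} [Ring B] [Algebra ℂ B] (f : Coord ι → B) (hf : IsRep deg f) : Alg deg →ₐ[ℂ] B :=
  RingQuot.liftAlgHom ℂ ⟨FreeAlgebra.lift ℂ f, by
    rintro _ _ ⟨g, h⟩
    simpa using hf g h⟩

@[simp] lemma lift_of {B : Type*} [Ring B] [Algebra ℂ B] (f : Coord ι → B) (hf : IsRep deg f)
    (g : Coord ι) : lift f hf (of deg g) = f g := by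
  have h := RingQuot.liftAlgHom_mkAlgHom_apply ℂ (s := Rel deg) (FreeAlgebra.lift ℂ f) (by
    rintro _ _ ⟨g, h⟩
    simpa using hf g h) (FreeAlgebra.ι ℂ g)
  rw [FreeAlgebra.lift_ι_apply] at h
  exact h

lemma induction {C : Alg deg → Prop} (one : C 1)
    (add : ∀ p q, C p → C q → C (p + q)) (smul : ∀ (c : ℂ) p, C p → C (c • p))
    (of_mul : ∀ x p, C p → C (of deg x * p)) (p : Alg deg) : C p := by
  obtain ⟨a, rfl⟩ := RingQuot.mkAlgHom_surjective ℂ (Rel deg) p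
  have key : ∀ a : FreeAlgebra ℂ (Coord ι), ∀ q, C q → C (RingQuot.mkAlgHom ℂ (Rel deg) a * q) := by
    intro a
    induction a using FreeAlgebra.induction with
    | grade0 r =>
      intro q hq
      rw [AlgHom.commutes, ← Algebra.smul_def]
      exact smul r q hq
    | grade1 x => exact fun q hq => of_mul x q hq
    | mul a b ha hb =>
      intro q hq
      rw [map_mul, mul_assoc]
      exact ha _ (hb _ hq)
    | add a b ha hb =>
      intro q hq
      rw [map_add, add_mul]
      exact add _ _ (ha _ hq) (hb _ hq)
  simpa using key a 1 one

lemma contr_ne_zero {g h : Coord ι} (hgh : contr deg g h ≠ 0) : h.degree deg = -g.degree deg := by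
  unfold contr at hgh
  split_ifs at hgh with e
  · rw [e, Coord.degree_dual]
  · exact absurd rfl hgh

/-- A rescaling of the generators by a character of the grading. -/
lemma isRep_rescale {B : Type*} [Ring B] [Algebra ℂ B] {f : Coord ι → B} (hf : IsRep deg f)
    (χ : ℤ → ℂ) (hχ : ∀ k, χ k * χ (-k) = 1) : IsRep deg fun g => χ (g.degree deg) • f g := by
  intro g h
  simp only [smul_mul_smul_comm]
  rw [hf, smul_add, smul_comm, mul_comm (χ (h.degree deg))]
  congr 1
  by_cases e : contr deg g h = 0
  · simp [e]
  · rw [contr_ne_zero e, hχ, one_smul]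

variable (deg) in
/-- The rescaling automorphisms of the Weyl superalgebra. -/
def rescale (χ : ℤ → ℂ) (hχ : ∀ k, χ k * χ (-k) = 1) : Alg deg →ₐ[ℂ] Alg deg :=
  lift _ (isRep_rescale (of_mul_of deg) χ hχ)

lemma sgn_eq_or (k : ℤ) : sgn k = 1 ∨ sgn k = -1 := by
  rcases Int.even_or_odd k with h | h <;> simp [sgn, h.neg_one_zpow]

lemma sgn_char (δ k : ℤ) : sgn (δ * k) * sgn (δ * -k) = 1 := by
  rw [mul_neg, sgn_neg, sgn_mul_self]

/-- The coordinates as differential operators. -/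
def coordOp : Coord ι → diffOps deg
  | .fn i => mulOp deg (gen deg i)
  | .vf i => pderivOp deg i

lemma isRep_coordOp : IsRep deg (coordOp (deg := deg)) := by
  classical
  have hvf : ∀ i j (p : SuperPoly deg), pderiv deg i (gen deg j * p) =
      (if j = i then p else 0) + sgn (deg i * deg j) • (gen deg j * pderiv deg i p) := by
    intro i j p
    rw [pderiv_mul, pderiv_gen, twist_gen, smul_mul_assoc]
    split_ifs <;> simp
  rintro (i | i) (j | j) <;> ext p
  · change gen deg i * (gen deg j * p) = sgn (deg i * deg j) • (gen deg j * (gen deg i * p)) +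
      contr deg (.fn i) (.fn j) • p
    rw [← mul_assoc, gen_mul_gen, smul_mul_assoc, mul_assoc]
    simp [contr, Coord.dual]
  · change gen deg i * pderiv deg j p = sgn (deg i * -deg j) • pderiv deg j (gen deg i * p) +
      contr deg (.fn i) (.vf j) • p
    rw [hvf, mul_neg, sgn_neg, smul_add, smul_smul, mul_comm (deg i), sgn_mul_self, one_smul,
      add_right_comm, right_eq_add]
    by_cases h : i = j
    · subst h
      simp only [contr, Coord.dual, Coord.pairing, if_true, ← add_smul]
      have : sgn (deg i * deg i) = sgn (deg i) := by
        rcases Int.even_or_odd (deg i) with h | h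
        · rw [sgn, sgn, h.neg_one_zpow, (h.mul_left _).neg_one_zpow]
        · rw [sgn, sgn, h.neg_one_zpow, (h.mul h).neg_one_zpow]
      rw [this, add_neg_cancel, zero_smul]
    · have : ¬ (Coord.vf j = Coord.dual (Coord.fn i)) := by
        simpa [Coord.dual] using Ne.symm h
      simp [contr, h, this]
  · change pderiv deg i (gen deg j * p) = sgn (-deg i * deg j) • (gen deg j * pderiv deg i p) +
      contr deg (.vf i) (.fn j) • p
    rw [hvf, neg_mul, sgn_neg, add_comm]
    congr 1
    by_cases h : j = i
    · subst h
      simp [contr, Coord.dual, Coord.pairing]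
    · have : ¬ (Coord.fn j = Coord.dual (Coord.vf i)) := by
        simpa [Coord.dual] using h
      simp [contr, h, this]
  · change pderiv deg i (pderiv deg j p) =
      sgn (-deg i * -deg j) • pderiv deg j (pderiv deg i p) + contr deg (.vf i) (.vf j) • p
    rw [pderiv_pderiv, neg_mul_neg]
    simp [contr, Coord.dual]

variable (deg) in
/-- The homomorphism to the algebra of differential operators. -/
def toDiff : Alg deg →ₐ[ℂ] diffOps deg := lift coordOp isRep_coordOp

/-! ### Normal ordering, and the faithful action of the Weyl superalgebra on polynomials -/

section Injectivity

/-- The operators `a ↦ ±a ∂_i` and `a ↦ ±[a, x_i]`, on an algebra with the relations of the Weyl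
superalgebra, where `s i` implements `a ↦ (-1)^{|x_i||a|} a`. -/
def crOp {B : Type*} [Ring B] [Algebra ℂ B] (f : Coord ι → B) (s : ι → B →ₐ[ℂ] B) (i : ι) :
    Module.End ℂ B :=
  LinearMap.mulRight ℂ (f (.vf i)) ∘ₗ (s i).toLinearMap

/-- See `crOp`. -/
def anOp (deg : ι → ℤ) {B : Type*} [Ring B] [Algebra ℂ B] (f : Coord ι → B) (s : ι → B →ₐ[ℂ] B)
    (i : ι) : Module.End ℂ B :=
  sgn (deg i * deg i) •
    (LinearMap.mulRight ℂ (f (.fn i)) ∘ₗ (s i).toLinearMap - LinearMap.mulLeft ℂ (f (.fn i)))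

/-- Up to signs, right multiplication by ∂_i creates, while the supercommutator with x_i annihilates
because it differentiates a word along ∂_i. The vacuum vectors are the elements that supercommute
with every x_i. The creation operators have the degrees of the ∂_i, hence -deg. -/
lemma isFock {B : Type*} [Ring B] [Algebra ℂ B] {f : Coord ι → B} (hf : IsRep deg f)
    {s : ι → B →ₐ[ℂ] B} (hs : ∀ i g, s i (f g) = sgn (deg i * g.degree deg) • f g)
    (hss : ∀ i j b, s i (s j b) = s j (s i b)) (hsq : ∀ i b, s i (s i b) = b) :
    IsFock (fun i => -deg i) (crOp f s) (anOp deg f s) := by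
  have hxx : ∀ i j, f (.fn i) * f (.fn j) = sgn (deg i * deg j) • (f (.fn j) * f (.fn i)) := by
    intro i j
    rw [hf]
    simp [contr, Coord.dual, Coord.degree]
  have hvv : ∀ i j, f (.vf i) * f (.vf j) = sgn (deg i * deg j) • (f (.vf j) * f (.vf i)) := by
    intro i j
    rw [hf]
    simp [contr, Coord.dual, Coord.degree]
  have hvx : ∀ i j, i ≠ j → f (.vf i) * f (.fn j) =
      sgn (deg i * deg j) • (f (.fn j) * f (.vf i)) := by
    intro i j hij
    have : ¬ (Coord.fn j = Coord.dual (Coord.vf i)) := by simpa [Coord.dual] using hij.symm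
    rw [hf]
    simp [contr, this, Coord.degree, sgn_neg]
  have hvx' : ∀ i, f (.vf i) * f (.fn i) = sgn (deg i * deg i) • (f (.fn i) * f (.vf i)) + 1 := by
    intro i
    rw [hf]
    simp [contr, Coord.dual, Coord.degree, Coord.pairing, sgn_neg]
  have hsx : ∀ i j, s i (f (.fn j)) = sgn (deg i * deg j) • f (.fn j) := fun i j => hs i _
  have hsv : ∀ i j, s i (f (.vf j)) = sgn (deg i * deg j) • f (.vf j) := fun i j => by
    rw [hs]
    simp [Coord.degree, sgn_neg]
  constructor
  · intro i j
    ext b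
    simp only [Module.End.mul_apply, crOp, LinearMap.comp_apply, LinearMap.mulRight_apply,
      AlgHom.toLinearMap_apply, LinearMap.smul_apply, map_mul, hsv, neg_mul_neg, mul_smul_comm,
      smul_mul_assoc, smul_smul]
    rw [mul_assoc, mul_assoc, hvv j i, hss i j, mul_smul_comm, smul_smul, mul_comm (deg j)]
  · intro i j b
    simp only [anOp, LinearMap.comp_apply, LinearMap.mulRight_apply, LinearMap.mulLeft_apply,
      AlgHom.toLinearMap_apply, LinearMap.smul_apply, LinearMap.sub_apply, map_mul, hsx,
      neg_mul_neg, mul_smul_comm, smul_mul_assoc, smul_smul, map_smul, map_sub,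
      smul_sub]
    rw [mul_comm (deg j) (deg i), mul_assoc (s i (s j b)), mul_assoc (s j (s i b)), hxx j i,
      hss i j, ← mul_assoc (f (.fn i)) (f (.fn j)) b, hxx i j, mul_comm (deg j) (deg i)]
    simp only [mul_smul_comm, smul_mul_assoc, smul_smul, ← mul_assoc]
    rcases sgn_eq_or (deg i * deg j) with e | e <;> rw [e] <;> module
  · intro i b
    simp only [anOp, crOp, LinearMap.comp_apply, LinearMap.mulRight_apply, LinearMap.mulLeft_apply,
      AlgHom.toLinearMap_apply, LinearMap.smul_apply, LinearMap.sub_apply, map_mul, hsv, hsx,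
      neg_mul_neg, mul_smul_comm, smul_mul_assoc, smul_smul, map_smul, map_sub,
      smul_sub, hsq, mul_assoc, hvx', mul_add, mul_one, smul_add]
    rcases sgn_eq_or (deg i * deg i) with e | e <;> rw [e] <;> module
  · intro i j b hij
    simp only [anOp, crOp, LinearMap.comp_apply, LinearMap.mulRight_apply, LinearMap.mulLeft_apply,
      AlgHom.toLinearMap_apply, LinearMap.smul_apply, LinearMap.sub_apply, map_mul, hsv, hsx,
      neg_mul_neg, mul_smul_comm, smul_mul_assoc, smul_smul, map_smul, map_sub,
      smul_sub, hss i j, mul_assoc, hvx j i hij.symm, mul_comm (deg j) (deg i)]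
    rcases sgn_eq_or (deg i * deg j) with e | e <;> rw [e] <;> module

/-- The map `λ ⊗ p ↦ p λ` to an algebra with the relations of the Weyl superalgebra, up to signs. -/
def normalMap {B : Type*} [Ring B] [Algebra ℂ B] {f : Coord ι → B} (hf : IsRep deg f)
    {s : ι → B →ₐ[ℂ] B} (hs : ∀ i g, s i (f g) = sgn (deg i * g.degree deg) • f g)
    (hss : ∀ i j b, s i (s j b) = s j (s i b)) (hsq : ∀ i b, s i (s i b) = b)
    (j : SuperPoly deg →ₗ[ℂ] B) : SuperPoly (fun i => -deg i) ⊗[ℂ] SuperPoly deg →ₗ[ℂ] B :=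
  TensorProduct.lift ((LinearMap.lcomp ℂ B j) ∘ₗ
    (SuperPoly.lift (crOp f s) (isFock hf hs hss hsq).cr_cr).toLinearMap)

variable (deg) in
/-- The sign automorphism `a ↦ (-1)^{|x_i||a|} a` of the Weyl superalgebra. -/
def signAut (i : ι) : Alg deg →ₐ[ℂ] Alg deg := rescale deg (fun k => sgn (deg i * k)) (sgn_char _)

lemma signAut_of (i : ι) (g : Coord ι) :
    signAut deg i (of deg g) = sgn (deg i * g.degree deg) • of deg g := by
  simp [signAut, rescale]

lemma signAut_comm (i j : ι) (b : Alg deg) :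
    signAut deg i (signAut deg j b) = signAut deg j (signAut deg i b) := by
  induction b using induction with
  | one => simp
  | add p q hp hq => simp [hp, hq]
  | smul c p hp => simp [hp]
  | of_mul x p hp => simp [hp, signAut_of, smul_smul, mul_comm]

lemma signAut_signAut (i : ι) (b : Alg deg) : signAut deg i (signAut deg i b) = b := by
  induction b using induction with
  | one => simp
  | add p q hp hq => simp [hp, hq]
  | smul c p hp => simp [hp]
  | of_mul x p hp => simp [hp, signAut_of, smul_smul, sgn_mul_self]

variable (deg) in
/-- The embedding of `P` in the Weyl superalgebra. -/
def fnHom : SuperPoly deg →ₐ[ℂ] Alg deg :=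
  SuperPoly.lift (fun i => of deg (.fn i)) fun i j => by
    rw [of_mul_of]
    simp [contr, Coord.dual, Coord.degree]

lemma signAut_fnHom (i : ι) (p : SuperPoly deg) :
    signAut deg i (fnHom deg p) = fnHom deg (twist deg (deg i) p) := by
  induction p using gen_induction with
  | one => simp
  | add p q hp hq => simp [hp, hq]
  | smul c p hp => simp [hp]
  | gen_mul x p hp =>
    have hx : fnHom deg (gen deg x) = of deg (.fn x) := by simp [fnHom]
    rw [map_mul, map_mul, hx, signAut_of, hp, map_mul, twist_gen, map_mul, map_smul, hx,
      Coord.degree]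

lemma of_vf_mul_fnHom (i : ι) (p : SuperPoly deg) : of deg (.vf i) * fnHom deg p =
    fnHom deg (pderiv deg i p) + fnHom deg (twist deg (deg i) p) * of deg (.vf i) := by
  classical
  induction p using gen_induction with
  | one => simp
  | add p q hp hq => simp only [map_add, mul_add, hp, hq, add_mul]; abel
  | smul c p hp => simp [hp, smul_add]
  | gen_mul x p hp =>
    have hx : fnHom deg (gen deg x) = of deg (.fn x) := by simp [fnHom]
    rw [map_mul, ← mul_assoc, hx, of_mul_of, add_mul, smul_mul_assoc, mul_assoc, hp, pderiv_mul,
      map_mul, map_add, map_mul, map_mul, map_mul, twist_gen, map_smul, hx, pderiv_gen]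
    have h1 : contr deg (.vf i) (.fn x) • (1 : Alg deg) * fnHom deg p =
        fnHom deg (if x = i then 1 else 0) * fnHom deg p := by
      by_cases h : x = i
      · subst h; simp [contr, Coord.dual, Coord.pairing]
      · have : ¬ (Coord.fn x = Coord.dual (Coord.vf i)) := by simpa [Coord.dual] using h
        simp [contr, h, this]
    rw [h1]
    simp only [Coord.degree, neg_mul, sgn_neg, mul_add, smul_add, smul_mul_assoc, mul_assoc]
    abel

variable (deg) in
/-- The map `λ ⊗ p ↦ p λ` to the Weyl superalgebra, up to signs. -/
def weylMap : SuperPoly (fun i => -deg i) ⊗[ℂ] SuperPoly deg →ₗ[ℂ] Alg deg :=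
  normalMap (of_mul_of deg) signAut_of signAut_comm signAut_signAut (fnHom deg).toLinearMap

lemma weylMap_gen_mul (i : ι) (l : SuperPoly fun i => -deg i) (p : SuperPoly deg) :
    weylMap deg ((gen _ i * l) ⊗ₜ p) =
      signAut deg i (weylMap deg (l ⊗ₜ p)) * of deg (.vf i) := by
  simp [weylMap, normalMap, crOp]

lemma weylMap_one (p : SuperPoly deg) : weylMap deg (1 ⊗ₜ p) = fnHom deg p := by
  simp [weylMap, normalMap]

/-- Normal ordering: the range contains 1 and is stable under left multiplication by the generators,
since a vector field can be moved to the right of all functions at the cost of a derivative. -/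
lemma weylMap_surjective : Function.Surjective (weylMap deg) := by
  have hcr : ∀ i, ∀ w ∈ LinearMap.range (weylMap deg),
      signAut deg i w * of deg (.vf i) ∈ LinearMap.range (weylMap deg) := by
    rintro i _ ⟨t, rfl⟩
    induction t with
    | zero => simp
    | add s t hs ht => rw [map_add, map_add, add_mul]; exact add_mem hs ht
    | tmul l p => exact ⟨_, weylMap_gen_mul i l p⟩
  have key : ∀ (g : Coord ι) (t), of deg g * weylMap deg t ∈ LinearMap.range (weylMap deg) := by
    intro g t
    induction t with
    | zero => simp
    | add s t hs ht => rw [map_add, mul_add]; exact add_mem hs ht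
    | tmul l p =>
      induction l using gen_induction with
      | one =>
        rw [weylMap_one]
        cases g with
        | fn i => exact ⟨1 ⊗ₜ (gen deg i * p), by rw [weylMap_one, map_mul]; simp [fnHom]⟩
        | vf i =>
          rw [of_vf_mul_fnHom, ← signAut_fnHom]
          exact add_mem ⟨1 ⊗ₜ _, weylMap_one _⟩ (hcr i _ ⟨1 ⊗ₜ _, weylMap_one _⟩)
      | add a b ha hb => rw [TensorProduct.add_tmul, map_add, mul_add]; exact add_mem ha hb
      | smul c a ha =>
        rw [← TensorProduct.smul_tmul', map_smul, mul_smul_comm]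
        exact Submodule.smul_mem _ _ ha
      | gen_mul i l hl =>
        have h1 := hcr i _ hl
        rw [map_mul, signAut_of, smul_mul_assoc, smul_mul_assoc] at h1
        have h2 := Submodule.smul_mem _ (sgn (deg i * g.degree deg)) h1
        rw [smul_smul, sgn_mul_self, one_smul] at h2
        rw [weylMap_gen_mul, ← mul_assoc]
        exact h2
  intro w
  change w ∈ LinearMap.range (weylMap deg)
  induction w using induction with
  | one => exact ⟨1 ⊗ₜ 1, by rw [weylMap_one, map_one]⟩
  | add p q hp hq => exact add_mem hp hq
  | smul c p hp => exact Submodule.smul_mem _ _ hp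
  | of_mul x p hp =>
    obtain ⟨t, rfl⟩ := hp
    exact key x t

variable (deg) in
/-- The coordinates as operators on `P`. -/
def coordEnd (g : Coord ι) : Module.End ℂ (SuperPoly deg) :=
  (coordOp g : diffOps deg)

lemma isRep_coordEnd : IsRep deg (coordEnd deg) := fun g h =>
  congrArg Subtype.val (isRep_coordOp (deg := deg) g h)

lemma twist_twist (δ : ℤ) (p : SuperPoly deg) : twist deg δ (twist deg δ p) = p := by
  induction p using gen_induction with
  | one => simp
  | add p q hp hq => simp [hp, hq]
  | smul c p hp => simp [hp]
  | gen_mul x p hp => simp [hp, smul_smul, sgn_mul_self]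

variable (deg) in
/-- Conjugation by the sign automorphism of `P`. -/
def conj (i : ι) : Module.End ℂ (SuperPoly deg) →ₐ[ℂ] Module.End ℂ (SuperPoly deg) :=
  AlgHom.ofLinearMap
    (LinearMap.mulLeft ℂ (A := Module.End ℂ (SuperPoly deg)) (twist deg (deg i)).toLinearMap ∘ₗ
      LinearMap.mulRight ℂ (A := Module.End ℂ (SuperPoly deg)) (twist deg (deg i)).toLinearMap)
    (by ext p; simp [twist_twist]) (fun a b => by ext p; simp [twist_twist])

lemma conj_apply (i : ι) (a : Module.End ℂ (SuperPoly deg)) (p : SuperPoly deg) :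
    conj deg i a p = twist deg (deg i) (a (twist deg (deg i) p)) := rfl

lemma conj_coordEnd (i : ι) (g : Coord ι) :
    conj deg i (coordEnd deg g) = sgn (deg i * g.degree deg) • coordEnd deg g := by
  ext p
  rw [conj_apply]
  cases g with
  | fn j =>
    change twist deg (deg i) (gen deg j * _) = sgn (deg i * deg j) • (gen deg j * p)
    rw [map_mul, twist_gen, twist_twist, smul_mul_assoc]
  | vf j =>
    change twist deg (deg i) (pderiv deg j _) = sgn (deg i * -deg j) • pderiv deg j p
    rw [twist_pderiv, twist_twist, mul_neg, sgn_neg]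

lemma conj_comm (i j : ι) (a : Module.End ℂ (SuperPoly deg)) :
    conj deg i (conj deg j a) = conj deg j (conj deg i a) := by
  ext p
  simp only [conj_apply]
  rw [twist_twist_comm, twist_twist_comm deg (deg i) (deg j) p]

lemma conj_conj (i : ι) (a : Module.End ℂ (SuperPoly deg)) : conj deg i (conj deg i a) = a := by
  ext p
  simp only [conj_apply, twist_twist]

lemma mul_gen (p : SuperPoly deg) (i : ι) : p * gen deg i = gen deg i * twist deg (deg i) p := by
  induction p using gen_induction with
  | one => simp
  | add p q hp hq => simp [hp, hq, mul_add, add_mul]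
  | smul c p hp => simp [hp]
  | gen_mul x p hp =>
    rw [mul_assoc, hp, map_mul, twist_gen, ← mul_assoc, gen_mul_gen, mul_comm (deg x)]
    simp [mul_assoc]

variable (deg) in
/-- The map `λ ⊗ p ↦ p λ` to the operators on `P`, up to signs. -/
def endMap : SuperPoly (fun i => -deg i) ⊗[ℂ] SuperPoly deg →ₗ[ℂ] Module.End ℂ (SuperPoly deg) :=
  normalMap isRep_coordEnd conj_coordEnd conj_comm conj_conj (Algebra.lmul ℂ _).toLinearMap

/-- Multiplication operators supercommute with the x_i and are therefore vacuum vectors. So the map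
is the injective Fock map composed with the inclusion of P among the vacuum vectors, tensored over
the field ℂ. -/
lemma endMap_injective : Function.Injective (endMap deg) := by
  have hF := isFock (deg := deg) isRep_coordEnd conj_coordEnd conj_comm conj_conj
  have hv : ∀ p, (Algebra.lmul ℂ (SuperPoly deg) p) ∈
      IsFock.vac (anOp deg (coordEnd deg) (conj deg)) := by
    intro p
    rw [IsFock.mem_vac]
    intro i
    ext q
    change sgn (deg i * deg i) •
      (twist deg (deg i) (p * twist deg (deg i) (gen deg i * q)) - gen deg i * (p * q)) = 0
    rw [map_mul, twist_twist, ← mul_assoc, mul_gen, twist_twist, mul_assoc, sub_self, smul_zero]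
  let j : SuperPoly deg →ₗ[ℂ] IsFock.vac (anOp deg (coordEnd deg) (conj deg)) :=
    (Algebra.lmul ℂ (SuperPoly deg)).toLinearMap.codRestrict _ hv
  have hj : Function.Injective j := by
    intro p q h
    have h1 : Algebra.lmul ℂ (SuperPoly deg) p = Algebra.lmul ℂ (SuperPoly deg) q :=
      congrArg Subtype.val h
    simpa using LinearMap.congr_fun h1 1
  have h1 : endMap deg = hF.fockMap ∘ₗ j.lTensor _ := by
    ext l p : 3
    rfl
  rw [h1, LinearMap.coe_comp]
  exact hF.fockMap_injective.comp (Module.Flat.lTensor_preserves_injective_linearMap j hj)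

lemma toDiff_of (g : Coord ι) : toDiff deg (of deg g) = coordOp g := by simp [toDiff]

lemma toDiff_signAut (i : ι) (w : Alg deg) :
    (toDiff deg (signAut deg i w) : Module.End ℂ (SuperPoly deg)) = conj deg i (toDiff deg w) := by
  induction w using induction with
  | one => simp
  | add p q hp hq => simp [hp, hq]
  | smul c p hp => simp [hp]
  | of_mul x p hp =>
    have := conj_coordEnd (deg := deg) i x
    simp only [map_mul, signAut_of, map_smul, toDiff_of, Subalgebra.coe_mul, Subalgebra.coe_smul,
      hp]
    rw [← coordEnd, this]

lemma toDiff_fnHom (p : SuperPoly deg) : toDiff deg (fnHom deg p) = mulOp deg p := by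
  induction p using gen_induction with
  | one => ext q; simp [mulOp]
  | add p q hp hq => ext r; simp [hp, hq, mulOp, add_mul]
  | smul c p hp => ext r; simp [hp, mulOp]
  | gen_mul x p hp =>
    rw [map_mul, map_mul, hp]
    ext q
    simp [fnHom, toDiff_of, coordOp, mulOp]

lemma toDiff_weylMap (t : SuperPoly (fun i => -deg i) ⊗[ℂ] SuperPoly deg) :
    (toDiff deg (weylMap deg t) : Module.End ℂ (SuperPoly deg)) = endMap deg t := by
  induction t with
  | zero => simp
  | add s t hs ht => simp [hs, ht]
  | tmul l p =>
    induction l using gen_induction with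
    | one =>
      rw [weylMap_one, toDiff_fnHom]
      simp [endMap, normalMap, mulOp]
      rfl
    | add a b ha hb => simp [TensorProduct.add_tmul, ha, hb]
    | smul c a ha => simp only [← TensorProduct.smul_tmul', map_smul, Subalgebra.coe_smul, ha]
    | gen_mul i l hl =>
      rw [weylMap_gen_mul, map_mul, Subalgebra.coe_mul, toDiff_signAut, hl, toDiff_of]
      simp [endMap, normalMap, crOp, coordEnd]

/-- Every element of the Weyl superalgebra has a normally ordered form, and such forms are already
linearly independent as operators on P. -/
lemma toDiff_injective : Function.Injective (toDiff deg) := by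
  intro v w h
  obtain ⟨s, rfl⟩ := weylMap_surjective v
  obtain ⟨t, rfl⟩ := weylMap_surjective w
  have := congrArg Subtype.val h
  rw [toDiff_weylMap, toDiff_weylMap] at this
  rw [endMap_injective this]

lemma mul_gen_of_mem {k : ℤ} {a : SuperPoly deg} (ha : a ∈ homog deg k) (x : ι) :
    a * gen deg x = sgn (k * deg x) • (gen deg x * a) := by
  rw [mul_gen, twist_of_mem deg _ k a ha, mul_smul_comm, mul_comm k]

/-- Both sides obey the same Leibniz rule and agree on the generators. This places every
superderivation in the algebra generated by the coordinates, and it also writes ∂ as ∑ f_i ∂_i. -/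
lemma superDerivation_eq_sum [Fintype ι] {δ : ℤ} {D : Module.End ℂ (SuperPoly deg)}
    (hD : IsSuperDerivation deg δ D) (p : SuperPoly deg) :
    D p = ∑ i, D (gen deg i) * pderiv deg i p := by
  classical
  have hgen : ∀ x, gen deg x ∈ homog deg (deg x) := fun x => by
    simpa using gen_mul_mem deg x 0 1 (one_mem_weightGr deg deg)
  induction p using gen_induction with
  | one =>
    have := hD.leibniz 0 1 (one_mem_weightGr deg deg) 1
    simp only [mul_one, one_mul, mul_zero] at this
    have h2 : sgn 0 = 1 := by simp [sgn]
    rw [h2, one_smul, right_eq_add] at this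
    simp [this]
  | add p q hp hq => simp [hp, hq, mul_add, Finset.sum_add_distrib]
  | smul c p hp => simp [hp, Finset.smul_sum]
  | gen_mul x p hp =>
    rw [hD.leibniz _ _ (hgen x), hp, Finset.mul_sum, Finset.smul_sum]
    simp only [pderiv_mul, pderiv_gen, twist_gen, mul_add, Finset.sum_add_distrib]
    congr 1
    · rw [Finset.sum_eq_single x]
      · simp
      · intro i _ hi
        simp [hi.symm]
      · simp
    · refine Finset.sum_congr rfl fun i _ => ?_
      rw [smul_mul_assoc, mul_smul_comm, ← mul_assoc (D _),
        mul_gen_of_mem (hD.map_homog _ _ (hgen i)), smul_mul_assoc, smul_smul, add_mul, sgn_add,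
        ← mul_assoc (sgn _), sgn_mul_self, one_mul, mul_assoc]

lemma toDiff_surjective [Fintype ι] : Function.Surjective (toDiff deg) := by
  have key : ∀ a : Module.End ℂ (SuperPoly deg), ∀ ha : a ∈ diffOps deg,
      ∃ w, toDiff deg w = ⟨a, ha⟩ := by
    intro a ha
    induction ha using Algebra.adjoin_induction with
    | mem a h =>
      rcases h with ⟨p, rfl⟩ | ⟨δ, hD⟩
      · exact ⟨fnHom deg p, toDiff_fnHom p⟩
      · refine ⟨∑ i, fnHom deg (a (gen deg i)) * of deg (.vf i), ?_⟩
        ext p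
        simp only [map_sum, map_mul, toDiff_fnHom, toDiff_of, AddSubmonoidClass.coe_finsetSum,
          Subalgebra.coe_mul, LinearMap.sum_apply]
        exact (superDerivation_eq_sum hD p).symm
    | algebraMap c => exact ⟨algebraMap ℂ _ c, by rw [AlgHom.commutes]; rfl⟩
    | add a b _ _ ha hb =>
      obtain ⟨v, hv⟩ := ha
      obtain ⟨w, hw⟩ := hb
      exact ⟨v + w, by rw [map_add, hv, hw]; rfl⟩
    | mul a b _ _ ha hb =>
      obtain ⟨v, hv⟩ := ha
      obtain ⟨w, hw⟩ := hb
      exact ⟨v * w, by rw [map_mul, hv, hw]; rfl⟩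
  exact fun a => key a a.2

/-! ### Differential operators by generators and relations -/

variable (deg) in
/-- The algebra of differential operators is the Weyl superalgebra. -/
def equivDiff [Fintype ι] : Alg deg ≃ₐ[ℂ] diffOps deg :=
  AlgEquiv.ofBijective (toDiff deg) ⟨toDiff_injective, toDiff_surjective⟩

/-- The universal property of the algebra of differential operators. -/
def diffLift [Fintype ι] {B : Type*} [Ring B] [Algebra ℂ B] (f : Coord ι → B) (hf : IsRep deg f) :
    diffOps deg →ₐ[ℂ] B :=
  (lift f hf).comp (equivDiff deg).symm.toAlgHom

@[simp] lemma diffLift_coordOp [Fintype ι] {B : Type*} [Ring B] [Algebra ℂ B] (f : Coord ι → B)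
    (hf : IsRep deg f) (g : Coord ι) : diffLift f hf (coordOp g) = f g := by
  have : (equivDiff deg).symm (coordOp g) = of deg g := by
    rw [AlgEquiv.symm_apply_eq]
    exact (toDiff_of g).symm
  simp [diffLift, this]

/-! ### Degrees of differential operators -/

variable (deg) in
/-- The span of the words of degree `k` in the coordinates. -/
def wordGr (k : ℤ) : Submodule ℂ (Alg deg) :=
  Submodule.span ℂ {w | ∃ l : List (Coord ι), (l.map (Coord.degree deg)).sum = k ∧
    w = (l.map (of deg)).prod}

lemma of_mul_mem_wordGr (g : Coord ι) {k : ℤ} {a : Alg deg} (ha : a ∈ wordGr deg k) :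
    of deg g * a ∈ wordGr deg (g.degree deg + k) := by
  induction ha using Submodule.span_induction with
  | mem p hp =>
    obtain ⟨l, rfl, rfl⟩ := hp
    exact Submodule.subset_span ⟨g :: l, by simp, by simp⟩
  | zero => simp
  | add p q _ _ hp hq => rw [mul_add]; exact add_mem hp hq
  | smul c p _ hp => rw [mul_smul_comm]; exact Submodule.smul_mem _ _ hp

lemma two_char (k : ℤ) : (2 : ℂ) ^ k * 2 ^ (-k) = 1 := by
  rw [← zpow_add₀ two_ne_zero, add_neg_cancel, zpow_zero]

lemma scale_of_mem {k : ℤ} {p : SuperPoly deg} (hp : p ∈ homog deg k) :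
    scale deg deg p = (2 : ℂ) ^ k • p := by
  induction hp using word_induction with
  | word l h =>
    subst h
    induction l with
    | nil => simp
    | cons x l ih =>
      rw [List.map_cons, List.prod_cons, map_mul, ih]
      simp [scale, zpow_add₀, smul_smul, mul_comm]
  | zero => simp
  | add p q _ _ hp hq => rw [map_add, hp, hq, smul_add]
  | smul c p _ hp => rw [map_smul, hp, smul_comm]

lemma scale_coordEnd (g : Coord ι) (p : SuperPoly deg) :
    scale deg deg (coordEnd deg g p) =
      (2 : ℂ) ^ g.degree deg • coordEnd deg g (scale deg deg p) := by
  refine LinearMap.congr_fun (f := (scale deg deg).toLinearMap ∘ₗ coordEnd deg g)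
    (g := (2 : ℂ) ^ g.degree deg • (coordEnd deg g ∘ₗ (scale deg deg).toLinearMap))
    (grade_hom_ext (homog_isInternal deg) fun k p hp => ?_) p
  have : coordEnd deg g p ∈ homog deg (g.degree deg + k) := by
    cases g with
    | fn i => exact gen_mul_mem deg i k p hp
    | vf i =>
      have := (isSuperDerivation_pderiv deg i).map_homog k p hp
      rwa [add_comm] at this
  simp [scale_of_mem hp, scale_of_mem this, zpow_add₀, smul_smul]

lemma scale_toDiff (w : Alg deg) (p : SuperPoly deg) :
    scale deg deg ((toDiff deg w : Module.End ℂ (SuperPoly deg)) p) =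
      (toDiff deg (rescale deg (fun k => (2 : ℂ) ^ k) two_char w) : Module.End ℂ (SuperPoly deg))
        (scale deg deg p) := by
  induction w using induction generalizing p with
  | one => simp
  | add v w hv hw => simp [hv, hw]
  | smul c w hw => simp [hw]
  | of_mul g w hw =>
    have h : ∀ q, ((coordOp g : diffOps deg) : Module.End ℂ (SuperPoly deg)) q =
        coordEnd deg g q := fun q => rfl
    simp only [map_mul, toDiff_of, Subalgebra.coe_mul, Module.End.mul_apply, h, scale_coordEnd, hw]
    simp [rescale, toDiff_of, h]

/-- A homogeneous differential operator of degree `k` is a linear combination of words of degree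
`k` in the coordinates. -/
lemma mem_wordGr_of_isHomogOp {k : ℤ} {w : Alg deg} (hw : IsHomogOp deg k (toDiff deg w)) :
    w ∈ wordGr deg k := by
  refine mem_of_eigen (rescale deg (fun k => (2 : ℂ) ^ k) two_char).toLinearMap
    (fun k w hw => ?_) (fun w => ?_) ?_
  · induction hw using Submodule.span_induction with
    | mem p hp =>
      obtain ⟨l, rfl, rfl⟩ := hp
      induction l with
      | nil => simp
      | cons x l ih =>
        simp only [AlgHom.toLinearMap_apply] at ih ⊢
        simp only [List.map_cons, List.prod_cons, List.sum_cons, map_mul, ih]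
        simp [rescale, zpow_add₀, smul_smul, mul_comm]
    | zero => simp
    | add p q _ _ hp hq => rw [map_add, hp, hq, smul_add]
    | smul c p _ hp => rw [map_smul, hp, smul_comm]
  · induction w using induction with
    | one => exact Submodule.mem_iSup_of_mem 0 (Submodule.subset_span ⟨[], by simp, by simp⟩)
    | add p q hp hq => exact add_mem hp hq
    | smul c p hp => exact Submodule.smul_mem _ _ hp
    | of_mul x p hp =>
      refine Submodule.iSup_induction _ (motive := fun p => of deg x * p ∈ ⨆ k, wordGr deg k)
        hp (fun k p hp => ?_) (by simp) fun p q hp hq => ?_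
      · exact Submodule.mem_iSup_of_mem _ (of_mul_mem_wordGr x hp)
      · rw [mul_add]; exact add_mem hp hq
  -- By faithfulness the eigenvalue equation can be checked on P, where the rescaling of the Weyl
  -- superalgebra becomes conjugation by the rescaling of P.
  · apply toDiff_injective
    ext p
    rw [AlgHom.toLinearMap_apply, map_smul]
    have hsurj : ∃ q, scale deg deg q = p := by
      refine ⟨gradeOp (homog_isInternal deg) (fun k => (2 : ℂ) ^ (-k)) p, ?_⟩
      refine LinearMap.congr_fun (f := (scale deg deg).toLinearMap ∘ₗ
        gradeOp (homog_isInternal deg) (fun k => (2 : ℂ) ^ (-k))) (g := LinearMap.id)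
        (grade_hom_ext (homog_isInternal deg) fun k p hp => ?_) p
      simp [gradeOp_of_mem _ _ hp, scale_of_mem hp, smul_smul,
        inv_mul_cancel₀ (zpow_ne_zero k (two_ne_zero (α := ℂ)))]
    obtain ⟨q, rfl⟩ := hsurj
    rw [← scale_toDiff]
    refine LinearMap.congr_fun (f := (scale deg deg).toLinearMap ∘ₗ
        (toDiff deg w : Module.End ℂ (SuperPoly deg)))
      (g := (2 : ℂ) ^ k • ((toDiff deg w : Module.End ℂ (SuperPoly deg)) ∘ₗ
        (scale deg deg).toLinearMap)) (grade_hom_ext (homog_isInternal deg) fun l p hp => ?_) q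
    simp [scale_of_mem hp, scale_of_mem (hw l p hp), zpow_add₀, smul_smul]

/-- Induction over homogeneous differential operators. -/
lemma homogOp_induction [Fintype ι] {C : ℤ → diffOps deg → Prop} (one : C 0 1)
    (zero : ∀ k, C k 0) (add : ∀ k a b, C k a → C k b → C k (a + b))
    (smul : ∀ k (c : ℂ) a, C k a → C k (c • a))
    (coord_mul : ∀ g k a, IsHomogOp deg k a → C k a → C (g.degree deg + k) (coordOp g * a))
    {k : ℤ} {a : diffOps deg} (ha : IsHomogOp deg k a) : C k a := by
  obtain ⟨w, rfl⟩ := toDiff_surjective a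
  have := mem_wordGr_of_isHomogOp ha
  clear ha
  induction this using Submodule.span_induction with
  | mem w hw =>
    obtain ⟨l, rfl, rfl⟩ := hw
    have key : ∀ l : List (Coord ι),
        IsHomogOp deg (l.map (Coord.degree deg)).sum (toDiff deg (l.map (of deg)).prod) ∧
        C (l.map (Coord.degree deg)).sum (toDiff deg (l.map (of deg)).prod) := by
      intro l
      induction l with
      | nil => exact ⟨fun k p hp => by simpa using hp, by simpa using one⟩
      | cons x l ih =>
        simp only [List.map_cons, List.sum_cons, List.prod_cons, map_mul, toDiff_of]
        refine ⟨fun k p hp => ?_, coord_mul x _ _ ih.1 ih.2⟩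
        have h1 := ih.1 k p hp
        cases x with
        | fn i =>
          rw [add_assoc]
          exact gen_mul_mem deg i _ _ h1
        | vf i =>
          have := (isSuperDerivation_pderiv deg i).map_homog _ _ h1
          rwa [add_comm, ← add_assoc] at this
    exact (key l).2
  | zero => simpa using zero k
  | add v w hv hw h1 h2 => rw [map_add]; exact add _ _ _ h1 h2
  | smul c w hw h => rw [map_smul]; exact smul _ _ _ h

lemma diffOps_induction [Fintype ι] {C : diffOps deg → Prop} (one : C 1)
    (add : ∀ a b, C a → C b → C (a + b)) (smul : ∀ (c : ℂ) a, C a → C (c • a))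
    (coord_mul : ∀ g a, C a → C (coordOp g * a)) (a : diffOps deg) : C a := by
  obtain ⟨w, rfl⟩ := toDiff_surjective a
  induction w using induction with
  | one => simpa using one
  | add v w hv hw => rw [map_add]; exact add _ _ hv hw
  | smul c w hw => rw [map_smul]; exact smul _ _ hw
  | of_mul g w hw => rw [map_mul, toDiff_of]; exact coord_mul _ _ hw

end Injectivity

end Weyl

/-! ### Singular vectors -/

namespace Coord

variable {ι : Type}

/-- The index of the mode of a coordinate which preserves the conformal weight. -/
def zeroIdx : Coord ι → ℤ
  | fn _ => -1
  | vf _ => 0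

lemma zeroIdx_dual (g : Coord ι) : zeroIdx (dual g) = -1 - zeroIdx g := by cases g <;> rfl

lemma pairing_mul_self (deg : ι → ℤ) (g : Coord ι) : pairing deg g * pairing deg g = 1 := by
  cases g <;> simp [pairing, sgn_mul_self]

end Coord

namespace HeisRep

open Chiral SuperPoly ChiralField

variable {ι : Type} {deg : ι → ℤ} {M : Type*} [AddCommGroup M] [Module ℂ M] (R : HeisRep deg M)

/-- The operators which raise the conformal weight. -/
def cr (y : Coord ι × ℕ) : Module.End ℂ M := R.op y.1 (y.1.zeroIdx - 1 - y.2)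

/-- The operators which lower the conformal weight, normalized to be dual to the operators which
raise it. -/
def an (y : Coord ι × ℕ) : Module.End ℂ M :=
  Coord.pairing deg y.1.dual • R.op y.1.dual (y.1.dual.zeroIdx + 1 + y.2)

/-- The operators which preserve the conformal weight. -/
def zeroMode (g : Coord ι) : Module.End ℂ M := R.op g g.zeroIdx

/-- The modes of nonzero conformal weight form their own oscillator algebra, indexed by pairs of a
coordinate and a natural number. Its polynomial algebra is therefore again `Jet deg`, but here the
generator (x_i, k) stands for x_{i(-2-k)}, because x_{i(-1)} is a zero mode. -/
lemma isFock : IsFock (jetDeg deg) R.cr R.an where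
  cr_cr x y := by
    ext m
    simp only [cr, Module.End.mul_apply, LinearMap.smul_apply]
    rw [R.comm_of_ne]
    · rfl
    · rcases x with ⟨_ | _, k⟩ <;> rcases y with ⟨_ | _, l⟩ <;> simp only [Coord.zeroIdx] <;> omega
  an_an x y m := by
    simp only [an, LinearMap.smul_apply, map_smul]
    rw [R.comm_of_ne]
    · simp only [Coord.degree_dual, jetDeg, neg_mul_neg, smul_smul]
      congr 1
      ring
    · rcases x with ⟨_ | _, k⟩ <;> rcases y with ⟨_ | _, l⟩ <;>
        simp only [Coord.zeroIdx, Coord.dual] <;> omega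
  an_cr x m := by
    classical
    simp only [an, cr, LinearMap.smul_apply, map_smul]
    rw [R.comm, Coord.contr, if_pos]
    · simp only [Coord.degree_dual, jetDeg, smul_add, smul_smul, Coord.pairing_mul_self, one_smul,
        neg_mul, sgn_neg]
      rw [add_comm, mul_comm (Coord.pairing _ _)]
    · rw [Coord.dual_dual, Coord.zeroIdx_dual]
      exact ⟨rfl, by ring⟩
  an_cr_ne x y m hxy := by
    classical
    simp only [an, cr, LinearMap.smul_apply, map_smul]
    rw [R.comm, Coord.contr, if_neg]
    · simp only [Coord.degree_dual, jetDeg, smul_smul, zero_smul, add_zero,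
        neg_mul, sgn_neg]
      rw [mul_comm (Coord.pairing _ _)]
    · rw [Coord.dual_dual, Coord.zeroIdx_dual]
      rintro ⟨h1, h2⟩
      refine hxy (Prod.ext h1.symm ?_)
      rw [h1] at h2
      omega

lemma cr_mem (y : Coord ι × ℕ) {k : ℤ} {m : M} (hm : m ∈ R.gr k) :
    R.cr y m ∈ R.gr (jetDeg deg y + k) := R.op_mem _ _ _ _ hm

lemma an_mem (y : Coord ι × ℕ) {k : ℤ} {m : M} (hm : m ∈ R.gr k) :
    R.an y m ∈ R.gr (-jetDeg deg y + k) := by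
  rw [jetDeg, ← Coord.degree_dual]
  exact Submodule.smul_mem _ _ (R.op_mem _ _ _ _ hm)

/-- A mode contracts only with dual modes of opposite conformal weight, so zero modes supercommute
with the oscillators. Together with `an_zeroMode` this isolates the zero modes, which act on the
singular vectors. -/
lemma zeroMode_cr (g : Coord ι) (y : Coord ι × ℕ) (m : M) : R.zeroMode g (R.cr y m) =
    sgn (g.degree deg * jetDeg deg y) • R.cr y (R.zeroMode g m) := by
  classical
  rw [zeroMode, cr, R.comm, Coord.contr, if_neg]
  · simp [jetDeg]
  · rintro ⟨h1, h2⟩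
    rw [h1, Coord.zeroIdx_dual] at h2
    omega

lemma an_zeroMode (g : Coord ι) (y : Coord ι × ℕ) (m : M) : R.an y (R.zeroMode g m) =
    sgn (g.degree deg * jetDeg deg y) • R.zeroMode g (R.an y m) := by
  classical
  simp only [zeroMode, an, LinearMap.smul_apply, map_smul]
  rw [R.comm, Coord.contr, if_neg]
  · rw [zero_smul, add_zero, smul_comm, Coord.degree_dual, jetDeg, neg_mul, sgn_neg, mul_comm]
  · rintro ⟨h1, h2⟩
    rw [Coord.dual_dual] at h1
    rw [h1, Coord.zeroIdx_dual] at h2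
    omega

/-- The singular vectors. -/
abbrev sing : Submodule ℂ M := IsFock.vac R.an

lemma mem_sing {m : M} : m ∈ R.sing ↔ ∀ y, R.an y m = 0 := IsFock.mem_vac

lemma mem_sing_iff {m : M} : m ∈ R.sing ↔ ∀ g (n : ℤ), Coord.zeroIdx g < n → R.op g n m = 0 := by
  rw [mem_sing]
  constructor
  · intro h g n hn
    have := h (g.dual, (n - g.zeroIdx - 1).toNat)
    rw [an] at this
    simp only [Coord.dual_dual, LinearMap.smul_apply] at this
    rw [show g.zeroIdx + 1 + ((n - g.zeroIdx - 1).toNat : ℤ) = n by omega] at this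
    have h2 := congrArg (fun v => Coord.pairing deg g • v) this
    simpa [smul_smul, Coord.pairing_mul_self] using h2
  · intro h y
    rw [an, LinearMap.smul_apply, h _ _ (by omega), smul_zero]

lemma zeroMode_mem_sing (g : Coord ι) {m : M} (hm : m ∈ R.sing) : R.zeroMode g m ∈ R.sing := by
  rw [mem_sing] at hm ⊢
  intro y
  rw [an_zeroMode, hm, map_zero, smul_zero]

/-- The action of the coordinates on the singular vectors. -/
def singOp (g : Coord ι) : Module.End ℂ R.sing :=
  (R.zeroMode g).restrict fun _ hm => R.zeroMode_mem_sing g hm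

@[simp] lemma coe_singOp (g : Coord ι) (s : R.sing) : (R.singOp g s : M) = R.zeroMode g s := rfl

/-- The indices of dual zero modes add up to -1, which is where the contraction of dual coordinates
is nonzero. -/
lemma isRep_singOp : Weyl.IsRep deg R.singOp := by
  classical
  intro g h
  ext s
  change R.zeroMode g (R.zeroMode h s) = sgn _ • R.zeroMode h (R.zeroMode g s) +
    Weyl.contr deg g h • (s : M)
  rw [zeroMode, zeroMode, R.comm, Coord.contr, Weyl.contr]
  congr 2
  by_cases hh : h = g.dual
  · rw [if_pos hh, if_pos ⟨hh, by rw [hh, Coord.zeroIdx_dual]; ring⟩]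
  · rw [if_neg hh, if_neg fun e => hh e.1]

lemma gradeOp_mem_sing (χ : ℤ → ℂ) {m : M} (hm : m ∈ R.sing) :
    gradeOp R.isInternal χ m ∈ R.sing := by
  rw [mem_sing] at hm ⊢
  intro y
  have h := gradeOp_comm_of_map R.isInternal R.isInternal
    (fun k m hm => R.an_mem y (k := k) (m := m) hm) (fun k => χ (k + jetDeg deg y)) m
  rw [hm y, map_zero] at h
  rw [h]
  congr 2
  ext k
  ring_nf

lemma isInternal_sing : DirectSum.IsInternal fun k => (R.gr k).comap R.sing.subtype :=
  isInternal_submodule R.isInternal _ fun _ _ hm => R.gradeOp_mem_sing _ hm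

/-! ### Morphisms and derivations -/

variable {M' : Type*} [AddCommGroup M'] [Module ℂ M'] {R} {R' : HeisRep deg M'}

/-- All fields are normally ordered products of the coordinates, so commutation with the coordinates
up to sign propagates along words. Morphisms are the case ε = 0 and the part δ of the differential
is the case ε = 1. -/
lemma map_mode {f : M →ₗ[ℂ] M'} {ε : ℤ}
    (hf : ∀ g n m, f (R.op g n m) = sgn (ε * g.degree deg) • R'.op g n (f m)) {k : ℤ} {v : Jet deg}
    (hv : v ∈ homog (jetDeg deg) k) (n : ℤ) (m : M) :
    f (mode (R.act v) n m) = sgn (ε * k) • mode (R'.act v) n (f m) := by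
  induction hv using word_induction generalizing n m with
  | word l h =>
    subst h
    induction l generalizing n m with
    | nil =>
      simp only [List.map_nil, List.prod_nil, List.sum_nil, mode_act_one]
      split_ifs <;> simp [sgn]
    | cons x l ih =>
      have ha : (l.map (gen (jetDeg deg))).prod ∈ homog (jetDeg deg) (l.map (jetDeg deg)).sum :=
        Submodule.subset_span ⟨l, rfl, rfl⟩
      simp only [List.map_cons, List.prod_cons, List.sum_cons]
      obtain ⟨N₁, h₁⟩ := exists_trunc (R.act (l.map (gen (jetDeg deg))).prod) m
      obtain ⟨N₂, h₂⟩ := exists_trunc (R'.act (l.map (gen (jetDeg deg))).prod) (f m)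
      obtain ⟨N₃, h₃⟩ := R.trunc x.1 m
      obtain ⟨N₄, h₄⟩ := R'.trunc x.1 (f m)
      rw [R.isNormalOrder_act ha x.1 x.2 n m ((N₁ : ℤ) + N₂ - n).toNat (N₃.toNat + N₄.toNat)
          (fun j hj => h₁ _ (by omega)) (fun j hj => by rw [mode_field]; exact h₃ _ (by omega)),
        R'.isNormalOrder_act ha x.1 x.2 n (f m) ((N₁ : ℤ) + N₂ - n).toNat (N₃.toNat + N₄.toNat)
          (fun j hj => h₂ _ (by omega)) (fun j hj => by rw [mode_field]; exact h₄ _ (by omega))]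
      simp only [mode_field, map_add, map_sum, map_smul, hf, ih, smul_add, Finset.smul_sum,
        smul_smul, jetDeg, mul_add, sgn_add]
      congr 1 <;>
      · refine Finset.sum_congr rfl fun j _ => ?_
        congr 1
        ring
  | zero => simp [mode_zero]
  | add p q _ _ hp hq =>
    simp only [map_add, mode_add, LinearMap.add_apply, hp, hq, smul_add]
  | smul c p _ hp =>
    simp only [map_smul, mode_smul, LinearMap.smul_apply, hp, smul_comm c]

variable (R)

/-! ### The commutator formula -/

/-- The case r = 0 of the Borcherds identity, in which (z-w)^r contributes a single term to each
residue on the right. -/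
lemma commutator {α β : ℤ} {a b : Jet deg} (ha : a ∈ homog (jetDeg deg) α)
    (hb : b ∈ homog (jetDeg deg) β) (p q : ℤ) (m : M) :
    mode (R.act a) p (mode (R.act b) q m) =
      sgn (α * β) • mode (R.act b) q (mode (R.act a) p m) +
        ∑ᶠ j : ℕ, binom p j • mode (R.act (nprod deg a j b)) (p + q - j) m := by
  have h := R.resIter_act ha hb p q 0 m
  have h1 : resIter (fun t => R.act (nprod deg a t b)) p q 0 m =
      ∑ᶠ j : ℕ, binom p j • mode (R.act (nprod deg a j b)) (p + q - j) m := by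
    simp only [resIter, zero_add]
  have h2 : ∀ f : ℕ → M, ∑ᶠ j : ℕ, ((-1) ^ j * binom 0 j) • f j = f 0 := by
    intro f
    rw [finsum_eq_single _ 0]
    · simp [binom_zero_left]
    · intro j hj
      simp [binom_zero_left, hj]
  rw [h1, resLeft, resRight, h2, h2] at h
  rw [h]
  have h3 : sgn 0 = 1 := by simp [sgn]
  simp only [Nat.cast_zero, add_zero, sub_zero, h3, one_mul]
  abel

/-- For p = 0 only the product with j = 0 remains, so zero modes of fields act as superderivations.
-/
lemma commutator_zero {α β : ℤ} {a b : Jet deg} (ha : a ∈ homog (jetDeg deg) α)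
    (hb : b ∈ homog (jetDeg deg) β) (q : ℤ) (m : M) :
    mode (R.act a) 0 (mode (R.act b) q m) =
      mode (R.act (nprod deg a 0 b)) q m +
      sgn (α * β) • mode (R.act b) q (mode (R.act a) 0 m) := by
  rw [R.commutator ha hb, finsum_eq_single _ 0, add_comm]
  · simp [binom_zero_left]
  · intro j hj
    simp [binom_zero_left, hj]

/-- The modes of `a_{(-1)} b` on a vector killed by the modes `a_{(j)}`, `j ≥ 0`. -/
lemma mode_nprod_neg_one {α β : ℤ} {a b : Jet deg} (ha : a ∈ homog (jetDeg deg) α)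
    (hb : b ∈ homog (jetDeg deg) β) (n : ℤ) (m : M) (h : ∀ j : ℕ, mode (R.act a) j m = 0) (N : ℕ)
    (hN : ∀ j : ℕ, N ≤ j → mode (R.act b) (n + j) m = 0) :
    mode (R.act (nprod deg a (-1) b)) n m =
      ∑ j ∈ Finset.range N, mode (R.act a) (-1 - j) (mode (R.act b) (n + j) m) := by
  have h0 := R.resIter_act ha hb 0 n (-1) m
  have h1 : resIter (fun t => R.act (nprod deg a t b)) 0 n (-1) m =
      mode (R.act (nprod deg a (-1) b)) n m := by
    rw [resIter, finsum_eq_single _ 0]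
    · simp [binom_zero_left]
    · intro j hj
      simp [binom_zero_left, hj]
  have h2 : ∀ j : ℕ, (-1 : ℂ) ^ j * binom (-1) j = 1 := by
    intro j
    have := binom_neg 0 j
    simp only [Nat.cast_zero, neg_zero, zero_sub, zero_add, Nat.choose_zero_right, Nat.cast_one,
      mul_one] at this
    rw [this, ← mul_pow]
    simp
  rw [h1, resLeft_eq _ _ _ _ _ _ N hN, resRight_eq _ _ _ _ _ _ 0 (fun j _ => by simp [h])] at h0
  rw [h0]
  simp only [h2, one_smul, Finset.range_zero, Finset.sum_empty, smul_zero, sub_zero, zero_add]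

/-! ### The action of functions on singular vectors -/

lemma emb_mem {k : ℤ} {p : SuperPoly deg} (hp : p ∈ homog deg k) :
    emb deg p ∈ homog (jetDeg deg) k := by
  induction hp using word_induction with
  | word l h =>
    subst h
    induction l with
    | nil =>
      simp only [List.map_nil, List.prod_nil, List.sum_nil, map_one]
      exact one_mem_weightGr (jetDeg deg) (jetDeg deg)
    | cons x l ih =>
      simp only [List.map_cons, List.prod_cons, List.sum_cons, map_mul]
      have : emb deg (gen deg x) = gen (jetDeg deg) (Coord.fn x, 0) :=
        SuperPoly.lift_gen _ _ _
      rw [this]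
      exact gen_mul_mem (jetDeg deg) (Coord.fn x, 0) _ _ ih
  | zero => simp
  | add p q _ _ hp hq => rw [map_add]; exact add_mem hp hq
  | smul c p _ hp => rw [map_smul]; exact Submodule.smul_mem _ _ hp

variable [Fintype ι]

/-- The action of the differential operators on the singular vectors. -/
def singAct : diffOps deg →ₐ[ℂ] Module.End ℂ R.sing := Weyl.diffLift R.singOp R.isRep_singOp

@[simp] lemma singAct_coordOp (g : Coord ι) : R.singAct (Weyl.coordOp g) = R.singOp g :=
  Weyl.diffLift_coordOp _ _ _

/-- The modes x_{i(j)} with j ≥ 0 vanish on a singular vector. Hence all annihilation parts drop out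
of a normally ordered product of functions, and in the mode -1 only the product of the x_{i(-1)} is
left. -/
lemma mode_emb (p : SuperPoly deg) (s : R.sing) :
    (∀ n : ℤ, 0 ≤ n → mode (R.act (emb deg p)) n s = 0) ∧
      mode (R.act (emb deg p)) (-1) s = R.singAct (mulOp deg p) s := by
  induction p using gen_induction with
  | one =>
    have : mulOp deg 1 = 1 := by ext q; simp [mulOp]
    rw [map_one, this]
    refine ⟨fun n hn => ?_, ?_⟩
    · rw [mode_act_one, if_neg (by omega)]
    · rw [mode_act_one, if_pos rfl, map_one]; rfl
  | add p q hp hq =>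
    have : mulOp deg (p + q) = mulOp deg p + mulOp deg q := by ext r; simp [mulOp, add_mul]
    rw [map_add, map_add, this]
    simp only [mode_add, LinearMap.add_apply, map_add]
    refine ⟨fun n hn => ?_, ?_⟩
    · rw [hp.1 n hn, hq.1 n hn, add_zero]
    · rw [hp.2, hq.2]; rfl
  | smul c p hp =>
    have : mulOp deg (c • p) = c • mulOp deg p := by ext r; simp [mulOp]
    rw [map_smul, map_smul, this]
    simp only [mode_smul, LinearMap.smul_apply, map_smul]
    refine ⟨fun n hn => ?_, ?_⟩
    · rw [hp.1 n hn, smul_zero]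
    · rw [hp.2]; rfl
  | gen_mul i p hp =>
    have hx : emb deg (gen deg i) = jet deg (Coord.fn i) 0 := SuperPoly.lift_gen _ _ _
    have hm : mulOp deg (gen deg i * p) = Weyl.coordOp (Coord.fn i) * mulOp deg p := by
      ext q
      simp [mulOp, Weyl.coordOp]
    have hop : ∀ j : ℕ, R.op (Coord.fn i) j s = 0 := fun j =>
      R.mem_sing_iff.1 s.2 _ _ (by simp only [Coord.zeroIdx]; omega)
    rw [map_mul, hx, hm, act_gen_mul]
    refine ⟨fun n hn => ?_, ?_⟩
    · rw [R.mode_normalOrder _ _ _ _ _ 0 0 (fun j _ => hp.1 _ (by omega)) (fun j _ => hop j)]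
      simp
    · rw [R.mode_normalOrder _ _ _ _ _ 1 0 (fun j hj => hp.1 _ (by omega)) (fun j _ => hop j)]
      simp only [Finset.range_one, Finset.sum_singleton, Finset.range_zero, Finset.sum_empty,
        add_zero, Nat.choose_self, Nat.cast_one, one_smul, Nat.cast_zero, neg_zero, zero_sub,
        sub_zero, hp.2, map_mul, singAct_coordOp]
      rfl

end HeisRep

/-! ### The differential of the vertex algebra -/

namespace SuperPoly

variable {X : Type} (deg : X → ℤ)

open Classical in
/-- The evaluation at zero of the generators of nonzero weight. -/
def evalZero (w : X → ℤ) : SuperPoly deg →ₐ[ℂ] SuperPoly deg :=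
  lift (fun x => if w x = 0 then gen deg x else 0) fun x y => by
    split_ifs <;> simp [gen_mul_gen deg x y]

/-- The weighted Euler operator kills p, so p has weight zero. As the weights are nonnegative,
evaluating the generators of nonzero weight at zero is the projection to weight zero. -/
lemma evalZero_eq_self {w : X → ℤ} (hw : ∀ x, 0 ≤ w x) {p : SuperPoly deg}
    (hp : ∀ x, w x ≠ 0 → pderiv deg x p = 0) : evalZero deg w p = p := by
  classical
  have hgen : ∀ x, evalZero deg w (gen deg x) = if w x = 0 then gen deg x else 0 := fun x => by
    simp [evalZero]
  have h1 : euler deg w p = 0 := by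
    obtain ⟨F, hF⟩ := euler_eq_sum deg w p
    rw [hF F subset_rfl]
    refine Finset.sum_eq_zero fun x _ => ?_
    by_cases hx : w x = 0
    · simp [hx]
    · simp [hp x hx]
  have h2 : ∀ l : List X, 0 ≤ (l.map w).sum ∧ evalZero deg w (l.map (gen deg)).prod =
      if (l.map w).sum = 0 then (l.map (gen deg)).prod else 0 := by
    intro l
    induction l with
    | nil => simp
    | cons x l ih =>
      have := hw x
      simp only [List.map_cons, List.prod_cons, List.sum_cons, map_mul, ih.2, hgen]
      refine ⟨add_nonneg this ih.1, ?_⟩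
      by_cases hx : w x = 0
      · simp [hx]
      · rw [if_neg hx, zero_mul, if_neg (by have := ih.1; omega)]
  have h3 : ∀ k, ∀ q ∈ weightGr deg w k, evalZero deg w q = if k = 0 then q else 0 := by
    intro k q hq
    induction hq using Submodule.span_induction with
    | mem q hq =>
      obtain ⟨l, rfl, rfl⟩ := hq
      exact (h2 l).2
    | zero => simp
    | add p q _ _ hp hq => rw [map_add, hp, hq]; split_ifs <;> simp
    | smul c p _ hp => rw [map_smul, hp]; split_ifs <;> simp
  have h4 : p - evalZero deg w p =
      gradeOp (weightGr_isInternal deg w) (fun k => (k : ℂ)⁻¹) (euler deg w p) := by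
    refine LinearMap.congr_fun (f := LinearMap.id - (evalZero deg w).toLinearMap)
      (g := gradeOp (weightGr_isInternal deg w) (fun k => (k : ℂ)⁻¹) ∘ₗ euler deg w)
      (grade_hom_ext (weightGr_isInternal deg w) fun k q hq => ?_) p
    by_cases hk : k = 0
    · subst hk
      simp [euler, gradeOp_of_mem _ _ hq, h3 _ q hq]
    · simp [euler, gradeOp_of_mem _ _ hq, h3 _ q hq, hk]
  rw [h1, map_zero, sub_eq_zero] at h4
  exact h4.symm

lemma gen_mem (x : X) : gen deg x ∈ homog deg (deg x) := by
  simpa using gen_mul_mem deg x 0 1 (one_mem_weightGr deg deg)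

end SuperPoly

namespace Chiral

open SuperPoly HeisRep

variable {ι : Type} {deg : ι → ℤ}

/-- The creation axiom of vertex algebras, which holds because the annihilation modes of the
coordinates kill the vacuum. -/
lemma nprod_vacuum (a : Jet deg) :
    (∀ n : ℤ, 0 ≤ n → nprod deg a n 1 = 0) ∧ nprod deg a (-1) 1 = a := by
  have hop : ∀ (g : Coord ι) (j : ℕ), (vacuumRep deg).op g j 1 = 0 := fun g j => by
    change genMode deg g j 1 = 0
    rw [genMode_of_nonneg _ _ _ (by omega), pderiv_one, smul_zero]
  simp only [nprod, ← vacuumRep_act]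
  induction a using gen_induction with
  | one =>
    refine ⟨fun n hn => ?_, ?_⟩
    · rw [mode_act_one, if_neg (by omega)]
    · rw [mode_act_one, if_pos rfl]
  | add p q hp hq =>
    simp only [map_add, ChiralField.mode_add, LinearMap.add_apply]
    exact ⟨fun n hn => by rw [hp.1 n hn, hq.1 n hn, add_zero], by rw [hp.2, hq.2]⟩
  | smul c p hp =>
    simp only [map_smul, ChiralField.mode_smul, LinearMap.smul_apply]
    exact ⟨fun n hn => by rw [hp.1 n hn, smul_zero], by rw [hp.2]⟩
  | gen_mul x p hp =>
    rw [(vacuumRep deg).act_gen_mul x.1 x.2]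
    refine ⟨fun n hn => ?_, ?_⟩
    · rw [mode_normalOrder _ _ _ _ _ _ 0 0 (fun j _ => hp.1 _ (by omega)) (fun j _ => hop _ j)]
      simp
    · rw [mode_normalOrder _ _ _ _ _ _ 1 0 (fun j hj => hp.1 _ (by omega)) (fun j _ => hop _ j)]
      simp only [Finset.range_one, Finset.sum_singleton, Finset.range_zero, Finset.sum_empty,
        add_zero, Nat.choose_self, Nat.cast_one, one_smul, Nat.cast_zero, sub_zero, hp.2]
      change genMode deg x.1 (-x.2 - 1) p = _
      rw [genMode_of_neg _ _ _ (by omega), show (-(-(x.2 : ℤ) - 1) - 1).toNat = x.2 by omega]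

variable [Fintype ι] (P : PolyDGA deg)

/-- The element `∑ f_{i (-1)} ∂_{x_i}`. -/
def charge : Jet deg :=
  ∑ i, nprod deg (emb deg (P.d (gen deg i))) (-1) (jet deg (Coord.vf i) 0)

lemma dCh_eq (v : Jet deg) : dCh P v = nprod deg (charge P) 0 v := rfl

omit [Fintype ι] in
lemma jet_mem (g : Coord ι) (n : ℕ) : jet deg g n ∈ homog (jetDeg deg) (g.degree deg) :=
  gen_mem (jetDeg deg) (g, n)

lemma charge_mem : charge P ∈ homog (jetDeg deg) 1 := by
  refine Submodule.sum_mem _ fun i _ => ?_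
  have := nprod_mem (emb_mem (P.isSuperDerivation.map_homog _ _ (gen_mem deg i)))
    (jet_mem (Coord.vf i) 0) (-1)
  rwa [Coord.degree, show deg i + 1 + -deg i = 1 by ring] at this

end Chiral

/-! ### The zero mode of the charge -/

namespace HeisRep

open Chiral SuperPoly ChiralField

variable {ι : Type} [Fintype ι] {deg : ι → ℤ} {M : Type*} [AddCommGroup M] [Module ℂ M]
  (R : HeisRep deg M) (P : PolyDGA deg)

/-- The operator `(∑ f_{i (-1)} ∂_{x_i})_{(0)}`. -/
def chargeOp : Module.End ℂ M := mode (R.act (charge P)) 0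

lemma dOp_eq : P.dOp = ∑ i, mulOp deg (P.d (gen deg i)) * pderivOp deg i := by
  ext p
  simp only [AddSubmonoidClass.coe_finsetSum, LinearMap.sum_apply]
  exact Weyl.superDerivation_eq_sum P.isSuperDerivation p

/-- On a singular vector the n-th mode of f_{i(-1)} ∂_{x_i} is the sum of the f_{i(-1-j)}
∂_{x_i(n+j)}, and ∂_{x_i(k)} vanishes for k > 0. Only f_{i(-1)} ∂_{x_i(0)} remains, in the mode
zero, and ∂ = ∑ f_i ∂_{x_i} in 𝒟_P. -/
lemma mode_charge (s : R.sing) : (∀ n : ℤ, 0 < n → mode (R.act (charge P)) n s = 0) ∧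
    R.chargeOp P s = R.singAct P.dOp s := by
  have hop : ∀ i (n : ℤ), 0 < n → mode (R.act (jet deg (Coord.vf i) 0)) n s = 0 :=
    fun i n hn => by
      rw [mode_act_jet]
      exact R.mem_sing_iff.1 s.2 _ _ hn
  have h := fun i n N hN => R.mode_nprod_neg_one
    (emb_mem (P.isSuperDerivation.map_homog _ _ (gen_mem deg i))) (jet_mem (Coord.vf i) 0) n s
    (fun j => (R.mode_emb (P.d (gen deg i)) s).1 j (by omega)) N hN
  have hsum : ∀ n, mode (R.act (charge P)) n s = ∑ i, mode (R.act
      (nprod deg (emb deg (P.d (gen deg i))) (-1) (jet deg (Coord.vf i) 0))) n s := by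
    intro n
    simp [charge, mode]
  refine ⟨fun n hn => ?_, ?_⟩
  · rw [hsum]
    refine Finset.sum_eq_zero fun i _ => ?_
    rw [h i n 0 (fun j _ => hop i _ (by omega))]
    simp
  · rw [chargeOp, hsum, dOp_eq, map_sum, LinearMap.sum_apply, AddSubmonoidClass.coe_finsetSum]
    refine Finset.sum_congr rfl fun i _ => ?_
    rw [h i 0 1 (fun j hj => hop i _ (by omega))]
    have : pderivOp deg i = Weyl.coordOp (Coord.vf i) := rfl
    simp only [Finset.range_one, Finset.sum_singleton, Nat.cast_zero, sub_zero, add_zero,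
      mode_act_jet, map_mul, this, singAct_coordOp, Module.End.mul_apply]
    exact (R.mode_emb _ (R.singOp (Coord.vf i) s)).2

lemma chargeOp_mode {k : ℤ} {v : Jet deg} (hv : v ∈ homog (jetDeg deg) k) (n : ℤ) (m : M) :
    R.chargeOp P (mode (R.act v) n m) =
      mode (R.act (dCh P v)) n m + sgn k • mode (R.act v) n (R.chargeOp P m) := by
  rw [chargeOp, R.commutator_zero (charge_mem P) hv, one_mul, dCh_eq]

omit [Fintype ι] in
lemma dOp_dOp : P.dOp * P.dOp = 0 := by
  ext p
  exact P.d_d p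

lemma dCh_charge_mem : dCh P (charge P) ∈ homog (jetDeg deg) 2 := by
  have := nprod_mem (charge_mem P) (charge_mem P) 0
  rwa [show (1 : ℤ) + 1 = 2 by norm_num] at this

/-- These modes are the supercommutators of Q with the modes of the charge. On singular vectors the
modes with j > 0 vanish, and j = 0 gives 2 ∂², which is zero. -/
lemma mode_dCh_charge (s : R.sing) (j : ℕ) : mode (R.act (dCh P (charge P))) j s = 0 := by
  have h := R.chargeOp_mode P (charge_mem P) j s
  have hs1 : sgn 1 = -1 := by simp [sgn]
  have h0 := (R.mode_charge P s).2
  rw [eq_comm, ← eq_sub_iff_add_eq] at h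
  rw [h, hs1, h0]
  rcases Nat.eq_zero_or_pos j with rfl | hj
  · have h1 : ∀ s' : R.sing, mode (R.act (charge P)) ((0 : ℕ) : ℤ) s' = R.singAct P.dOp s' :=
      fun s' => (R.mode_charge P s').2
    rw [h1, h1, (R.mode_charge P _).2, ← Module.End.mul_apply, ← map_mul, dOp_dOp]
    simp
  · rw [(R.mode_charge P s).1 _ (by omega), (R.mode_charge P _).1 _ (by omega)]
    simp

variable {P} in
-- The vanishing of ∂² on singular vectors gives A_(j) x_i = 0 for j ≥ 0, where A is the element in
-- question. So A supercommutes with the modes of x_i, which means that A contains no jets of vector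
-- fields. Then it is a polynomial in jets of functions of degree ≤ 0, whereas A has degree 2.
lemma dCh_charge (hdeg : ∀ i, deg i ≤ 0) : dCh P (charge P) = 0 := by
  set A := dCh P (charge P) with hA
  have hA2 : A ∈ homog (jetDeg deg) 2 := dCh_charge_mem P
  let V := vacuumRep deg
  have h1 : (1 : Jet deg) ∈ V.sing := by
    rw [mem_sing_iff]
    intro g n hn
    change genMode deg g n 1 = 0
    rw [genMode_of_nonneg _ _ _ (by cases g <;> simp only [Coord.zeroIdx] at hn <;> omega),
      pderiv_one, smul_zero]
  have hx : ∀ i, jet deg (Coord.fn i) 0 ∈ V.sing := by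
    intro i
    have := V.zeroMode_mem_sing (Coord.fn i) h1
    have e : V.zeroMode (Coord.fn i) 1 = jet deg (Coord.fn i) 0 * 1 :=
      genMode_of_neg deg (Coord.fn i) (-1) (by norm_num) 1
    rwa [e, mul_one] at this
  have hcomm : ∀ i (q : ℤ), 0 ≤ q → genMode deg (Coord.fn i) q A = 0 := by
    intro i q hq
    -- Evaluated on the vacuum with first index -1, since A_(-1) 1 = A and x_{i(q)} 1 = 0 for q ≥ 0.
    have h2 := V.commutator hA2 (jet_mem (Coord.fn i) 0) (-1) q 1
    have h3 : ∀ j : ℕ, nprod deg A j (jet deg (Coord.fn i) 0) = 0 := by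
      intro j
      have := V.mode_dCh_charge P ⟨_, hx i⟩ j
      rwa [vacuumRep_act] at this
    rw [finsum_eq_zero_of_forall_eq_zero (fun j => by rw [h3, map_zero, mode_zero, smul_zero]),
      mode_act_jet] at h2
    have h4 : V.op (Coord.fn i) q 1 = 0 := V.mem_sing_iff.1 h1 _ _ (by
      simp only [Coord.zeroIdx]; omega)
    have h5 : mode (V.act A) (-1) 1 = A := by
      rw [vacuumRep_act]
      exact (nprod_vacuum A).2
    rw [h4, map_zero, h5, add_zero] at h2
    have h6 := congrArg (fun v => sgn (2 * (Coord.fn i).degree deg) • v) h2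
    simp only [smul_zero, smul_smul, sgn_mul_self, one_smul] at h6
    exact h6.symm
  -- The weight counts jets of vector fields. The operators x_{i(n)}, n ≥ 0, are up to a unit the
  -- derivatives along these jets, and they vanish on A.
  let w : Coord ι × ℕ → ℤ := fun y => match y.1 with
    | .fn _ => 0
    | .vf _ => 1
  have hA3 : evalZero (jetDeg deg) w A = A := by
    refine evalZero_eq_self _ (fun y => ?_) fun y hy => ?_
    · rcases y with ⟨_ | _, n⟩ <;> simp [w]
    · rcases y with ⟨i | i, n⟩
      · simp [w] at hy
      · have := hcomm i n (by omega)
        rw [genMode_of_nonneg _ _ _ (by omega)] at this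
        have h2 := congrArg (fun v => Coord.pairing deg (Coord.fn i) • v) this
        simpa [smul_smul, Coord.pairing_mul_self, Coord.dual] using h2
  -- A word without jets of vector fields has degree ≤ 0, since deg x_i ≤ 0.
  have hword : ∀ l : List (Coord ι × ℕ), evalZero (jetDeg deg) w (l.map (gen _)).prod = 0 ∨
      (l.map (jetDeg deg)).sum ≤ 0 := by
    intro l
    induction l with
    | nil => simp
    | cons y l ih =>
      simp only [List.map_cons, List.prod_cons, List.sum_cons, map_mul]
      rcases ih with h | h
      · simp [h]
      · rcases y with ⟨i | i, n⟩
        · right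
          have := hdeg i
          simp only [jetDeg, Coord.degree] at *
          omega
        · left
          have : evalZero (jetDeg deg) w (gen (jetDeg deg) (Coord.vf i, n)) = 0 := by
            simp [evalZero, w]
          rw [this, zero_mul]
  rw [← hA3]
  clear_value A
  clear hA hA3 hcomm
  induction hA2 using word_induction with
  | word l h =>
    rcases hword l with h' | h'
    · exact h'
    · omega
  | zero => simp
  | add p q _ _ hp hq => rw [map_add, hp, hq, add_zero]
  | smul c p _ hp => rw [map_smul, hp, smul_zero]

lemma chargeOp_mem {k : ℤ} {m : M} (hm : m ∈ R.gr k) : R.chargeOp P m ∈ R.gr (k + 1) := by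
  rw [add_comm]
  exact R.hasDegree_act (charge_mem P) _ _ _ hm

variable {P} in
-- The supercommutator of the odd operator Q with itself is 2 Q², and it is the zero mode of `dCh P
-- (charge P)`, which vanishes.
lemma chargeOp_chargeOp (hdeg : ∀ i, deg i ≤ 0) (m : M) : R.chargeOp P (R.chargeOp P m) = 0 := by
  have h := R.chargeOp_mode P (charge_mem P) 0 m
  have hs1 : sgn 1 = -1 := by simp [sgn]
  rw [dCh_charge hdeg, map_zero, mode_zero, zero_add, hs1] at h
  change R.chargeOp P (R.chargeOp P m) = (-1 : ℂ) • R.chargeOp P (R.chargeOp P m) at h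
  rw [neg_one_smul, eq_neg_iff_add_eq_zero, ← two_smul ℂ] at h
  exact (smul_eq_zero.1 h).resolve_left two_ne_zero

lemma chargeOp_mem_sing {m : M} (hm : m ∈ R.sing) : R.chargeOp P m ∈ R.sing := by
  rw [(R.mode_charge P ⟨m, hm⟩).2]
  exact Submodule.coe_mem _

omit [Fintype ι] in
/-- The Borcherds identity in the form used for dg modules. -/
lemma borcherds {k l : ℤ} {a b : Jet deg} (ha : a ∈ homog (jetDeg deg) k)
    (hb : b ∈ homog (jetDeg deg) l) (p q r : ℤ) (m : M) :
    ∑ᶠ j : ℕ, Ring.choose p j • mode (R.act (nprod deg a (r + j) b)) (p + q - j) m =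
      ∑ᶠ j : ℕ, ((-1) ^ j * Ring.choose r j) •
        (mode (R.act a) (p + r - j) (mode (R.act b) (q + j) m)
          - (sgn r * sgn (k * l)) • mode (R.act b) (q + r - j) (mode (R.act a) (p + j) m)) := by
  have h := R.resIter_act ha hb p q r m
  obtain ⟨N₁, h₁⟩ := exists_trunc (R.act b) m
  obtain ⟨N₂, h₂⟩ := exists_trunc (R.act a) m
  set N := (N₁ - q).toNat + (N₂ - p).toNat
  have v1 : ∀ j : ℕ, N ≤ j → mode (R.act b) (q + j) m = 0 := fun j hj => h₁ _ (by omega)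
  have v2 : ∀ j : ℕ, N ≤ j → mode (R.act a) (p + j) m = 0 := fun j hj => h₂ _ (by omega)
  rw [resLeft_eq _ _ _ _ _ _ N v1, resRight_eq _ _ _ _ _ _ N v2] at h
  rw [finsum_eq_range (f := fun j : ℕ => ((-1) ^ j * Ring.choose r j) •
        (mode (R.act a) (p + r - j) (mode (R.act b) (q + j) m)
          - (sgn r * sgn (k * l)) • mode (R.act b) (q + r - j) (mode (R.act a) (p + j) m))) N
      (fun j hj => by simp [v1 j hj, v2 j hj])]
  simp only [← Int.cast_smul_eq_zsmul ℂ]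
  refine (h.trans ?_)
  rw [Finset.smul_sum, ← Finset.sum_sub_distrib]
  refine Finset.sum_congr rfl fun j _ => ?_
  have : (((-1) ^ j * Ring.choose r j : ℤ) : ℂ) = (-1) ^ j * binom r j := by
    simp [binom]
  rw [this, smul_sub, smul_comm (sgn r * sgn (k * l))]

end HeisRep

/-! ### Modules over the vertex algebra -/

namespace HeisRep

open Chiral SuperPoly ChiralField

variable {ι : Type} {deg : ι → ℤ} {M : Type*} [AddCommGroup M] [Module ℂ M] (R : HeisRep deg M)
  {M' : Type*} [AddCommGroup M'] [Module ℂ M'] {R' : HeisRep deg M'}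

variable {R}

lemma map_an {f : M →ₗ[ℂ] M'} {ε : ℤ}
    (hf : ∀ g n m, f (R.op g n m) = sgn (ε * g.degree deg) • R'.op g n (f m))
    (y : Coord ι × ℕ) (m : M) : f (R.an y m) = sgn (ε * jetDeg deg y) • R'.an y (f m) := by
  simp only [an, LinearMap.smul_apply, map_smul, hf, Coord.degree_dual, mul_neg, sgn_neg]
  rw [smul_comm]
  rfl

lemma map_mem_sing {f : M →ₗ[ℂ] M'} {ε : ℤ}
    (hf : ∀ g n m, f (R.op g n m) = sgn (ε * g.degree deg) • R'.op g n (f m)) {m : M}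
    (hm : m ∈ R.sing) : f m ∈ R'.sing := by
  rw [mem_sing] at hm ⊢
  intro y
  have h := map_an hf y m
  rw [hm y, map_zero] at h
  have h2 := congrArg (fun v => sgn (ε * jetDeg deg y) • v) h
  simpa [smul_smul, sgn_mul_self] using h2.symm

/-- The restriction of a morphism to the singular vectors. -/
def mapSing (f : M →ₗ[ℂ] M') (ε : ℤ)
    (hf : ∀ g n m, f (R.op g n m) = sgn (ε * g.degree deg) • R'.op g n (f m)) :
    R.sing →ₗ[ℂ] R'.sing :=
  f.restrict fun _ hm => map_mem_sing hf hm

@[simp] lemma coe_mapSing (f : M →ₗ[ℂ] M') (ε : ℤ) (hf) (s : R.sing) :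
    (mapSing (R' := R') f ε hf s : M') = f s := rfl

lemma isHomogOp_coordOp (g : Coord ι) : IsHomogOp deg (g.degree deg) (Weyl.coordOp g) := by
  intro k p hp
  cases g with
  | fn i => exact gen_mul_mem deg i k p hp
  | vf i =>
    have := (isSuperDerivation_pderiv deg i).map_homog k p hp
    rwa [add_comm] at this

variable [Fintype ι]

/-- A homogeneous differential operator is a combination of words of its own degree in the
coordinates, so the sign can be collected letter by letter. -/
lemma mapSing_singAct {f : M →ₗ[ℂ] M'} {ε : ℤ}
    (hf : ∀ g n m, f (R.op g n m) = sgn (ε * g.degree deg) • R'.op g n (f m)) {k : ℤ}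
    {a : diffOps deg} (ha : IsHomogOp deg k a) (s : R.sing) :
    mapSing f ε hf (R.singAct a s) = sgn (ε * k) • R'.singAct a (mapSing f ε hf s) := by
  refine Weyl.homogOp_induction (C := fun k a => ∀ s, mapSing f ε hf (R.singAct a s) =
    sgn (ε * k) • R'.singAct a (mapSing f ε hf s)) ?_ ?_ ?_ ?_ ?_ ha s
  · intro s; simp [sgn]
  · intro k s; simp
  · intro k a b ha hb s; simp [ha, hb]
  · intro k c a ha s; simp [ha, smul_comm c]
  · intro g k a _ ih s
    have h : ∀ s, mapSing f ε hf (R.singOp g s) =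
        sgn (ε * g.degree deg) • R'.singOp g (mapSing f ε hf s) := fun s => by
      ext
      exact hf g _ s
    rw [map_mul, map_mul, singAct_coordOp, singAct_coordOp, Module.End.mul_apply, h, ih,
      Module.End.mul_apply, map_smul, smul_smul, mul_add, sgn_add]

lemma singAct_mem {k l : ℤ} {a : diffOps deg} (ha : IsHomogOp deg k a) {s : R.sing}
    (hs : (s : M) ∈ R.gr l) : (R.singAct a s : M) ∈ R.gr (k + l) := by
  refine Weyl.homogOp_induction (C := fun k a => ∀ l, ∀ s : R.sing, (s : M) ∈ R.gr l →
    (R.singAct a s : M) ∈ R.gr (k + l)) ?_ ?_ ?_ ?_ ?_ ha l s hs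
  · intro l s hs; simpa using hs
  · intro k l s hs; simp
  · intro k a b ha hb l s hs; simpa using add_mem (ha l s hs) (hb l s hs)
  · intro k c a ha l s hs; simpa using Submodule.smul_mem _ c (ha l s hs)
  · intro g k a _ ih l s hs
    rw [map_mul, singAct_coordOp, Module.End.mul_apply, add_assoc]
    exact R.op_mem _ _ _ _ (ih l s hs)

variable (R)

/-- The differential itself need not supercommute with the coordinates. But d = (d - Q) + Q, where
the first term does, and Q acts on singular vectors through ∂ in 𝒟_P. -/
lemma map_mem_sing_of_diff (P : PolyDGA deg) (d : Module.End ℂ M)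
    (hd : ∀ g n m, (d - R.chargeOp P) (R.op g n m) =
      sgn (1 * g.degree deg) • R.op g n ((d - R.chargeOp P) m)) {m : M} (hm : m ∈ R.sing) :
    d m ∈ R.sing := by
  have := add_mem (map_mem_sing hd hm) (R.chargeOp_mem_sing P hm)
  simpa using this

/-- On singular vectors d - ∂ supercommutes with 𝒟_P. Moving ∂ to the other side produces the
bracket [∂, a]. -/
lemma sing_leibniz (P : PolyDGA deg) (d : Module.End ℂ M)
    (hd : ∀ g n m, (d - R.chargeOp P) (R.op g n m) =
      sgn (1 * g.degree deg) • R.op g n ((d - R.chargeOp P) m)) {k : ℤ} {a : diffOps deg}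
    (ha : IsHomogOp deg k a) (s : R.sing) :
    (d.restrict fun _ hm => R.map_mem_sing_of_diff P d hd hm) (R.singAct a s) =
      R.singAct (P.dOp * a - sgn k • (a * P.dOp)) s +
        sgn k • R.singAct a ((d.restrict fun _ hm => R.map_mem_sing_of_diff P d hd hm) s) := by
  have h := mapSing_singAct hd ha s
  have h3 : ∀ s, mapSing (R' := R) (d - R.chargeOp P) 1 hd s =
      (d.restrict fun _ hm => R.map_mem_sing_of_diff P d hd hm) s - R.singAct P.dOp s := by
    intro s
    ext
    simp [(R.mode_charge P s).2]
  rw [h3, h3, sub_eq_iff_eq_add] at h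
  rw [h]
  have e : R.singAct (P.dOp * a - sgn k • (a * P.dOp)) =
      R.singAct P.dOp * R.singAct a - sgn k • (R.singAct a * R.singAct P.dOp) :=
    (map_sub R.singAct _ _).trans (by rw [map_smul, map_mul, map_mul])
  rw [e]
  simp only [map_sub, LinearMap.sub_apply, Module.End.mul_apply, LinearMap.smul_apply, smul_sub,
    one_mul]
  abel

/-- The dg module of singular vectors, for a differential `d` such that the difference of `d` and
the differential `∑ (f_{i (-1)} ∂_{x_i})_{(0)}` supercommutes with the coordinates. -/
def singModule {M : Type u} [AddCommGroup M] [Module ℂ M] (R : HeisRep deg M) (P : PolyDGA deg)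
    (d : Module.End ℂ M) (d_mem : ∀ k, ∀ m ∈ R.gr k, d m ∈ R.gr (k + 1)) (d_d : ∀ m, d (d m) = 0)
    (hd : ∀ g n m, (d - R.chargeOp P) (R.op g n m) =
      sgn (1 * g.degree deg) • R.op g n ((d - R.chargeOp P) m)) : DgDMod.{u} P where
  carrier := R.sing
  gr k := (R.gr k).comap R.sing.subtype
  isInternal := R.isInternal_sing
  act := R.singAct
  act_mem _ _ _ _ ha hs := R.singAct_mem ha hs
  d := d.restrict fun _ hm => R.map_mem_sing_of_diff P d hd hm
  d_mem k _ hs := d_mem k _ hs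
  d_d _ := Subtype.ext (d_d _)
  leibniz _ _ s ha := R.sing_leibniz P d hd ha s

/-- The dg module over the vertex algebra with the differential `∑ (f_{i (-1)} ∂_{x_i})_{(0)} + δ`,
where `δ` supercommutes with the coordinates. -/
def toDgChMod {M : Type u} [AddCommGroup M] [Module ℂ M] (R : HeisRep deg M) {P : PolyDGA deg}
    (hdeg : ∀ i, deg i ≤ 0) (δ : Module.End ℂ M)
    (δ_mem : ∀ k, ∀ m ∈ R.gr k, δ m ∈ R.gr (k + 1)) (δ_δ : ∀ m, δ (δ m) = 0)
    (hδ : ∀ g n m, δ (R.op g n m) = sgn (1 * g.degree deg) • R.op g n (δ m)) :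
    DgChMod.{u} P where
  carrier := M
  gr := R.gr
  isInternal := R.isInternal
  act := R.act
  act_vac := R.act_one
  borcherds _ _ _ ha _ hb := R.borcherds ha hb
  act_mem _ l _ hv n m hm := R.hasDegree_act hv n l m hm
  d := R.chargeOp P + δ
  d_mem k m hm := add_mem (R.chargeOp_mem P hm) (δ_mem k m hm)
  d_d m := by
    -- The charge has degree 1, so δ anticommutes with Q and the square of the sum is Q² + δ².
    have h := map_mode hδ (charge_mem P) 0 m
    have hs1 : sgn (1 * 1) = -1 := by simp [sgn]
    rw [hs1, neg_one_smul] at h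
    change δ (R.chargeOp P m) = -R.chargeOp P (δ m) at h
    simp only [LinearMap.add_apply, map_add, h, R.chargeOp_chargeOp hdeg, δ_δ]
    abel
  leibniz k v hv n m := by
    simp only [LinearMap.add_apply, map_add, R.chargeOp_mode P hv, map_mode hδ hv, one_mul,
      smul_add, add_assoc]

end HeisRep

/-! ### Modules over the vertex algebra as representations of the modes of the coordinates -/

namespace DgChMod

open Chiral SuperPoly ChiralField

variable {ι : Type} [Fintype ι] {deg : ι → ℤ} {P : PolyDGA deg} (M : DgChMod.{u} P)

/-- The operators `g_{(n)}` on a module. -/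
def heisRep : HeisRep deg M.carrier where
  gr := M.gr
  isInternal := M.isInternal
  op g n := mode (M.act (jet deg g 0)) n
  op_mem g n k m hm := M.act_mem _ _ _ (jet_mem g 0) n m hm
  trunc g m := by
    obtain ⟨N, hN⟩ := exists_trunc (M.act (jet deg g 0)) m
    exact ⟨N, hN⟩
  comm g h p q m := by
    classical
    -- With r = 0 this is the commutator formula. The products g_(j) h of coordinates are constants
    -- and vanish unless j = 0 and h is dual to g.
    have hb := M.borcherds _ _ _ (jet_mem g 0) _ (jet_mem h 0) p q 0 m
    have h1 : ∀ j : ℕ, nprod deg (jet deg g 0) (0 + j) (jet deg h 0) =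
        (if h = g.dual ∧ j = 0 then Coord.pairing deg g else 0) • 1 := by
      intro j
      rw [zero_add, HeisRep.nprod_jet, genMode_of_nonneg _ _ _ (by omega), pderiv_gen]
      by_cases hh : h = g.dual ∧ j = 0
      · rw [if_pos (by rw [hh.1, hh.2]; rfl), if_pos hh]
      · rw [if_neg, if_neg hh, smul_zero, zero_smul]
        rintro e
        rw [Prod.mk.injEq] at e
        exact hh ⟨e.1, by have := e.2; omega⟩
    have h2 : ∑ᶠ j : ℕ, Ring.choose p j •
        mode (M.act (nprod deg (jet deg g 0) (0 + j) (jet deg h 0))) (p + q - j) m =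
        Coord.contr deg g h p q • m := by
      rw [finsum_eq_single _ 0]
      · rw [h1, map_smul, M.act_vac, mode_smul, LinearMap.smul_apply, HeisRep.mode_idField,
          Ring.choose_zero_right, one_smul, Coord.contr]
        by_cases hh : h = g.dual <;> by_cases hpq : p + q = -1 <;> simp [hh, hpq]
      · intro j hj
        rw [h1, if_neg fun e => hj e.2, zero_smul, map_zero, HeisRep.mode_zero, smul_zero]
    have h3 : sgn 0 = 1 := by simp [sgn]
    rw [h2, finsum_eq_single _ 0] at hb
    · simp only [pow_zero, Ring.choose_zero_right, one_mul, one_smul, Nat.cast_zero, add_zero,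
        sub_zero, h3] at hb
      rw [hb]
      abel
    · intro j hj
      have : Ring.choose (0 : ℤ) j = 0 := by
        rw [Ring.choose_zero_ite, if_neg hj]
      rw [this, mul_zero, zero_smul]

/-- With p = 0 and r = -n-1 the Borcherds identity writes the field of g^{(n)} a = g_(-n-1) a as the
normally ordered product of (1/n!) ∂^n g(z) with the field of a. Hence the modes of the coordinates
determine the whole module structure. -/
lemma heisRep_act : M.heisRep.act = M.act := by
  have key : ∀ k, ∀ v ∈ homog (jetDeg deg) k, ∀ n m,
      mode (M.heisRep.act v) n m = mode (M.act v) n m := by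
    intro k v hv
    induction hv using word_induction with
    | word l h =>
      subst h
      induction l with
      | nil =>
        intro n m
        rw [List.map_nil, List.prod_nil, M.heisRep.act_one, M.act_vac]
      | cons x l ih =>
        intro k m
        have ha : (l.map (gen (jetDeg deg))).prod ∈ homog (jetDeg deg) (l.map (jetDeg deg)).sum :=
          Submodule.subset_span ⟨l, rfl, rfl⟩
        simp only [List.map_cons, List.prod_cons]
        set a := (l.map (gen (jetDeg deg))).prod
        obtain ⟨g, n⟩ := x
        obtain ⟨N₁, h₁⟩ := exists_trunc (M.act a) m
        obtain ⟨N₂, h₂⟩ := M.heisRep.trunc g m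
        have hb := M.borcherds _ _ _ (jet_mem g 0) a ha 0 k (-n - 1) m
        have hv1 : ∀ j : ℕ, (N₁ - k).toNat + N₂.toNat ≤ j → mode (M.act a) (k + j) m = 0 :=
          fun j hj => h₁ _ (by omega)
        have hv2 : ∀ j : ℕ, (N₁ - k).toNat + N₂.toNat ≤ j →
            mode (M.act (jet deg g 0)) (0 + j) m = 0 := fun j hj => h₂ _ (by omega)
        have hg : nprod deg (jet deg g 0) (-n - 1) a = jet deg g n * a := by
          rw [HeisRep.nprod_jet, genMode_of_neg _ _ _ (by omega),
            show (-(-(n : ℤ) - 1) - 1).toNat = n by omega]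
        have hL : ∑ᶠ j : ℕ, Ring.choose (0 : ℤ) j •
            mode (M.act (nprod deg (jet deg g 0) (-n - 1 + j) a)) (0 + k - j) m =
            mode (M.act (jet deg g n * a)) k m := by
          rw [finsum_eq_single _ 0]
          · simp [hg]
          · intro j hj
            have : Ring.choose (0 : ℤ) j = 0 := by
              rw [Ring.choose_zero_ite, if_neg hj]
            rw [this, zero_smul]
        rw [hL, finsum_eq_range ((N₁ - k).toNat + N₂.toNat)
          (fun j hj => by rw [hv1 j hj, hv2 j hj]; simp)] at hb
        rw [hb, M.heisRep.isNormalOrder_act ha g n k m ((N₁ - k).toNat + N₂.toNat)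
          ((N₁ - k).toNat + N₂.toNat) (fun j hj => by rw [ih, hv1 j hj])
          (fun j hj => by rw [HeisRep.mode_field]; have := hv2 j hj; rwa [zero_add] at this),
          ← Finset.sum_add_distrib]
        refine Finset.sum_congr rfl fun j _ => ?_
        have hc : (((-1) ^ j * Ring.choose (-n - 1 : ℤ) j : ℤ) : ℂ) = ((n + j).choose n : ℂ) := by
          have := binom_neg n j
          rw [binom] at this
          push_cast
          rw [this, ← mul_assoc, ← mul_pow]
          simp
        have hs : sgn (-n - 1) = -(-1) ^ n := by
          rw [show (-(n : ℤ) - 1) = -(n + 1) by ring, sgn_neg, sgn_add]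
          simp [sgn]
        rw [← Int.cast_smul_eq_zsmul ℂ, hc, hs]
        simp only [HeisRep.mode_field, ih]
        change _ • mode (M.act (jet deg g 0)) _ _ + _ • mode (M.act a) _
          (mode (M.act (jet deg g 0)) _ _) = _
        rw [smul_sub, smul_smul, sub_eq_add_neg (_ • _ : M.carrier), ← neg_smul, zero_add, zero_add]
        congr 2
        · ring
        · ring_nf
    | zero => intro n m; simp [HeisRep.mode_zero]
    | add p q _ _ hp hq =>
      intro n m
      simp only [map_add, mode_add, LinearMap.add_apply, hp, hq]
    | smul c p _ hp =>
      intro n m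
      simp only [map_smul, mode_smul, LinearMap.smul_apply, hp]
  exact grade_hom_ext (homog_isInternal _) fun k v hv => ext_modes (key k v hv)

/-- The difference of the differential and `∑ (f_{i (-1)} ∂_{x_i})_{(0)}`. -/
def diff : Module.End ℂ M.carrier := M.d - M.heisRep.chargeOp P

/-- The differential d and Q satisfy Leibniz rules with the same inhomogeneous term, the action of
`dCh P`, which cancels in the difference. -/
lemma diff_op (g : Coord ι) (n : ℤ) (m : M.carrier) : M.diff (M.heisRep.op g n m) =
    sgn (1 * g.degree deg) • M.heisRep.op g n (M.diff m) := by
  have h1 := M.leibniz _ _ (jet_mem g 0) n m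
  have h2 := M.heisRep.chargeOp_mode P (jet_mem g 0) n m
  rw [heisRep_act] at h2
  rw [diff, LinearMap.sub_apply]
  change M.d (mode (M.act (jet deg g 0)) n m) -
    M.heisRep.chargeOp P (mode (M.act (jet deg g 0)) n m) = _ • mode (M.act (jet deg g 0)) n _
  rw [h1, h2, LinearMap.sub_apply, map_sub, one_mul, smul_sub]
  abel

/-- The dg `𝒟_P`-module of singular vectors. -/
def singDgDMod : DgDMod.{u} P := M.heisRep.singModule P M.d M.d_mem M.d_d M.diff_op

lemma sing_eq : M.sing = M.heisRep.sing := by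
  ext m
  rw [HeisRep.mem_sing_iff]
  simp only [sing, Submodule.mem_iInf, Submodule.mem_inf, LinearMap.mem_ker, Subtype.forall]
  constructor
  · intro h g n hn
    cases g with
    | fn i =>
      have := (h i (n + 1) (by simp only [Coord.zeroIdx] at hn; omega)).1
      rwa [add_sub_cancel_right] at this
    | vf i => exact (h i n hn).2
  · intro h i n hn
    exact ⟨h (.fn i) (n - 1) (by simp only [Coord.zeroIdx]; omega), h (.vf i) n hn⟩

lemma isSingModule : M.IsSingModule M.singDgDMod (LinearEquiv.ofEq _ _ M.sing_eq.symm) where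
  gr _ _ := Iff.rfl
  act_x i n := by
    have := M.heisRep.singAct_coordOp (.fn i)
    exact congrArg Subtype.val (LinearMap.congr_fun this n)
  act_vf i n := by
    have := M.heisRep.singAct_coordOp (.vf i)
    exact congrArg Subtype.val (LinearMap.congr_fun this n)
  d _ := rfl

variable {M} {M' : DgChMod.{u} P}

lemma Hom.map_op (f : Hom M M') (g : Coord ι) (n : ℤ) (m : M.carrier) :
    f.toLin (M.heisRep.op g n m) = sgn (0 * g.degree deg) • M'.heisRep.op g n (f.toLin m) := by
  have : sgn (0 * g.degree deg) = 1 := by simp [sgn]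
  rw [this, one_smul]
  exact f.map_act _ _ _

/-- The restriction of a morphism to the singular vectors. -/
def Hom.sing (f : Hom M M') : DgDMod.Hom M.singDgDMod M'.singDgDMod where
  toLin := HeisRep.mapSing f.toLin 0 f.map_op
  map_gr k m hm := f.map_gr k _ hm
  map_act a s := by
    refine Weyl.diffOps_induction (C := fun a => ∀ s,
      HeisRep.mapSing f.toLin 0 f.map_op (M.heisRep.singAct a s) =
        M'.heisRep.singAct a (HeisRep.mapSing f.toLin 0 f.map_op s)) ?_ ?_ ?_ ?_ a s
    · intro s; simp
    · intro a b ha hb s; simp [ha, hb]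
    · intro c a ha s; simp [ha]
    · intro g a ha s
      rw [map_mul, map_mul, Module.End.mul_apply, Module.End.mul_apply, ← ha,
        HeisRep.mapSing_singAct f.map_op (HeisRep.isHomogOp_coordOp g)]
      simp [sgn]
  map_d s := Subtype.ext (f.map_d _)

variable (P) in
/-- The functor of singular vectors. -/
def singFunctor : Bounded.{u} P ⥤ DgDMod.{u} P where
  obj M := M.obj.singDgDMod
  map f := Hom.sing f.hom
  map_id _ := rfl
  map_comp _ _ := rfl

end DgChMod

/-! ### Bounded modules are generated by singular vectors -/

namespace IsFock

variable {X : Type} {deg : X → ℤ} {M : Type*} [AddCommGroup M] [Module ℂ M]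
  {cr an : X → Module.End ℂ M} (h : IsFock deg cr an)
  {M' : Type*} [AddCommGroup M'] [Module ℂ M'] {cr' an' : X → Module.End ℂ M'}
  (h' : IsFock deg cr' an')

include h h' in
-- T is only semilinear over the polynomials, by way of φ. Taking φ to be a sign twist covers the
-- zero modes and δ, and taking it to be a rescaling covers the dilation.
lemma map_lift {T : M →ₗ[ℂ] M'} {φ : SuperPoly deg →ₐ[ℂ] SuperPoly deg}
    (hT : ∀ y m, T (cr y m) = SuperPoly.lift cr' h'.cr_cr (φ (SuperPoly.gen deg y)) (T m))
    (p : SuperPoly deg) (m : M) :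
    T (SuperPoly.lift cr h.cr_cr p m) = SuperPoly.lift cr' h'.cr_cr (φ p) (T m) := by
  induction p using SuperPoly.gen_induction with
  | one => simp
  | add p q hp hq => simp [hp, hq]
  | smul c p hp => simp [hp]
  | gen_mul x p hp => simp [hT, hp]

lemma map_fockMap {T : M →ₗ[ℂ] M'} {φ : SuperPoly deg →ₐ[ℂ] SuperPoly deg}
    (hT : ∀ y m, T (cr y m) = SuperPoly.lift cr' h'.cr_cr (φ (SuperPoly.gen deg y)) (T m))
    {S : vac an →ₗ[ℂ] vac an'} (hS : ∀ s, (S s : M') = T s) (t : SuperPoly deg ⊗[ℂ] vac an) :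
    T (h.fockMap t) = h'.fockMap (TensorProduct.map φ.toLinearMap S t) := by
  induction t with
  | zero => simp
  | add s t hs ht => simp [hs, ht]
  | tmul p m => simp [h.map_lift h' hT, hS]

end IsFock

namespace HeisRep

open Chiral SuperPoly ChiralField

variable {ι : Type} {deg : ι → ℤ} {M : Type*} [AddCommGroup M] [Module ℂ M] (R : HeisRep deg M)

lemma op_eq_an (g : Coord ι) (k : ℕ) :
    R.op g (g.zeroIdx + 1 + k) = Coord.pairing deg g • R.an (g.dual, k) := by
  rw [an, smul_smul]
  simp only [Coord.dual_dual, Coord.pairing_mul_self, one_smul]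

lemma pow_an_eq_zero_iff (y : Coord ι × ℕ) (N : ℕ) (m : M) : (R.an y ^ N) m = 0 ↔
    (R.op y.1.dual (y.1.dual.zeroIdx + 1 + y.2) ^ N) m = 0 := by
  have : Coord.pairing deg y.1.dual ≠ 0 := fun h => by
    have := Coord.pairing_mul_self deg y.1.dual
    simp [h] at this
  rw [an, smul_pow, LinearMap.smul_apply, smul_eq_zero_iff_right (pow_ne_zero _ this)]

/-- Local truncation and the finiteness of ι leave finitely many annihilation operators that act
nontrivially on m. With the nilpotency of each of them this bounds the length of the words that do
not kill m. -/
lemma fockMap_bijective [Fintype ι] (h : ∀ m, ∃ N, ∀ y, (R.an y ^ N) m = 0) :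
    Function.Bijective R.isFock.fockMap := by
  classical
  refine ⟨R.isFock.fockMap_injective, fun m => ?_⟩
  obtain ⟨N, hN⟩ := h m
  choose K hK using fun g : Coord ι => R.trunc g.dual m
  let F : Finset (Coord ι × ℕ) := Finset.univ.biUnion fun i : ι =>
    ((Finset.range ((K (.fn i)).toNat + 1)).image fun k => (Coord.fn i, k)) ∪
      ((Finset.range ((K (.vf i)).toNat + 1)).image fun k => (Coord.vf i, k))
  have hF : ∀ y, y ∉ F → R.an y m = 0 := by
    rintro ⟨g, k⟩ hy
    have hk : (K g).toNat + 1 ≤ k := by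
      by_contra hk
      refine hy (Finset.mem_biUnion.2 ?_)
      cases g with
      | fn i => exact ⟨i, Finset.mem_univ _, Finset.mem_union_left _
          (Finset.mem_image_of_mem _ (Finset.mem_range.2 (by omega)))⟩
      | vf i => exact ⟨i, Finset.mem_univ _, Finset.mem_union_right _
          (Finset.mem_image_of_mem _ (Finset.mem_range.2 (by omega)))⟩
    rw [an, LinearMap.smul_apply, hK, smul_zero]
    cases g <;> simp only [Coord.zeroIdx, Coord.dual] <;> omega
  obtain ⟨n, hn⟩ := KilledByWords.of_pow (fun x y m => R.isFock.an_an x y m)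
    (Finsupp.indicator F fun _ _ => N) (m := m) fun y => by
      by_cases hy : y ∈ F
      · rw [Finsupp.indicator_of_mem hy, pow_succ', Module.End.mul_apply, hN, map_zero]
      · rw [Finsupp.indicator_of_notMem hy, zero_add, pow_one, hF y hy]
  exact R.isFock.mem_range_fockMap F hn hF

lemma zeroMode_lift_gen (g : Coord ι) (y : Coord ι × ℕ) (m : M) : R.zeroMode g (R.cr y m) =
    SuperPoly.lift R.cr R.isFock.cr_cr (twist (jetDeg deg) (g.degree deg) (gen _ y))
      (R.zeroMode g m) := by
  rw [zeroMode_cr, twist_gen, map_smul, lift_gen, LinearMap.smul_apply]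

/-- The grading operator, which acts on the component of degree `k` as `2 ^ k`. -/
def dil : Module.End ℂ M := gradeOp R.isInternal fun k => 2 ^ k

lemma dil_of_mem {k : ℤ} {m : M} (hm : m ∈ R.gr k) : R.dil m = (2 : ℂ) ^ k • m :=
  gradeOp_of_mem _ _ hm

lemma mem_of_dil {k : ℤ} {m : M} (hm : R.dil m = (2 : ℂ) ^ k • m) : m ∈ R.gr k :=
  mem_of_eigen R.dil (fun _ _ h => R.dil_of_mem h)
    (fun _ => R.isInternal.submodule_iSup_eq_top ▸ Submodule.mem_top) hm

lemma dil_lift_gen (y : Coord ι × ℕ) (m : M) : R.dil (R.cr y m) =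
    SuperPoly.lift R.cr R.isFock.cr_cr (scale (jetDeg deg) (jetDeg deg) (gen _ y)) (R.dil m) := by
  rw [dil, gradeOp_comm_of_map R.isInternal R.isInternal (fun k m hm => R.cr_mem y hm)]
  simp only [scale, lift_gen, map_smul, LinearMap.smul_apply]
  rw [← map_smul]
  congr 1
  refine LinearMap.congr_fun (g := (2 : ℂ) ^ jetDeg deg y • gradeOp R.isInternal fun k => 2 ^ k)
    (grade_hom_ext R.isInternal fun k m hm => ?_) m
  rw [LinearMap.smul_apply, gradeOp_of_mem _ _ hm, gradeOp_of_mem _ _ hm, smul_smul,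
    zpow_add₀ two_ne_zero]

end HeisRep

/-! ### Full faithfulness of the functor of singular vectors -/

namespace DgChMod

open Chiral SuperPoly ChiralField

variable {ι : Type} [Fintype ι] {deg : ι → ℤ} {P : PolyDGA deg}

lemma isBounded_iff (M : DgChMod.{u} P) :
    IsBounded M ↔ ∀ m, ∃ N, 0 < N ∧ ∀ y, (M.heisRep.an y ^ N) m = 0 := by
  refine forall_congr' fun m => exists_congr fun N => and_congr_right fun _ => ?_
  simp only [HeisRep.pow_an_eq_zero_iff]
  constructor
  · rintro h ⟨i | i, k⟩
    · have := (h i (k + 1) (by omega)).2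
      simp only [Coord.dual, Coord.zeroIdx]
      rwa [zero_add, add_comm]
    · have := (h i (k + 1) (by omega)).1
      simp only [Coord.dual, Coord.zeroIdx]
      rwa [neg_add_cancel, zero_add, ← add_sub_cancel_right (k : ℤ) 1]
  · intro h i n hn
    constructor
    · have := h (.vf i, (n - 1).toNat)
      simp only [Coord.dual, Coord.zeroIdx] at this
      rwa [show (-1 : ℤ) + 1 + ((n - 1).toNat : ℤ) = n - 1 by omega] at this
    · have := h (.fn i, (n - 1).toNat)
      simp only [Coord.dual, Coord.zeroIdx] at this
      rwa [show (0 : ℤ) + 1 + ((n - 1).toNat : ℤ) = n by omega] at this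

/-- A bounded module is a Fock space over its singular vectors. -/
def fockEquiv (M : DgChMod.{u} P) (hM : IsBounded M) :
    Jet deg ⊗[ℂ] M.heisRep.sing ≃ₗ[ℂ] M.carrier :=
  LinearEquiv.ofBijective M.heisRep.isFock.fockMap
    (M.heisRep.fockMap_bijective fun m => by
      obtain ⟨N, _, hN⟩ := M.isBounded_iff.1 hM m
      exact ⟨N, hN⟩)

lemma fockEquiv_apply (M : DgChMod.{u} P) (hM : IsBounded M)
    (t : Jet deg ⊗[ℂ] M.heisRep.sing) : M.fockEquiv hM t = M.heisRep.isFock.fockMap t := rfl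

section extend

variable {M M' : DgChMod.{u} P} (hM : IsBounded M)
  (g : DgDMod.Hom M.singDgDMod M'.singDgDMod)

/-- The underlying map of a morphism of singular vectors. -/
def singLin : M.heisRep.sing →ₗ[ℂ] M'.heisRep.sing := g.toLin

/-- The extension to a bounded module of a map of singular vectors. -/
def extend : M.carrier →ₗ[ℂ] M'.carrier :=
  M'.heisRep.isFock.fockMap ∘ₗ (singLin g).lTensor _ ∘ₗ (M.fockEquiv hM).symm.toLinearMap

lemma extend_fockMap (t : Jet deg ⊗[ℂ] M.heisRep.sing) :
    extend hM g (M.heisRep.isFock.fockMap t) =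
      M'.heisRep.isFock.fockMap ((singLin g).lTensor _ t) := by
  rw [← fockEquiv_apply M hM, extend, LinearMap.comp_apply, LinearMap.comp_apply,
    LinearEquiv.coe_coe, LinearEquiv.symm_apply_apply]

lemma extend_sing (s : M.heisRep.sing) : extend hM g s = singLin g s := by
  have := extend_fockMap hM g (1 ⊗ₜ s)
  simpa using this

/-- Operators that are semilinear over the creation operators with the same φ are φ ⊗ (restriction
to the singular vectors) on both Fock spaces, while the extension is id ⊗ g. Compatibility thus
reduces to singular vectors. -/
lemma extend_comm {T : Module.End ℂ M.carrier} {T' : Module.End ℂ M'.carrier}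
    {φ : Jet deg →ₐ[ℂ] Jet deg}
    (hT : ∀ y m, T (M.heisRep.cr y m) =
      SuperPoly.lift _ M.heisRep.isFock.cr_cr (φ (gen _ y)) (T m))
    (hT' : ∀ y m, T' (M'.heisRep.cr y m) =
      SuperPoly.lift _ M'.heisRep.isFock.cr_cr (φ (gen _ y)) (T' m))
    (hS : ∀ s ∈ M.heisRep.sing, T s ∈ M.heisRep.sing)
    (hS' : ∀ s ∈ M'.heisRep.sing, T' s ∈ M'.heisRep.sing)
    (hg : ∀ s : M.heisRep.sing, (singLin g ⟨T s, hS s s.2⟩ : M'.carrier) = T' (singLin g s))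
    (m : M.carrier) : extend hM g (T m) = T' (extend hM g m) := by
  obtain ⟨t, rfl⟩ := (M.fockEquiv hM).surjective m
  rw [fockEquiv_apply, M.heisRep.isFock.map_fockMap M.heisRep.isFock hT
      (S := T.restrict hS) (fun s => rfl), extend_fockMap, extend_fockMap,
    M'.heisRep.isFock.map_fockMap M'.heisRep.isFock hT' (S := T'.restrict hS') (fun s => rfl)]
  congr 1
  induction t with
  | zero => simp
  | add s t hs ht => simp only [map_add, hs, ht]
  | tmul p s =>
    simp only [TensorProduct.map_tmul, LinearMap.lTensor_tmul]
    congr 1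
    exact Subtype.ext (hg s)

lemma extend_op (c : Coord ι) (n : ℤ) (m : M.carrier) :
    extend hM g (M.heisRep.op c n m) = M'.heisRep.op c n (extend hM g m) := by
  have hcr : ∀ y m, extend hM g (M.heisRep.cr y m) = M'.heisRep.cr y (extend hM g m) := by
    intro y m
    obtain ⟨t, rfl⟩ := (M.fockEquiv hM).surjective m
    rw [fockEquiv_apply, IsFock.cr_fockMap, extend_fockMap, extend_fockMap, IsFock.cr_fockMap]
    congr 1
    rw [← LinearMap.comp_apply, ← LinearMap.comp_apply, LinearMap.lTensor_comp_rTensor,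
      LinearMap.rTensor_comp_lTensor]
  have han : ∀ y m, extend hM g (M.heisRep.an y m) = M'.heisRep.an y (extend hM g m) := by
    intro y m
    obtain ⟨t, rfl⟩ := (M.fockEquiv hM).surjective m
    rw [fockEquiv_apply, IsFock.an_fockMap, extend_fockMap, extend_fockMap, IsFock.an_fockMap]
    congr 1
    rw [← LinearMap.comp_apply, ← LinearMap.comp_apply, LinearMap.lTensor_comp_rTensor,
      LinearMap.rTensor_comp_lTensor]
  rcases lt_trichotomy n c.zeroIdx with h | rfl | h
  · have e : n = c.zeroIdx - 1 - (c.zeroIdx - 1 - n).toNat := by omega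
    rw [e]
    exact hcr (c, _) m
  -- On singular vectors the zero modes are the action of the coordinates of 𝒟_P, with which g
  -- commutes.
  · refine extend_comm hM g (M.heisRep.zeroMode_lift_gen c) (M'.heisRep.zeroMode_lift_gen c)
      (fun s hs => M.heisRep.zeroMode_mem_sing c hs)
      (fun s hs => M'.heisRep.zeroMode_mem_sing c hs) (fun s => ?_) m
    have h1 := congrArg Subtype.val (g.map_act (Weyl.coordOp c) s)
    have h2 : M.singDgDMod.act (Weyl.coordOp c) = M.heisRep.singOp c :=
      M.heisRep.singAct_coordOp c
    have h3 : M'.singDgDMod.act (Weyl.coordOp c) = M'.heisRep.singOp c :=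
      M'.heisRep.singAct_coordOp c
    rw [h2, h3] at h1
    exact h1
  · have e : n = c.zeroIdx + 1 + (n - c.zeroIdx - 1).toNat := by omega
    rw [e, HeisRep.op_eq_an, HeisRep.op_eq_an, LinearMap.smul_apply, LinearMap.smul_apply,
      map_smul, han]

/-- Degrees are tested with the dilation, which is semilinear over the creation operators and
commutes with g on singular vectors. -/
lemma extend_mem {k : ℤ} {m : M.carrier} (hm : m ∈ M.gr k) : extend hM g m ∈ M'.gr k := by
  have h : extend hM g (M.heisRep.dil m) = M'.heisRep.dil (extend hM g m) := by
    refine extend_comm hM g M.heisRep.dil_lift_gen M'.heisRep.dil_lift_gen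
      (fun s hs => M.heisRep.gradeOp_mem_sing _ hs)
      (fun s hs => M'.heisRep.gradeOp_mem_sing _ hs) (fun s => ?_) m
    refine LinearMap.congr_fun (f := M'.heisRep.sing.subtype ∘ₗ singLin g ∘ₗ
        M.heisRep.dil.restrict fun s hs => M.heisRep.gradeOp_mem_sing _ hs)
      (g := M'.heisRep.dil ∘ₗ M'.heisRep.sing.subtype ∘ₗ singLin g)
      (grade_hom_ext M.heisRep.isInternal_sing fun k s hs => ?_) s
    have h1 : (M.heisRep.dil.restrict fun s hs => M.heisRep.gradeOp_mem_sing _ hs) s =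
        (2 : ℂ) ^ k • s := Subtype.ext (M.heisRep.dil_of_mem hs)
    have h2 : (singLin g s : M'.carrier) ∈ M'.heisRep.gr k := g.map_gr k s hs
    simp only [LinearMap.comp_apply, h1, map_smul, Submodule.subtype_apply,
      M'.heisRep.dil_of_mem h2]
  have h2 := M.heisRep.dil_of_mem (k := k) hm
  rw [h2, map_smul] at h
  exact M'.heisRep.mem_of_dil h.symm

lemma extend_mode (v : Jet deg) (n : ℤ) (m : M.carrier) :
    extend hM g (mode (M.act v) n m) = mode (M'.act v) n (extend hM g m) := by
  have h : ∀ c n m, extend hM g (M.heisRep.op c n m) =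
      sgn (0 * c.degree deg) • M'.heisRep.op c n (extend hM g m) := fun c n m => by
    rw [extend_op]
    simp [sgn]
  rw [← M.heisRep_act, ← M'.heisRep_act]
  refine grade_induction (homog_isInternal (jetDeg deg)) (C := fun v => extend hM g
    (mode (M.heisRep.act v) n m) = mode (M'.heisRep.act v) n (extend hM g m)) ?_ ?_ ?_ v
  · simp [HeisRep.mode_zero]
  · intro v w hv hw
    simp only [map_add, mode_add, LinearMap.add_apply, hv, hw]
  · intro k v hv
    rw [HeisRep.map_mode h hv]
    simp [sgn]

lemma diff_lift_gen (M : DgChMod.{u} P) (y : Coord ι × ℕ) (m : M.carrier) :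
    M.diff (M.heisRep.cr y m) =
      SuperPoly.lift _ M.heisRep.isFock.cr_cr (twist (jetDeg deg) 1 (gen _ y)) (M.diff m) := by
  rw [HeisRep.cr, diff_op, twist_gen, map_smul, lift_gen, LinearMap.smul_apply]
  rfl

lemma diff_mem_sing (M : DgChMod.{u} P) {m : M.carrier} (hm : m ∈ M.heisRep.sing) :
    M.diff m ∈ M.heisRep.sing :=
  HeisRep.map_mem_sing M.diff_op hm

/-- Split d = δ + Q. The operator Q is a mode of the vertex algebra and commutes with the extension.
The operator δ is semilinear through the sign twist and equals d - ∂ on singular vectors, so it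
commutes with g there. -/
lemma extend_d (m : M.carrier) : extend hM g (M.d m) = M'.d (extend hM g m) := by
  have h1 : extend hM g (M.diff m) = M'.diff (extend hM g m) := by
    refine extend_comm hM g M.diff_lift_gen M'.diff_lift_gen (fun s hs => M.diff_mem_sing hs)
      (fun s hs => M'.diff_mem_sing hs) (fun s => ?_) m
    have h1 := congrArg Subtype.val (g.map_act P.dOp s)
    have h2 := congrArg Subtype.val (g.map_d s)
    have h3 : (⟨M.diff s, M.diff_mem_sing s.2⟩ : M.heisRep.sing) =
        M.singDgDMod.d s - M.singDgDMod.act P.dOp s := by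
      ext
      change M.d s - M.heisRep.chargeOp P s = M.d s - (M.heisRep.singAct P.dOp s : M.carrier)
      rw [(M.heisRep.mode_charge P s).2]
    have h4 : M'.diff (singLin g s : M'.carrier) = M'.d (singLin g s) -
        (M'.heisRep.singAct P.dOp (singLin g s) : M'.carrier) := by
      rw [diff, LinearMap.sub_apply, (M'.heisRep.mode_charge P _).2]
    have h5 : singLin g (M.singDgDMod.d s - M.singDgDMod.act P.dOp s) =
        singLin g (M.singDgDMod.d s) - singLin g (M.singDgDMod.act P.dOp s) := map_sub _ _ _
    rw [h3, h5, h4]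
    exact congrArg₂ (fun a b => a - b) h2 h1
  have h2 : extend hM g (M.heisRep.chargeOp P m) = M'.heisRep.chargeOp P (extend hM g m) := by
    rw [HeisRep.chargeOp, HeisRep.chargeOp, heisRep_act, heisRep_act, extend_mode]
  have h3 : ∀ (M : DgChMod.{u} P) m, M.d m = M.diff m + M.heisRep.chargeOp P m := fun M m => by
    simp [diff]
  rw [h3, h3, map_add, h1, h2]

end extend

/-- A morphism commutes with the creation operators, and these generate a bounded module from its
singular vectors. -/
instance : (singFunctor.{u} P).Faithful where
  map_injective {M M'} f f' hff := by
    refine ObjectProperty.hom_ext _ (Hom.ext (LinearMap.ext fun m => ?_))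
    obtain ⟨t, rfl⟩ := (M.obj.fockEquiv M.property).surjective m
    rw [fockEquiv_apply]
    have h : ∀ f : M ⟶ M', ∀ t, f.hom.toLin (M.obj.heisRep.isFock.fockMap t) =
        M'.obj.heisRep.isFock.fockMap ((singLin (Hom.sing f.hom)).lTensor _ t) := by
      intro f t
      have := M.obj.heisRep.isFock.map_fockMap M'.obj.heisRep.isFock (T := f.hom.toLin)
        (φ := AlgHom.id ℂ _) (fun y m => by
          rw [AlgHom.id_apply, lift_gen]
          exact f.hom.map_act _ _ _) (S := singLin (Hom.sing f.hom)) (fun s => rfl) t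
      exact this
    rw [h, h]
    have : Hom.sing f.hom = Hom.sing f'.hom := hff
    rw [this]

instance : (singFunctor.{u} P).Full where
  map_surjective {M M'} g := by
    refine ⟨ObjectProperty.homMk ⟨extend M.property g, fun k m hm => extend_mem M.property g hm,
      extend_mode M.property g, extend_d M.property g⟩, ?_⟩
    refine DgDMod.Hom.ext (LinearMap.ext fun s => Subtype.ext ?_)
    exact extend_sing M.property g s

end DgChMod

/-! ### The module generated by a module over the differential operators -/

/-- The index of the mode of `g` on `𝒟^{ch}_P` that acts as `g_{(n)}` on the module
`𝒟^{ch}_P ⊗ N`, where the modes which preserve the conformal weight are skipped. -/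
def Coord.shift {ι : Type} (g : Coord ι) (n : ℤ) : ℤ :=
  if n < g.zeroIdx then n - g.zeroIdx else n - g.zeroIdx - 1

/-- Modes on opposite sides of the zero modes are paired. The shift moves the two sides together by
amounts that cancel in p + q for dual coordinates, so the oscillators reproduce the relations of the
vacuum representation. -/
lemma Coord.contr_shift {ι : Type} (deg : ι → ℤ) {g h : Coord ι} {p q : ℤ} (hp : p ≠ g.zeroIdx)
    (hq : q ≠ h.zeroIdx) :
    Coord.contr deg g h (g.shift p) (h.shift q) = Coord.contr deg g h p q := by
  classical
  rw [Coord.contr, Coord.contr]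
  by_cases hh : h = g.dual
  · subst hh
    have := g.zeroIdx_dual
    have e : g.shift p + g.dual.shift q = -1 ↔ p + q = -1 := by
      rw [shift, shift]
      split_ifs <;> omega
    simp only [e]
  · simp [hh]

lemma HeisRep.ext_of_op {ι : Type} {deg : ι → ℤ} {M : Type*} [AddCommGroup M] [Module ℂ M]
    {R R' : HeisRep deg M} (hgr : R.gr = R'.gr) (hop : R.op = R'.op) : R = R' := by
  cases R
  cases R'
  cases hgr
  cases hop
  rfl

namespace DgDMod

open Chiral SuperPoly ChiralField

variable {ι : Type} {deg : ι → ℤ} {P : PolyDGA deg} (N : DgDMod.{u} P)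

/-- The action of the coordinates on `𝒟^{ch}_P ⊗ N`. -/
def freeOp (g : Coord ι) (n : ℤ) : Module.End ℂ (Jet deg ⊗[ℂ] N.carrier) :=
  if n = g.zeroIdx then
    TensorProduct.map (twist (jetDeg deg) (g.degree deg)).toLinearMap (N.act (Weyl.coordOp g))
  else (genMode deg g (g.shift n)).rTensor _

lemma freeOp_zeroIdx (g : Coord ι) (p : Jet deg) (n : N.carrier) :
    N.freeOp g g.zeroIdx (p ⊗ₜ n) =
      twist (jetDeg deg) (g.degree deg) p ⊗ₜ N.act (Weyl.coordOp g) n := by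
  simp [freeOp]

lemma freeOp_of_ne {g : Coord ι} {k : ℤ} (hk : k ≠ g.zeroIdx) :
    N.freeOp g k = (genMode deg g (g.shift k)).rTensor _ := by
  rw [freeOp, if_neg hk]

/-- The components of `𝒟^{ch}_P ⊗ N`. -/
def freeGr (k : ℤ) : Submodule ℂ (Jet deg ⊗[ℂ] N.carrier) :=
  Submodule.span ℂ {t | ∃ i j p n, i + j = k ∧ p ∈ homog (jetDeg deg) i ∧ n ∈ N.gr j ∧
    t = p ⊗ₜ n}

lemma tmul_mem_freeGr {i j : ℤ} {p : Jet deg} {n : N.carrier} (hp : p ∈ homog (jetDeg deg) i)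
    (hn : n ∈ N.gr j) : p ⊗ₜ n ∈ N.freeGr (i + j) :=
  Submodule.subset_span ⟨i, j, p, n, rfl, hp, hn, rfl⟩

lemma map_mem_freeGr {f : Module.End ℂ (Jet deg ⊗[ℂ] N.carrier)} {δ k : ℤ}
    (hf : ∀ i j p n, p ∈ homog (jetDeg deg) i → n ∈ N.gr j → f (p ⊗ₜ n) ∈ N.freeGr (δ + (i + j)))
    {t : Jet deg ⊗[ℂ] N.carrier} (ht : t ∈ N.freeGr k) : f t ∈ N.freeGr (δ + k) := by
  induction ht using Submodule.span_induction with
  | mem t ht =>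
    obtain ⟨i, j, p, n, rfl, hp, hn, rfl⟩ := ht
    exact hf i j p n hp hn
  | zero => simp
  | add s t _ _ hs ht => rw [map_add]; exact add_mem hs ht
  | smul c t _ ht => rw [map_smul]; exact Submodule.smul_mem _ _ ht

lemma freeGr_isInternal : DirectSum.IsInternal N.freeGr := by
  refine isInternal_of_le_eigenspace (TensorProduct.map (scale (jetDeg deg) (jetDeg deg)).toLinearMap
    (gradeOp N.isInternal fun k => 2 ^ k)) (fun k t ht => ?_) fun t => ?_
  · induction ht using Submodule.span_induction with
    | mem t ht =>
      obtain ⟨i, j, p, n, rfl, hp, hn, rfl⟩ := ht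
      rw [TensorProduct.map_tmul, AlgHom.toLinearMap_apply, Weyl.scale_of_mem hp,
        gradeOp_of_mem _ _ hn, TensorProduct.smul_tmul_smul, zpow_add₀ two_ne_zero]
    | zero => simp
    | add s t _ _ hs ht => rw [map_add, hs, ht, smul_add]
    | smul c t _ ht => rw [map_smul, ht, smul_comm]
  · induction t with
    | zero => exact Submodule.zero_mem _
    | add s t hs ht => exact add_mem hs ht
    | tmul p n =>
      refine grade_induction (homog_isInternal (jetDeg deg))
        (C := fun p => p ⊗ₜ[ℂ] n ∈ ⨆ k, N.freeGr k) (by simp) (fun p q hp hq => by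
          rw [TensorProduct.add_tmul]; exact add_mem hp hq) (fun i p hp => ?_) p
      refine grade_induction N.isInternal
        (C := fun n => p ⊗ₜ[ℂ] n ∈ ⨆ k, N.freeGr k) (by simp) (fun p q hp hq => by
          rw [TensorProduct.tmul_add]; exact add_mem hp hq) (fun j n hn => ?_) n
      exact Submodule.mem_iSup_of_mem _ (N.tmul_mem_freeGr hp hn)

lemma twist_mem {δ k : ℤ} {p : Jet deg} (hp : p ∈ homog (jetDeg deg) k) :
    twist (jetDeg deg) δ p ∈ homog (jetDeg deg) k := by
  rw [twist_of_mem _ _ _ _ hp]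
  exact Submodule.smul_mem _ _ hp

/-- The action of the coordinates on the graded space `𝒟^{ch}_P ⊗ N`. -/
def freeRep : HeisRep deg (Jet deg ⊗[ℂ] N.carrier) where
  gr := N.freeGr
  isInternal := N.freeGr_isInternal
  op := N.freeOp
  op_mem g n k m hm := by
    refine N.map_mem_freeGr (fun i j p s hp hs => ?_) hm
    by_cases hn : n = g.zeroIdx
    · subst hn
      rw [freeOp_zeroIdx, add_left_comm]
      exact N.tmul_mem_freeGr (twist_mem hp)
        (N.act_mem _ _ _ _ (HeisRep.isHomogOp_coordOp g) hs)
    · rw [N.freeOp_of_ne hn, LinearMap.rTensor_tmul, ← add_assoc]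
      exact N.tmul_mem_freeGr (HeisRep.genMode_mem _ _ _ _ hp) hs
  trunc g t := by
    induction t with
    | zero => exact ⟨0, fun n _ => map_zero _⟩
    | add s t hs ht =>
      obtain ⟨K, hK⟩ := hs
      obtain ⟨L, hL⟩ := ht
      exact ⟨max K L, fun n hn => by
        rw [map_add, hK n (le_trans (le_max_left _ _) hn), hL n (le_trans (le_max_right _ _) hn),
          add_zero]⟩
    | tmul p s =>
      obtain ⟨K, hK⟩ := (HeisRep.vacuumRep deg).trunc g p
      refine ⟨max (K + g.zeroIdx + 1) (g.zeroIdx + 1), fun n hn => ?_⟩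
      have h1 := (le_max_left _ _).trans hn
      have h2 := (le_max_right _ _).trans hn
      have h3 := hK (g.shift n) (by rw [Coord.shift, if_neg (by omega)]; omega)
      rw [N.freeOp_of_ne (by omega), LinearMap.rTensor_tmul]
      change genMode deg g (g.shift n) p = 0 at h3
      rw [h3, TensorProduct.zero_tmul]
  comm g h p q t := by
    classical
    have hcontr : p = g.zeroIdx → q ≠ h.zeroIdx → Coord.contr deg g h p q = 0 := by
      intro hp hq
      rw [Coord.contr, if_neg]
      rintro ⟨h1, h2⟩
      rw [h1, Coord.zeroIdx_dual] at hq
      omega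
    have hcontr' : p ≠ g.zeroIdx → q = h.zeroIdx → Coord.contr deg g h p q = 0 := by
      intro hp hq
      rw [Coord.contr, if_neg]
      rintro ⟨h1, h2⟩
      rw [h1, Coord.zeroIdx_dual] at hq
      omega
    induction t with
    | zero => simp
    | add s t hs ht => simp only [map_add, hs, ht, smul_add]; abel
    | tmul a n =>
      by_cases hp : p = g.zeroIdx <;> by_cases hq : q = h.zeroIdx
      · subst hp hq
        simp only [freeOp_zeroIdx]
        have h1 := LinearMap.congr_fun (congrArg N.act (Weyl.isRep_coordOp (deg := deg) g h)) n
        simp only [map_mul, map_add, map_smul, map_one, Module.End.mul_apply, LinearMap.add_apply,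
          LinearMap.smul_apply, Module.End.one_apply] at h1
        rw [h1, TensorProduct.tmul_add, TensorProduct.tmul_smul, TensorProduct.tmul_smul,
          twist_twist_comm]
        congr 1
        rw [Weyl.contr, Coord.contr]
        by_cases hh : h = g.dual
        · subst hh
          rw [if_pos rfl, if_pos ⟨rfl, by rw [Coord.zeroIdx_dual]; ring⟩]
          congr 2
          rw [Coord.degree_dual]
          -- Dual coordinates have opposite degrees and the twist sees only the parity, so the two
          -- twists on the first factor cancel.
          have : ∀ a : Jet deg, twist (jetDeg deg) (-g.degree deg) a =
              twist (jetDeg deg) (g.degree deg) a := by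
            intro a
            refine LinearMap.congr_fun (f := (twist (jetDeg deg) (-g.degree deg)).toLinearMap)
              (g := (twist (jetDeg deg) (g.degree deg)).toLinearMap)
              (grade_hom_ext (homog_isInternal _) fun k p hp => ?_) a
            rw [AlgHom.toLinearMap_apply, AlgHom.toLinearMap_apply, twist_of_mem _ _ _ _ hp,
              twist_of_mem _ _ _ _ hp, neg_mul, sgn_neg]
          rw [this, Weyl.twist_twist]
        · rw [if_neg hh, if_neg fun e => hh e.1, zero_smul, zero_smul]
      · rw [hcontr hp hq, zero_smul, add_zero]
        subst hp
        rw [N.freeOp_of_ne hq, LinearMap.rTensor_tmul, freeOp_zeroIdx, freeOp_zeroIdx,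
          LinearMap.rTensor_tmul, twist_genMode, TensorProduct.smul_tmul']
      · rw [hcontr' hp hq, zero_smul, add_zero]
        subst hq
        rw [N.freeOp_of_ne hp, LinearMap.rTensor_tmul, freeOp_zeroIdx, freeOp_zeroIdx,
          LinearMap.rTensor_tmul, twist_genMode, TensorProduct.smul_tmul', smul_smul,
          mul_comm (h.degree deg), sgn_mul_self, one_smul]
      · rw [N.freeOp_of_ne hp, N.freeOp_of_ne hq]
        simp only [LinearMap.rTensor_tmul]
        have h1 := (HeisRep.vacuumRep deg).comm g h (g.shift p) (h.shift q) a
        change genMode deg g (g.shift p) (genMode deg h (h.shift q) a) = _ •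
          genMode deg h (h.shift q) (genMode deg g (g.shift p) a) + _ at h1
        rw [h1, Coord.contr_shift deg hp hq, TensorProduct.add_tmul, TensorProduct.smul_tmul',
          TensorProduct.smul_tmul']

/-- Away from the zero modes the module is a Fock space in the first factor, so the singular vectors
are found by the Poincaré lemma. -/
lemma freeRep_an (y : Coord ι × ℕ) :
    N.freeRep.an y = (pderiv (jetDeg deg) y).rTensor N.carrier := by
  obtain ⟨g, k⟩ := y
  rw [HeisRep.an]
  change Coord.pairing deg g.dual • N.freeOp g.dual (g.dual.zeroIdx + 1 + k) = _
  rw [N.freeOp_of_ne (by omega), Coord.shift, if_neg (by omega)]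
  ext a n
  simp only [TensorProduct.AlgebraTensorModule.curry_apply, TensorProduct.curry_apply,
    LinearMap.coe_restrictScalars, LinearMap.smul_apply, LinearMap.rTensor_tmul]
  rw [genMode_of_nonneg _ _ _ (by omega), ← TensorProduct.smul_tmul', smul_smul,
    Coord.pairing_mul_self, one_smul, Coord.dual_dual]
  rw [show (g.dual.zeroIdx + 1 + (k : ℤ) - g.dual.zeroIdx - 1).toNat = k by omega]

lemma one_tmul_mem_sing (n : N.carrier) : (1 : Jet deg) ⊗ₜ n ∈ N.freeRep.sing := by
  rw [HeisRep.mem_sing]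
  intro y
  rw [freeRep_an, LinearMap.rTensor_tmul, pderiv_one, TensorProduct.zero_tmul]

/-- The map `n ↦ 1 ⊗ n`. -/
def toFree : N.carrier →ₗ[ℂ] N.freeRep.sing :=
  (TensorProduct.mk ℂ (Jet deg) N.carrier 1).codRestrict _ N.one_tmul_mem_sing

@[simp] lemma coe_toFree (n : N.carrier) :
    (N.toFree n : Jet deg ⊗[ℂ] N.carrier) = (1 : Jet deg) ⊗ₜ n := rfl

/-- Injectivity is seen by evaluating all jets at zero, surjectivity is the Poincaré lemma. -/
lemma toFree_bijective : Function.Bijective N.toFree := by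
  constructor
  · intro n n' h
    have h1 : (1 : Jet deg) ⊗ₜ[ℂ] n = (1 : Jet deg) ⊗ₜ n' := congrArg Subtype.val h
    let ev : Jet deg →ₐ[ℂ] ℂ := SuperPoly.lift (fun _ => 0) (by simp)
    have h2 := congrArg (fun t => TensorProduct.lid ℂ N.carrier (ev.toLinearMap.rTensor _ t)) h1
    simpa using h2
  · rintro ⟨t, ht⟩
    obtain ⟨n, rfl⟩ := exists_eq_one_tmul (jetDeg deg) (t := t) fun y => by
      rw [← freeRep_an]
      exact N.freeRep.mem_sing.1 ht y
    exact ⟨n, rfl⟩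

/-- The part of the differential of `𝒟^{ch}_P ⊗ N` which supercommutes with the coordinates. -/
def freeDiff : Module.End ℂ (Jet deg ⊗[ℂ] N.carrier) :=
  TensorProduct.map (twist (jetDeg deg) 1).toLinearMap (N.d - N.act P.dOp)

lemma freeDiff_tmul (p : Jet deg) (n : N.carrier) : N.freeDiff (p ⊗ₜ n) =
    twist (jetDeg deg) 1 p ⊗ₜ (N.d n - N.act P.dOp n) := rfl

lemma isHomogOp_dOp : IsHomogOp deg 1 P.dOp := fun k p hp => by
  rw [add_comm]
  exact P.isSuperDerivation.map_homog k p hp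

lemma freeDiff_mem {k : ℤ} {t : Jet deg ⊗[ℂ] N.carrier} (ht : t ∈ N.freeGr k) :
    N.freeDiff t ∈ N.freeGr (k + 1) := by
  rw [add_comm]
  refine N.map_mem_freeGr (fun i j p n hp hn => ?_) ht
  rw [freeDiff_tmul, add_left_comm]
  refine N.tmul_mem_freeGr (twist_mem hp) (sub_mem ?_ (N.act_mem _ _ _ _ isHomogOp_dOp hn))
  rw [add_comm]
  exact N.d_mem _ _ hn

/-- Since ∂² = 0, the Leibniz rule for the operator ∂ itself says d ∂ = -∂ d on N, whence (d - ∂)² =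
0. -/
lemma freeDiff_freeDiff (t : Jet deg ⊗[ℂ] N.carrier) : N.freeDiff (N.freeDiff t) = 0 := by
  induction t with
  | zero => simp
  | add s t hs ht => rw [map_add, map_add, hs, ht, add_zero]
  | tmul p n =>
    have hs1 : sgn 1 = -1 := by simp [sgn]
    have h := N.leibniz 1 P.dOp n isHomogOp_dOp
    have e : P.dOp * P.dOp - sgn 1 • (P.dOp * P.dOp) = 0 := by
      rw [HeisRep.dOp_dOp, smul_zero]
      exact sub_zero (0 : diffOps deg)
    rw [e, map_zero, LinearMap.zero_apply, zero_add, hs1, neg_one_smul] at h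
    have h2 : N.act P.dOp (N.act P.dOp n) = 0 := by
      rw [← Module.End.mul_apply, ← map_mul, HeisRep.dOp_dOp, map_zero, LinearMap.zero_apply]
    rw [freeDiff_tmul, freeDiff_tmul, map_sub, map_sub, N.d_d, h, h2]
    simp

/-- On N the Leibniz rule says that d - ∂ supercommutes with 𝒟_P. On the first factor the twist by
degree 1 supplies the sign. -/
lemma freeDiff_op (g : Coord ι) (k : ℤ) (t : Jet deg ⊗[ℂ] N.carrier) :
    N.freeDiff (N.freeRep.op g k t) =
      sgn (1 * g.degree deg) • N.freeRep.op g k (N.freeDiff t) := by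
  change N.freeDiff (N.freeOp g k t) = _ • N.freeOp g k (N.freeDiff t)
  induction t with
  | zero => simp
  | add s t hs ht => simp only [map_add, hs, ht, smul_add]
  | tmul p n =>
    by_cases hk : k = g.zeroIdx
    · subst hk
      have h := N.leibniz _ _ n (HeisRep.isHomogOp_coordOp (deg := deg) g)
      have e : N.act (P.dOp * Weyl.coordOp g - sgn (g.degree deg) • (Weyl.coordOp g * P.dOp)) =
          N.act P.dOp * N.act (Weyl.coordOp g) -
            sgn (g.degree deg) • (N.act (Weyl.coordOp g) * N.act P.dOp) :=
        (map_sub N.act _ _).trans (by rw [map_smul, map_mul, map_mul])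
      rw [e] at h
      simp only [LinearMap.sub_apply, Module.End.mul_apply, LinearMap.smul_apply] at h
      rw [freeOp_zeroIdx, freeDiff_tmul, freeDiff_tmul, freeOp_zeroIdx, h, twist_twist_comm,
        ← TensorProduct.tmul_smul, one_mul, map_sub, smul_sub]
      congr 1
      abel
    · rw [N.freeOp_of_ne hk, LinearMap.rTensor_tmul, freeDiff_tmul, freeDiff_tmul,
        LinearMap.rTensor_tmul, twist_genMode, TensorProduct.smul_tmul']

variable [Fintype ι]

/-- The dg module `𝒟^{ch}_P ⊗ N`. -/
def free (hdeg : ∀ i, deg i ≤ 0) : DgChMod.{u} P :=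
  N.freeRep.toDgChMod hdeg N.freeDiff (fun _ _ h => N.freeDiff_mem h) N.freeDiff_freeDiff
    N.freeDiff_op

lemma free_heisRep (hdeg : ∀ i, deg i ≤ 0) : (N.free hdeg).heisRep = N.freeRep := by
  have : ∀ g n, mode (N.freeRep.act (jet deg g 0)) n = N.freeRep.op g n := fun g n =>
    N.freeRep.mode_act_jet g n
  exact HeisRep.ext_of_op rfl (funext₂ this)

lemma free_isBounded (hdeg : ∀ i, deg i ≤ 0) : DgChMod.IsBounded (N.free hdeg) := by
  rw [DgChMod.isBounded_iff, free_heisRep]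
  intro t
  obtain ⟨n, hn⟩ := IsFock.exists_killedByWords_rTensor (deg := jetDeg deg) t
  refine ⟨n + 1, Nat.succ_pos n, fun y => ?_⟩
  have h := hn.succ.pow_eq_zero y
  simp only [← freeRep_an] at h
  exact h

omit [Fintype ι] in
lemma toFree_mem_iff {k : ℤ} {n : N.carrier} :
    (N.toFree n : Jet deg ⊗[ℂ] N.carrier) ∈ N.freeGr k ↔ n ∈ N.gr k := by
  have hmap : ∀ k, ∀ n ∈ N.gr k,
      TensorProduct.mk ℂ (Jet deg) N.carrier 1 n ∈ N.freeGr (0 + k) := fun k n hn =>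
    N.tmul_mem_freeGr (one_mem_weightGr (jetDeg deg) (jetDeg deg)) hn
  constructor
  · intro h
    have h1 := gradeOp_comm_of_map N.isInternal N.freeGr_isInternal hmap (Pi.single k 1) n
    have h2 := gradeOp_of_mem N.freeGr_isInternal (Pi.single k 1) h
    simp only [zero_add, Pi.single_eq_same, one_smul] at h1 h2
    have h3 : N.toFree (gradeOp N.isInternal (Pi.single k 1) n) = N.toFree n :=
      Subtype.ext (h1.symm.trans h2)
    rw [← N.toFree_bijective.1 h3]
    exact gradeOp_single_mem _ _ _
  · intro h
    simpa using hmap k n h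

/-- The twist in the zero mode fixes 1, so the coordinates act on 1 ⊗ n through N, and they generate
𝒟_P. -/
lemma toFree_act (a : diffOps deg) (n : N.carrier) :
    N.toFree (N.act a n) = N.freeRep.singAct a (N.toFree n) := by
  refine Weyl.diffOps_induction (C := fun a => ∀ n,
    N.toFree (N.act a n) = N.freeRep.singAct a (N.toFree n)) ?_ ?_ ?_ ?_ a n
  · intro n; simp
  · intro a b ha hb n; simp [ha, hb]
  · intro c a ha n; simp [ha]
  · intro g a ha n
    rw [map_mul, map_mul, Module.End.mul_apply, Module.End.mul_apply, ← ha,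
      HeisRep.singAct_coordOp]
    ext
    rw [coe_toFree, HeisRep.coe_singOp, coe_toFree]
    change _ = N.freeOp g g.zeroIdx _
    rw [freeOp_zeroIdx, map_one]

end DgDMod

namespace DgDMod

variable {X : Type} {deg : X → ℤ} {P : PolyDGA deg}

/-- A bijective morphism which reflects degrees is an isomorphism. -/
def isoOfBijective {M N : DgDMod.{u} P} (f : Hom M N) (hf : Function.Bijective f.toLin)
    (hgr : ∀ k m, f.toLin m ∈ N.gr k → m ∈ M.gr k) : M ≅ N where
  hom := f
  inv :=
    { toLin := (LinearEquiv.ofBijective f.toLin hf).symm.toLinearMap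
      map_gr := fun k n hn => hgr k _ (by
        have := (LinearEquiv.ofBijective f.toLin hf).apply_symm_apply n
        rw [LinearEquiv.ofBijective_apply] at this
        rwa [LinearEquiv.coe_coe, this])
      map_act := fun a n => by
        obtain ⟨m, rfl⟩ := hf.2 n
        rw [← f.map_act, LinearEquiv.coe_coe, LinearEquiv.ofBijective_symm_apply_apply,
          LinearEquiv.ofBijective_symm_apply_apply]
      map_d := fun n => by
        obtain ⟨m, rfl⟩ := hf.2 n
        rw [← f.map_d, LinearEquiv.coe_coe, LinearEquiv.ofBijective_symm_apply_apply,
          LinearEquiv.ofBijective_symm_apply_apply] }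
  hom_inv_id := Hom.ext (LinearMap.ext fun m =>
    (LinearEquiv.ofBijective f.toLin hf).symm_apply_apply m)
  inv_hom_id := Hom.ext (LinearMap.ext fun n =>
    (LinearEquiv.ofBijective f.toLin hf).apply_symm_apply n)

end DgDMod

/-! ### Essential surjectivity -/

namespace DgChMod

open Chiral SuperPoly

variable {ι : Type} [Fintype ι] {deg : ι → ℤ} {P : PolyDGA deg}

lemma singFunctor_essSurj (hdeg : ∀ i, deg i ≤ 0) : (singFunctor.{u} P).EssSurj where
  mem_essImage N := by
    let M : Bounded.{u} P := ⟨N.free hdeg, N.free_isBounded hdeg⟩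
    have hop : M.obj.heisRep = N.freeRep := N.free_heisRep hdeg
    let e : N.freeRep.sing ≃ₗ[ℂ] M.obj.heisRep.sing := LinearEquiv.ofEq _ _ (congrArg HeisRep.sing hop.symm)
    -- The two representations agree only up to a propositional equality, along which the actions
    -- are compared by substitution.
    have he : ∀ a s, e (N.freeRep.singAct a s) = M.obj.heisRep.singAct a (e s) := by
      have key : ∀ (R R' : HeisRep deg (Jet deg ⊗[ℂ] N.carrier)) (h : R = R') (a s),
          (LinearEquiv.ofEq R'.sing R.sing (by rw [h])) (R'.singAct a s) =
            R.singAct a ((LinearEquiv.ofEq R'.sing R.sing (by rw [h])) s) := by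
        rintro R _ rfl a s
        rfl
      exact key _ _ hop
    let f : DgDMod.Hom N M.obj.singDgDMod :=
      { toLin := e.toLinearMap ∘ₗ N.toFree
        map_gr := fun k n hn => N.toFree_mem_iff.2 hn
        map_act := fun a n => by
          change e (N.toFree (N.act a n)) = M.obj.heisRep.singAct a (e (N.toFree n))
          rw [N.toFree_act, he]
        map_d := fun n => by
          refine Subtype.ext ?_
          -- On 1 ⊗ n the operator Q contributes ∂ and the remaining part contributes d - ∂.
          change (1 : Jet deg) ⊗ₜ[ℂ] N.d n =
            N.freeRep.chargeOp P (N.toFree n) + N.freeDiff (1 ⊗ₜ n)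
          rw [(N.freeRep.mode_charge P _).2, ← N.toFree_act, N.coe_toFree, N.freeDiff_tmul,
            map_one, TensorProduct.tmul_sub, add_sub_cancel] }
    exact ⟨M, ⟨(DgDMod.isoOfBijective f (e.bijective.comp N.toFree_bijective)
      fun k n hn => N.toFree_mem_iff.1 hn).symm⟩⟩

end DgChMod

/-! ### Induced modules -/

namespace UHeis

open Chiral SuperPoly

variable {ι : Type} {deg : ι → ℤ}

lemma of_mul_of (u v : HeisGen ι) : of deg u * of deg v =
    sgn (HeisGen.degree deg u * HeisGen.degree deg v) • (of deg v * of deg u) +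
      HeisGen.bracket deg u v • of deg .C := by
  have h := RingQuot.mkAlgHom_rel ℂ (HeisGen.Rel.comm (deg := deg) u v)
  rw [map_mul, map_add, map_smul, map_mul, map_smul] at h
  exact h

/-- The quotient map from the free algebra. -/
def mk : FreeAlgebra ℂ (HeisGen ι) →ₐ[ℂ] UHeis deg := RingQuot.mkAlgHom ℂ (HeisGen.Rel deg)

lemma mk_surjective : Function.Surjective (mk (deg := deg)) :=
  RingQuot.mkAlgHom_surjective ℂ (HeisGen.Rel deg)

lemma induction {C : UHeis deg → Prop} (one : C 1) (add : ∀ p q, C p → C q → C (p + q))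
    (smul : ∀ (c : ℂ) p, C p → C (c • p)) (of_mul : ∀ x p, C p → C (of deg x * p))
    (p : UHeis deg) : C p := by
  obtain ⟨a, rfl⟩ := mk_surjective p
  have key : ∀ a : FreeAlgebra ℂ (HeisGen ι), ∀ q : UHeis deg, C q →
      C (mk a * q) := by
    intro a
    induction a using FreeAlgebra.induction with
    | grade0 r =>
      intro q hq
      rw [AlgHom.commutes]
      have := smul r q hq
      rwa [Algebra.smul_def] at this
    | grade1 x => exact fun q hq => of_mul x q hq
    | mul a b ha hb =>
      intro q hq
      have := ha _ (hb _ hq)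
      rw [map_mul]
      rwa [← mul_assoc] at this
    | add a b ha hb =>
      intro q hq
      have := add _ _ (ha _ hq) (hb _ hq)
      rw [map_add]
      rwa [← add_mul] at this
  simpa using key a 1 one

/-- The universal property of `U(𝔞̂)`. -/
def lift {B : Type*} [Ring B] [Algebra ℂ B] (f : HeisGen ι → B)
    (hf : ∀ u v, f u * f v = sgn (HeisGen.degree deg u * HeisGen.degree deg v) • (f v * f u) +
      HeisGen.bracket deg u v • f .C) : UHeis deg →ₐ[ℂ] B :=
  RingQuot.liftAlgHom ℂ ⟨FreeAlgebra.lift ℂ f, by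
    rintro _ _ ⟨u, v⟩
    simpa using hf u v⟩

@[simp] lemma lift_of {B : Type*} [Ring B] [Algebra ℂ B] (f : HeisGen ι → B) (hf)
    (g : HeisGen ι) : lift (deg := deg) f hf (of deg g) = f g := by
  have h := RingQuot.liftAlgHom_mkAlgHom_apply ℂ (s := HeisGen.Rel deg) (FreeAlgebra.lift ℂ f) (by
    rintro _ _ ⟨u, v⟩
    simpa using hf u v) (FreeAlgebra.ι ℂ g)
  exact h.trans (FreeAlgebra.lift_ι_apply _ _)

lemma C_mul (u : UHeis deg) : of deg .C * u = u * of deg .C := by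
  have hC : ∀ g, of deg .C * of deg g = of deg g * of deg .C := by
    intro g
    rw [of_mul_of]
    have h1 : HeisGen.bracket deg .C g = 0 := by cases g <;> rfl
    rw [h1, zero_smul, add_zero, HeisGen.degree, zero_mul]
    simp [sgn]
  induction u using induction with
  | one => simp
  | add p q hp hq => rw [mul_add, add_mul, hp, hq]
  | smul c p hp => rw [mul_smul_comm, smul_mul_assoc, hp]
  | of_mul g p hp => rw [← mul_assoc, hC, mul_assoc, hp, mul_assoc]

/-- The elements of `𝔞̂` which raise the conformal weight. -/
def crGen : Coord ι × ℕ → HeisGen ι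
  | (.fn i, k) => .b i (-1 - k)
  | (.vf i, k) => .a i (-1 - k)

lemma crGen_comm (x y : Coord ι × ℕ) : of deg (crGen x) * of deg (crGen y) =
    sgn (jetDeg deg x * jetDeg deg y) • (of deg (crGen y) * of deg (crGen x)) := by
  classical
  rw [of_mul_of]
  have h1 : HeisGen.bracket deg (crGen x) (crGen y) = 0 := by
    rcases x with ⟨i | i, k⟩ <;> rcases y with ⟨j | j, l⟩ <;>
      simp only [crGen, HeisGen.bracket, ite_eq_right_iff] <;> intro h <;> omega
  have h2 : ∀ x : Coord ι × ℕ, HeisGen.degree deg (crGen x) = jetDeg deg x := by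
    rintro ⟨i | i, k⟩ <;> rfl
  rw [h1, zero_smul, add_zero, h2, h2]

variable (deg) in
/-- The map from `𝒟^{ch}_P` to `U(𝔞̂)`. -/
def ofJet : Jet deg →ₐ[ℂ] UHeis deg := SuperPoly.lift (fun y => of deg (crGen y)) crGen_comm

lemma nonneg_or_crGen (g : HeisGen ι) : g.IsNonneg ∨ ∃ y, g = crGen y := by
  cases g with
  | a i n =>
    rcases le_or_gt 0 n with h | h
    · exact Or.inl h
    · exact Or.inr ⟨(.vf i, (-1 - n).toNat), by simp only [crGen]; congr 1; omega⟩
  | b i n =>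
    rcases le_or_gt 0 n with h | h
    · exact Or.inl h
    · exact Or.inr ⟨(.fn i, (-1 - n).toNat), by simp only [crGen]; congr 1; omega⟩
  | C => exact Or.inl trivial

end UHeis

namespace HeisRep

open Chiral SuperPoly

variable {ι : Type} {deg : ι → ℤ} {M : Type*} [AddCommGroup M] [Module ℂ M] (R : HeisRep deg M)

/-- The action of the basis of `𝔞̂`. -/
def heisOp : HeisGen ι → Module.End ℂ M
  | .a i n => R.op (.vf i) n
  | .b i n => R.op (.fn i) (n - 1)
  | .C => 1

lemma heisOp_comm (u v : HeisGen ι) : R.heisOp u * R.heisOp v =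
    sgn (HeisGen.degree deg u * HeisGen.degree deg v) • (R.heisOp v * R.heisOp u) +
      HeisGen.bracket deg u v • R.heisOp .C := by
  classical
  ext m
  have h0 : sgn 0 = 1 := by simp [sgn]
  rcases u with ⟨i, p⟩ | ⟨i, p⟩ | _ <;> rcases v with ⟨j, q⟩ | ⟨j, q⟩ | _ <;>
    simp only [heisOp, HeisGen.bracket, HeisGen.degree, Module.End.mul_apply, LinearMap.add_apply,
      LinearMap.smul_apply, Module.End.one_apply, mul_zero, zero_mul, h0, one_smul, zero_smul,
      add_zero]
  · rw [R.comm]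
    simp [Coord.contr, Coord.dual, Coord.degree]
  · rw [R.comm]
    congr 2
    rw [Coord.contr]
    refine if_congr ?_ rfl rfl
    simp only [Coord.dual, Coord.fn.injEq]
    constructor
    · rintro ⟨h1, h2⟩; exact ⟨h1.symm, by omega⟩
    · rintro ⟨h1, h2⟩; exact ⟨h1.symm, by omega⟩
  · rw [R.comm]
    congr 2
    rw [Coord.contr]
    by_cases h : j = i ∧ q = -p
    · obtain ⟨rfl, rfl⟩ := h
      rw [if_pos ⟨rfl, by omega⟩, if_pos ⟨rfl, rfl⟩, Coord.pairing, neg_inj]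
      rcases Int.even_or_odd (deg j) with h | h
      · rw [sgn, sgn, h.neg_one_zpow, (h.mul_left _).neg_one_zpow]
      · rw [sgn, sgn, h.neg_one_zpow, (h.mul h).neg_one_zpow]
    · rw [if_neg, if_neg h]
      simp only [Coord.dual, Coord.vf.injEq]
      rintro ⟨h1, h2⟩
      exact h ⟨h1, by omega⟩
  · rw [R.comm]
    simp [Coord.contr, Coord.dual, Coord.degree]

/-- The action of `U(𝔞̂)`. -/
def heisHom : UHeis deg →ₐ[ℂ] Module.End ℂ M := UHeis.lift R.heisOp R.heisOp_comm

lemma heisHom_of (g : HeisGen ι) : R.heisHom (UHeis.of deg g) = R.heisOp g := UHeis.lift_of _ _ _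

lemma heisOp_crGen (y : Coord ι × ℕ) : R.heisOp (UHeis.crGen y) = R.cr y := by
  obtain ⟨i | i, k⟩ := y <;>
  · simp only [UHeis.crGen, heisOp, cr, Coord.zeroIdx]
    congr 1 <;> omega

lemma heisHom_ofJet (p : Jet deg) :
    R.heisHom (UHeis.ofJet deg p) = SuperPoly.lift R.cr R.isFock.cr_cr p := by
  have h : R.heisHom.comp (UHeis.ofJet deg) = SuperPoly.lift R.cr R.isFock.cr_cr := by
    refine SuperPoly.algHom_ext _ fun y => ?_
    rw [AlgHom.comp_apply, UHeis.ofJet, lift_gen, lift_gen, heisHom_of, heisOp_crGen]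
  exact DFunLike.congr_fun h p

end HeisRep

namespace DgDMod

open Chiral SuperPoly

variable {ι : Type} {deg : ι → ℤ} {P : PolyDGA deg} (N : DgDMod.{u} P)

lemma indMk_mul_of (u : UHeis deg) {g : HeisGen ι} (hg : g.IsNonneg) (n : N.carrier) :
    N.indMk (u * UHeis.of deg g) n = N.indMk u (N.heisAct g n) :=
  (Submodule.Quotient.eq _).2 (Submodule.subset_span ⟨u, g, n, hg, rfl⟩)

lemma smul_indMk (v u : UHeis deg) (n : N.carrier) : v • N.indMk u n = N.indMk (v * u) n := rfl

lemma ind_induction {C : N.Ind → Prop} (mk : ∀ u n, C (N.indMk u n))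
    (add : ∀ y z, C y → C z → C (y + z)) (y : N.Ind) : C y := by
  obtain ⟨t, rfl⟩ := Submodule.Quotient.mk_surjective _ y
  induction t with
  | zero =>
    have := mk 0 0
    rwa [indMk, TensorProduct.tmul_zero] at this
  | add s t hs ht => exact add _ _ hs ht
  | tmul u n => exact mk u n

/-- C is central, so it can be moved next to N, where it acts as the identity. -/
lemma C_smul_ind (y : N.Ind) : UHeis.of deg .C • y = y := by
  induction y using ind_induction with
  | mk u n =>
    rw [smul_indMk, UHeis.C_mul, indMk_mul_of _ _ (by trivial)]
    rfl
  | add y z hy hz => rw [smul_add, hy, hz]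

/-- The map `p ⊗ n ↦ p ⊗ n` to the induced module. -/
def jetToInd : Jet deg ⊗[ℂ] N.carrier →ₗ[ℂ] N.Ind :=
  N.indRel.mkQ.restrictScalars ℂ ∘ₗ (UHeis.ofJet deg).toLinearMap.rTensor _

lemma jetToInd_tmul (p : Jet deg) (n : N.carrier) :
    N.jetToInd (p ⊗ₜ n) = N.indMk (UHeis.ofJet deg p) n := rfl

/-- The spanning half of a Poincaré–Birkhoff–Witt statement: the image contains 1 ⊗ N and is stable
under 𝔞̂, because the elements of 𝔞̂_≥ can be moved to the right through the creation elements until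
they act on N. -/
lemma jetToInd_surjective : Function.Surjective N.jetToInd := by
  have hcr : ∀ y, ∀ z ∈ LinearMap.range N.jetToInd,
      UHeis.of deg (UHeis.crGen y) • z ∈ LinearMap.range N.jetToInd := by
    rintro y _ ⟨t, rfl⟩
    induction t with
    | zero => simp
    | add s t hs ht => rw [map_add, smul_add]; exact add_mem hs ht
    | tmul p n =>
      refine ⟨(gen _ y * p) ⊗ₜ n, ?_⟩
      rw [jetToInd_tmul, jetToInd_tmul, map_mul, smul_indMk]
      congr 2
      exact SuperPoly.lift_gen _ _ _
  have hnn : ∀ g : HeisGen ι, g.IsNonneg → ∀ p n,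
      UHeis.of deg g • N.jetToInd (p ⊗ₜ n) ∈ LinearMap.range N.jetToInd := by
    intro g hg p n
    induction p using gen_induction with
    | one =>
      refine ⟨1 ⊗ₜ N.heisAct g n, ?_⟩
      rw [jetToInd_tmul, jetToInd_tmul, map_one, smul_indMk, mul_one, ← indMk_mul_of _ _ hg,
        one_mul]
    | add p q hp hq => rw [TensorProduct.add_tmul, map_add, smul_add]; exact add_mem hp hq
    | smul c p hp =>
      rw [← TensorProduct.smul_tmul', map_smul, smul_comm]
      exact Submodule.smul_mem _ _ hp
    | gen_mul y p hp =>
      have h1 : N.jetToInd ((gen _ y * p) ⊗ₜ n) =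
          UHeis.of deg (UHeis.crGen y) • N.jetToInd (p ⊗ₜ n) := by
        rw [jetToInd_tmul, jetToInd_tmul, map_mul, smul_indMk]
        congr 2
        exact SuperPoly.lift_gen _ _ _
      -- Exchanging g with a creation element costs a multiple of C, which acts as the identity, so
      -- the induction on p closes.
      rw [h1, ← mul_smul, UHeis.of_mul_of, add_smul, smul_assoc, smul_assoc, mul_smul,
        C_smul_ind]
      exact add_mem (Submodule.smul_mem _ _ (hcr y _ hp)) (Submodule.smul_mem _ _ ⟨_, rfl⟩)
  have hall : ∀ g : HeisGen ι, ∀ z ∈ LinearMap.range N.jetToInd,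
      UHeis.of deg g • z ∈ LinearMap.range N.jetToInd := by
    intro g z hz
    rcases UHeis.nonneg_or_crGen g with hg | ⟨y, rfl⟩
    · obtain ⟨t, rfl⟩ := hz
      induction t with
      | zero => simp
      | add s t hs ht => rw [map_add, smul_add]; exact add_mem hs ht
      | tmul p n => exact hnn g hg p n
    · exact hcr y z hz
  intro y
  change y ∈ LinearMap.range N.jetToInd
  induction y using ind_induction with
  | mk u n =>
    induction u using UHeis.induction with
    | one => exact ⟨1 ⊗ₜ n, by rw [jetToInd_tmul, map_one]⟩
    | add u v hu hv =>
      have : N.indMk (u + v) n = N.indMk u n + N.indMk v n := by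
        rw [indMk, TensorProduct.add_tmul]
        rfl
      rw [this]
      exact add_mem hu hv
    | smul c u hu =>
      have : N.indMk (c • u) n = c • N.indMk u n := by
        rw [indMk, ← TensorProduct.smul_tmul']
        rfl
      rw [this]
      exact Submodule.smul_mem _ _ hu
    | of_mul g u hu =>
      rw [← smul_indMk]
      exact hall g _ hu
  | add y z hy hz => exact add_mem hy hz

end DgDMod

namespace DgChMod

open Chiral SuperPoly

variable {ι : Type} [Fintype ι] {deg : ι → ℤ} {P : PolyDGA deg}

lemma heisOp_eq (M : DgChMod.{u} P) (g : HeisGen ι) : M.heisRep.heisOp g = M.heisAct g := by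
  cases g <;> rfl

/-- A bounded module is induced from its singular vectors. -/
theorem exists_indEquiv (M : DgChMod.{u} P) (hM : IsBounded M) (N : DgDMod.{u} P)
    (ψ : N.carrier ≃ₗ[ℂ] M.heisRep.sing)
    (hψ : ∀ g n, ψ (N.act (Weyl.coordOp g) n) = M.heisRep.singOp g (ψ n)) :
    ∃ j : N.Ind ≃ₗ[ℂ] M.carrier,
      (∀ g y, j (UHeis.of deg g • y) = M.heisAct g (j y)) ∧
      ∀ n, j (N.indMk 1 n) = ψ n := by
  let Φ : UHeis deg ⊗[ℂ] N.carrier →ₗ[ℂ] M.carrier :=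
    TensorProduct.lift ((LinearMap.lcomp ℂ M.carrier
      (M.heisRep.sing.subtype ∘ₗ ψ.toLinearMap)) ∘ₗ M.heisRep.heisHom.toLinearMap)
  have hΦ : ∀ u n, Φ (u ⊗ₜ n) = M.heisRep.heisHom u (ψ n) := fun u n => rfl
  have hΦ_smul : ∀ (u : UHeis deg) t, Φ (u • t) = M.heisRep.heisHom u (Φ t) := by
    intro u t
    induction t with
    | zero => simp
    | add s t hs ht => rw [smul_add, map_add, map_add, map_add, hs, ht]
    | tmul v n =>
      rw [TensorProduct.smul_tmul', hΦ, hΦ, smul_eq_mul, map_mul, Module.End.mul_apply]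
  have hgen : ∀ g : HeisGen ι, g.IsNonneg → ∀ n,
      M.heisRep.heisOp g (ψ n) = ψ (N.heisAct g n) := by
    intro g hg n
    cases g with
    | a i k =>
      have hk : 0 ≤ k := hg
      rw [HeisRep.heisOp, DgDMod.heisAct]
      split_ifs with h
      · subst h
        exact (congrArg Subtype.val (hψ (.vf i) n)).symm
      · rw [M.heisRep.mem_sing_iff.1 (ψ n).2 _ _ (by simp only [Coord.zeroIdx]; omega)]
        simp
    | b i k =>
      have hk : 0 ≤ k := hg
      rw [HeisRep.heisOp, DgDMod.heisAct]
      split_ifs with h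
      · subst h
        exact (congrArg Subtype.val (hψ (.fn i) n)).symm
      · rw [M.heisRep.mem_sing_iff.1 (ψ n).2 _ _ (by simp only [Coord.zeroIdx]; omega)]
        simp
    | C => rfl
  have hker : ∀ t ∈ N.indRel, Φ t = 0 := by
    intro t ht
    induction ht using Submodule.span_induction with
    | mem t ht =>
      obtain ⟨u, g, n, hg, rfl⟩ := ht
      rw [map_sub, hΦ, hΦ, map_mul, Module.End.mul_apply, HeisRep.heisHom_of, hgen g hg, sub_self]
    | zero => exact map_zero _
    | add s t _ _ hs ht => rw [map_add, hs, ht, add_zero]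
    | smul u t _ ht => rw [hΦ_smul, ht, map_zero]
  let j₀ : N.Ind →ₗ[ℂ] M.carrier :=
    (N.indRel.restrictScalars ℂ).liftQ Φ (fun t ht => LinearMap.mem_ker.2 (hker t ht)) ∘ₗ
      (Submodule.Quotient.restrictScalarsEquiv ℂ N.indRel).symm.toLinearMap
  have hj₀ : ∀ t, j₀ (Submodule.Quotient.mk t) = Φ t := fun t => rfl
  have hcomp : ∀ t, j₀ (N.jetToInd t) =
      M.fockEquiv hM (LinearEquiv.lTensor (Jet deg) ψ t) := by
    intro t
    induction t with
    | zero => simp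
    | add s t hs ht => simp only [map_add, hs, ht]
    | tmul p n =>
      rw [DgDMod.jetToInd_tmul, DgDMod.indMk, hj₀, hΦ, HeisRep.heisHom_ofJet,
        LinearEquiv.lTensor_tmul, fockEquiv_apply, IsFock.fockMap_tmul]
  -- The composite with the spanning map is the Fock isomorphism. As the spanning map is surjective,
  -- both maps are bijective, so the linear independence half of Poincaré–Birkhoff–Witt comes for
  -- free.
  have hbij : Function.Bijective j₀ := by
    have h1 : Function.Bijective (j₀ ∘ N.jetToInd) := by
      have : j₀ ∘ N.jetToInd = M.fockEquiv hM ∘ LinearEquiv.lTensor (Jet deg) ψ := funext hcomp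
      rw [this]
      exact (M.fockEquiv hM).bijective.comp (LinearEquiv.bijective _)
    refine ⟨fun y z hyz => ?_, h1.2.of_comp⟩
    obtain ⟨s, rfl⟩ := N.jetToInd_surjective y
    obtain ⟨t, rfl⟩ := N.jetToInd_surjective z
    rw [h1.1 hyz]
  refine ⟨LinearEquiv.ofBijective j₀ hbij, fun g y => ?_, fun n => ?_⟩
  · obtain ⟨t, rfl⟩ := Submodule.Quotient.mk_surjective _ y
    rw [LinearEquiv.ofBijective_apply, LinearEquiv.ofBijective_apply, hj₀,
      ← Submodule.Quotient.mk_smul, hj₀, hΦ_smul, HeisRep.heisHom_of, heisOp_eq]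
  · rw [LinearEquiv.ofBijective_apply, DgDMod.indMk, hj₀, hΦ, map_one, Module.End.one_apply]

end DgChMod

/-! ### The equivalence of categories and its inverse -/

theorem mainTheorem2 {r : ℕ} (deg : Fin r → ℤ) (hdeg : ∀ i, deg i ≤ 0) (P : PolyDGA deg)
    {A : Type*} [CommRing A] [Algebra ℂ A] [Algebra.FiniteType ℂ A]
    (π : SuperPoly deg →ₐ[ℂ] A) (hπ : P.IsResolution π) :
    ∃ (E : DgChMod.Bounded.{u} P ≌ DgDMod.{u} P)
      (e : ∀ M : DgChMod.Bounded.{u} P, (E.functor.obj M).carrier ≃ₗ[ℂ] M.obj.sing),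
      (∀ M : DgChMod.Bounded.{u} P, M.obj.IsSingModule (E.functor.obj M) (e M)) ∧
      (∀ (M M' : DgChMod.Bounded.{u} P) (f : M ⟶ M') (m : (E.functor.obj M).carrier),
        (e M' ((E.functor.map f).toLin m) : M'.obj.carrier) = f.hom.toLin (e M m)) ∧
      ∀ N : DgDMod.{u} P, ∃ j : N.Ind ≃ₗ[ℂ] (E.inverse.obj N).obj.carrier,
        (∀ g y, j (UHeis.of deg g • y) = (E.inverse.obj N).obj.heisAct g (j y)) ∧
        ∀ n, j (N.indMk 1 n) = e (E.inverse.obj N) ((E.counitIso.inv.app N).toLin n) := by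
  have := DgChMod.singFunctor_essSurj (P := P) hdeg
  have : (DgChMod.singFunctor.{u} P).IsEquivalence := { }
  refine ⟨(DgChMod.singFunctor P).asEquivalence, fun M => LinearEquiv.ofEq _ _ M.obj.sing_eq.symm,
    fun M => M.obj.isSingModule, fun _ _ _ _ => rfl, fun N => ?_⟩
  set E := (DgChMod.singFunctor.{u} P).asEquivalence
  let M := (E.inverse.obj N).obj
  let f : DgDMod.Hom N M.singDgDMod := E.counitIso.inv.app N
  let f' : DgDMod.Hom M.singDgDMod N := E.counitIso.hom.app N
  have h1 : f.toLin ∘ₗ f'.toLin = LinearMap.id :=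
    congrArg DgDMod.Hom.toLin (E.counitIso.hom_inv_id_app N)
  have h2 : f'.toLin ∘ₗ f.toLin = LinearMap.id :=
    congrArg DgDMod.Hom.toLin (E.counitIso.inv_hom_id_app N)
  -- The inverse functor is known only abstractly. This suffices, since every bounded module whose
  -- singular vectors are identified with N is induced from N, and the inverse of the counit
  -- provides the identification.
  obtain ⟨j, hj, hj'⟩ := M.exists_indEquiv (E.inverse.obj N).property N
    (LinearEquiv.ofLinearMap f.toLin f'.toLin h1 h2) (fun g n => by
      have := M.heisRep.singAct_coordOp g
      rw [← this]
      exact f.map_act _ _)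
  exact ⟨j, hj, hj'⟩

end
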